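/- Let $n\ge 1$ and $\rho>0$, let $\Delta=-\sum_{j=1}^n \partial^2/\partial x_j^2$ on $\mathbb R^n$, and for $\lambda\in\mathbb C$ let $\varphi_\lambda(x)=\int_{S^{n-1}}e^{i\lambda x\cdot\omega}\,d\sigma(\omega)$, where $\sigma$ is the surface measure on the unit sphere $S^{n-1}$ (counting measure on $\{-1,1\}$ if $n=1$). The function $\varphi_{i\rho}$ is real and strictly positive. Let $e^{-t\Delta}$ be convolution with the heat kernel $h_t(x)=(4\pi t)^{-n/2}e^{-|x|^2/(4t)}$ for $t>0$, and the identity for $t=0$. For $c\in\mathbb R$ and $1\le p\le\infty$ consider the semigroup of bounded operators $$\tilde T_t^c f=e^{ct}\,\varphi_{i\rho}^{-1}\,e^{-t(\Delta+\rho^2)}(\varphi_{i\rho}f),\qquad t\ge 0,$$ on the space $L^p(\mathbb R^n,\varphi_{i\rho}(x)^2dx)$ of complex-valued functions (for $p=\infty$ this is $L^\infty(\mathbb R^n)$). Call a family of bounded operators $(T_t)_{t\ge0}$ on a complex Banach space $B$ hypercyclic if $\{T_tv:t\ge0\}$ is dense in $B$ for some $v\in B$; call $v\in B$ a periodic point if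 $T_tv=v$ for some $t>0$; and call $(T_t)$ chaotic if it is hypercyclic and its periodic points are dense in $B$. Put $\gamma_p=|\tfrac2p-1|$ and $c_p=\rho^2(1-\gamma_p^2)$. Then: (a) For $2<p<\infty$ and $c\in\mathbb R$, $\tilde T_t^c$ is chaotic on $L^p(\mathbb R^n,\varphi_{i\rho}(x)^2dx)$ if and only if $c>c_p$. (b) For $p=\infty$, $\tilde T_t^c$ is not chaotic on $L^\infty(\mathbb R^n)$ for any $c\in\mathbb R$. (c) For $1\le p\le 2$ and any $c\in\mathbb R$, $\tilde T_t^c$ is not hypercyclic on $L^p(\mathbb R^n,\varphi_{i\rho}(x)^2dx)$ and has no nonzero periodic points there. -/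

import Mathlib

open MeasureTheory Set Metric
open scoped ENNReal NNReal RealInnerProductSpace

namespace HeatChaos

noncomputable section

section Dynamics

variable {B : Type*} [NormedAddCommGroup B] [NormedSpace ℂ B]

/-- The family `(T t)`, `t ≥ 0`, has a dense orbit `{T t v : t ≥ 0}`. -/
def IsHypercyclic (T : ℝ≥0 → B →L[ℂ] B) : Prop :=
  ∃ v : B, Dense (range fun t : ℝ≥0 => T t v)

/-- `v` is a periodic point: `T t v = v` for some `t > 0`. -/
def IsPeriodicPoint (T : ℝ≥0 → B →L[ℂ] B) (v : B) : Prop :=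
  ∃ t : ℝ≥0, 0 < t ∧ T t v = v

/-- Hypercyclic, with a dense set of periodic points. -/
def IsChaotic (T : ℝ≥0 → B →L[ℂ] B) : Prop :=
  IsHypercyclic T ∧ Dense {v : B | IsPeriodicPoint T v}

end Dynamics

/-- The Euclidean spherical function
`φ_lam (x) = ∫_{S^{n-1}} exp (i lam x·ω) dσ(ω)`, where `σ` is the surface measure of the unit
sphere (the counting measure of `{-1, 1}` if `n = 1`). -/
def sphericalFunction {n : ℕ} (lam : ℂ) (x : EuclideanSpace ℝ (Fin n)) : ℂ :=
  ∫ ω : sphere (0 : EuclideanSpace ℝ (Fin n)) 1,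
    Complex.exp (Complex.I * lam * ((⟪x, (ω : EuclideanSpace ℝ (Fin n))⟫ : ℝ) : ℂ))
    ∂(volume : Measure (EuclideanSpace ℝ (Fin n))).toSphere

/-- `φ_{iρ}` as a real-valued function; it takes real values by `sphericalFunction_I_mul`, and
positive ones by `phi_pos`. -/
def phi {n : ℕ} (ρ : ℝ) (x : EuclideanSpace ℝ (Fin n)) : ℝ :=
  (sphericalFunction (Complex.I * (ρ : ℂ)) x).re

/-- The measure `φ_{iρ}(x)² dx` on `ℝⁿ`. -/
def weightedMeasure (n : ℕ) (ρ : ℝ) : Measure (EuclideanSpace ℝ (Fin n)) :=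
  volume.withDensity fun x => ENNReal.ofReal (phi ρ x ^ 2)

/-- The heat kernel `h_t(x) = (4πt)^{-n/2} exp (-|x|²/(4t))` of `ℝⁿ`, for `t > 0`. -/
def heatKernel {n : ℕ} (t : ℝ) (x : EuclideanSpace ℝ (Fin n)) : ℝ :=
  (4 * Real.pi * t) ^ (-(n : ℝ) / 2) * Real.exp (-‖x‖ ^ 2 / (4 * t))

/-- The operator `e^{-t(Δ+ρ²)}`, where `Δ = -∑ ∂²/∂x_j²`: convolution with the heat kernel,
times `e^{-tρ²}`, for `t > 0`; the identity for `t = 0`. -/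
def heatOp {n : ℕ} (ρ : ℝ) (t : ℝ≥0) (g : EuclideanSpace ℝ (Fin n) → ℂ)
    (x : EuclideanSpace ℝ (Fin n)) : ℂ :=
  if t = 0 then g x
  else (Real.exp (-(t * ρ ^ 2)) : ℂ) * ∫ y, (heatKernel t (x - y) : ℂ) * g y

/-- `(e^{ct} φ_{iρ}⁻¹ e^{-t(Δ+ρ²)} (φ_{iρ} f)) (x)`, on functions. -/
def conjHeatFun {n : ℕ} (ρ c : ℝ) (t : ℝ≥0) (f : EuclideanSpace ℝ (Fin n) → ℂ)
    (x : EuclideanSpace ℝ (Fin n)) : ℂ :=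
  (Real.exp (c * t) : ℂ) * ((phi ρ x : ℂ)⁻¹ * heatOp ρ t (fun y => (phi ρ y : ℂ) * f y) x)

/-! Facts showing that `conjHeatFun` acts as a bounded operator on `L^p(ℝⁿ, φ_{iρ}(x)² dx)`. -/

section Facts

variable {n : ℕ}

theorem continuous_expInner (ρ : ℝ) :
    Continuous fun z : EuclideanSpace ℝ (Fin n) × sphere (0 : EuclideanSpace ℝ (Fin n)) 1 =>
      Real.exp (-(ρ * ⟪z.1, (z.2 : EuclideanSpace ℝ (Fin n))⟫)) := by
  fun_prop

theorem integrable_expInner (ρ : ℝ) (x : EuclideanSpace ℝ (Fin n)) :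
    Integrable (fun ω : sphere (0 : EuclideanSpace ℝ (Fin n)) 1 =>
      Real.exp (-(ρ * ⟪x, (ω : EuclideanSpace ℝ (Fin n))⟫)))
      (volume : Measure (EuclideanSpace ℝ (Fin n))).toSphere := by
  have hc : Continuous (fun ω : sphere (0 : EuclideanSpace ℝ (Fin n)) 1 =>
      Real.exp (-(ρ * ⟪x, (ω : EuclideanSpace ℝ (Fin n))⟫))) := by fun_prop
  exact hc.integrable_of_hasCompactSupport (HasCompactSupport.of_compactSpace _)

theorem sphericalFunction_I_mul_eq (ρ : ℝ) (x : EuclideanSpace ℝ (Fin n)) :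
    sphericalFunction (Complex.I * (ρ : ℂ)) x =
      ((∫ ω : sphere (0 : EuclideanSpace ℝ (Fin n)) 1,
        Real.exp (-(ρ * ⟪x, (ω : EuclideanSpace ℝ (Fin n))⟫))
        ∂(volume : Measure (EuclideanSpace ℝ (Fin n))).toSphere : ℝ) : ℂ) := by
  rw [sphericalFunction, ← integral_complex_ofReal]
  congr 1
  funext ω
  rw [Complex.ofReal_exp, ← mul_assoc, Complex.I_mul_I]
  push_cast
  ring_nf

theorem phi_eq (ρ : ℝ) (x : EuclideanSpace ℝ (Fin n)) :
    phi ρ x = ∫ ω : sphere (0 : EuclideanSpace ℝ (Fin n)) 1,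
        Real.exp (-(ρ * ⟪x, (ω : EuclideanSpace ℝ (Fin n))⟫))
        ∂(volume : Measure (EuclideanSpace ℝ (Fin n))).toSphere := by
  rw [phi, sphericalFunction_I_mul_eq, Complex.ofReal_re]

theorem sphericalFunction_I_mul (ρ : ℝ) (x : EuclideanSpace ℝ (Fin n)) :
    sphericalFunction (Complex.I * (ρ : ℂ)) x = (phi ρ x : ℂ) := by
  rw [phi_eq, sphericalFunction_I_mul_eq]

theorem ofReal_phi (ρ : ℝ) (x : EuclideanSpace ℝ (Fin n)) :
    ENNReal.ofReal (phi ρ x) = ∫⁻ ω : sphere (0 : EuclideanSpace ℝ (Fin n)) 1,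
        ENNReal.ofReal (Real.exp (-(ρ * ⟪x, (ω : EuclideanSpace ℝ (Fin n))⟫)))
        ∂(volume : Measure (EuclideanSpace ℝ (Fin n))).toSphere := by
  rw [phi_eq, ofReal_integral_eq_lintegral_ofReal (integrable_expInner ρ x)]
  exact Filter.Eventually.of_forall fun _ => (Real.exp_pos _).le

theorem phi_pos [NeZero n] (ρ : ℝ) (x : EuclideanSpace ℝ (Fin n)) : 0 < phi ρ x := by
  rw [phi_eq]
  have : NeZero (volume : Measure (EuclideanSpace ℝ (Fin n))).toSphere :=
    ⟨Measure.toSphere_ne_zero _⟩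
  exact integral_exp_pos (integrable_expInner ρ x)

theorem measurable_phi (ρ : ℝ) : Measurable (phi ρ : EuclideanSpace ℝ (Fin n) → ℝ) := by
  have h : StronglyMeasurable fun x : EuclideanSpace ℝ (Fin n) => phi ρ x := by
    simp_rw [phi_eq]
    exact (continuous_expInner ρ).stronglyMeasurable.integral_prod_right
  exact h.measurable

theorem measurable_weight (ρ : ℝ) :
    Measurable fun x : EuclideanSpace ℝ (Fin n) => ENNReal.ofReal (phi ρ x ^ 2) :=
  ((measurable_phi ρ).pow_const 2).ennreal_ofReal

theorem weighted_ac (ρ : ℝ) : weightedMeasure n ρ ≪ volume :=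
  withDensity_absolutelyContinuous _ _

theorem ac_weighted [NeZero n] (ρ : ℝ) : volume ≪ weightedMeasure n ρ := by
  refine withDensity_absolutelyContinuous' (measurable_weight ρ).aemeasurable ?_
  refine Filter.Eventually.of_forall fun x => ?_
  have := phi_pos ρ x
  simp only [ne_eq, ENNReal.ofReal_eq_zero, not_le]
  positivity

theorem heatKernel_nonneg {t : ℝ} (ht : 0 < t) (x : EuclideanSpace ℝ (Fin n)) :
    0 ≤ heatKernel t x := by
  unfold heatKernel
  positivity

theorem continuous_heatKernel (t : ℝ) :
    Continuous (heatKernel t : EuclideanSpace ℝ (Fin n) → ℝ) := by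
  unfold heatKernel
  fun_prop

theorem lintegral_heatKernel {t : ℝ} (ht : 0 < t) :
    ∫⁻ x : EuclideanSpace ℝ (Fin n), ENNReal.ofReal (heatKernel t x) = 1 := by
  have hb : 0 < 1 / (4 * t) := by positivity
  have h1 := GaussianFourier.integral_rexp_neg_mul_sq_norm (V := EuclideanSpace ℝ (Fin n)) hb
  have h2 : ∫ x : EuclideanSpace ℝ (Fin n), heatKernel t x = 1 := by
    have : ∀ x : EuclideanSpace ℝ (Fin n), heatKernel t x =
        (4 * Real.pi * t) ^ (-(n : ℝ) / 2) * Real.exp (-(1 / (4 * t)) * ‖x‖ ^ 2) := by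
      intro x
      unfold heatKernel
      congr 2
      ring
    simp_rw [this]
    rw [integral_const_mul, h1, finrank_euclideanSpace_fin]
    have e : Real.pi / (1 / (4 * t)) = 4 * Real.pi * t := by field_simp
    rw [e, ← Real.rpow_add (by positivity)]
    simp [neg_div]
  have h3 : Integrable (fun x : EuclideanSpace ℝ (Fin n) => heatKernel t x) := by
    by_contra h
    rw [integral_undef h] at h2
    exact zero_ne_one h2
  rw [← ofReal_integral_eq_lintegral_ofReal h3
    (Filter.Eventually.of_forall fun x => heatKernel_nonneg ht x), h2, ENNReal.ofReal_one]

/-- `e^{-t(Δ+ρ²)}` fixes the exponentials `e^{-ρ y·ω}`. -/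
theorem lintegral_heat_exp {t : ℝ} (ht : 0 < t) (ρ : ℝ) (x ω : EuclideanSpace ℝ (Fin n))
    (hω : ‖ω‖ = 1) :
    ∫⁻ y, ENNReal.ofReal (Real.exp (-(t * ρ ^ 2)) * heatKernel t (x - y)) *
      ENNReal.ofReal (Real.exp (-(ρ * ⟪y, ω⟫))) =
      ENNReal.ofReal (Real.exp (-(ρ * ⟪x, ω⟫))) := by
  have key : ∀ y : EuclideanSpace ℝ (Fin n),
      ENNReal.ofReal (Real.exp (-(t * ρ ^ 2)) * heatKernel t (x - y)) *
        ENNReal.ofReal (Real.exp (-(ρ * ⟪y, ω⟫))) =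
      ENNReal.ofReal (Real.exp (-(ρ * ⟪x, ω⟫))) *
        ENNReal.ofReal (heatKernel t ((x - (2 * t * ρ) • ω) - y)) := by
    intro y
    rw [← ENNReal.ofReal_mul (by have := heatKernel_nonneg ht (x - y); positivity),
      ← ENNReal.ofReal_mul (by positivity)]
    congr 1
    unfold heatKernel
    have hn : ‖x - (2 * t * ρ) • ω - y‖ ^ 2 =
        ‖x - y‖ ^ 2 - 4 * t * ρ * (⟪x, ω⟫ - ⟪y, ω⟫) + 4 * t ^ 2 * ρ ^ 2 := by
      have : x - (2 * t * ρ) • ω - y = (x - y) - (2 * t * ρ) • ω := by abel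
      rw [this, norm_sub_sq_real, inner_smul_right, norm_smul, mul_pow, hω, inner_sub_left,
        Real.norm_eq_abs, sq_abs]
      ring
    rw [hn]
    have : Real.exp (-(t * ρ ^ 2)) * ((4 * Real.pi * t) ^ (-(n : ℝ) / 2) *
        Real.exp (-‖x - y‖ ^ 2 / (4 * t))) * Real.exp (-(ρ * ⟪y, ω⟫)) =
        (4 * Real.pi * t) ^ (-(n : ℝ) / 2) * Real.exp
          (-(t * ρ ^ 2) + -‖x - y‖ ^ 2 / (4 * t) + -(ρ * ⟪y, ω⟫)) := by
      rw [Real.exp_add, Real.exp_add]; ring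
    rw [this, mul_left_comm (Real.exp _), ← Real.exp_add]
    congr 2
    field_simp
    ring
  simp_rw [key]
  have hm : Measurable fun y : EuclideanSpace ℝ (Fin n) =>
      ENNReal.ofReal (heatKernel t ((x - (2 * t * ρ) • ω) - y)) :=
    ((continuous_heatKernel t).comp (by fun_prop)).measurable.ennreal_ofReal
  rw [lintegral_const_mul _ hm,
    lintegral_sub_left_eq_self (fun z => ENNReal.ofReal (heatKernel t z)) _,
    lintegral_heatKernel ht, mul_one]

/-- `e^{-t(Δ+ρ²)}` fixes `φ_{iρ}`. -/
theorem lintegral_heat_phi {t : ℝ} (ht : 0 < t) (ρ : ℝ) (x : EuclideanSpace ℝ (Fin n)) :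
    ∫⁻ y, ENNReal.ofReal (Real.exp (-(t * ρ ^ 2)) * heatKernel t (x - y)) *
      ENNReal.ofReal (phi ρ y) = ENNReal.ofReal (phi ρ x) := by
  have hk : Measurable fun y : EuclideanSpace ℝ (Fin n) =>
      ENNReal.ofReal (Real.exp (-(t * ρ ^ 2)) * heatKernel t (x - y)) :=
    (((continuous_heatKernel t).comp
      (by fun_prop : Continuous fun y => x - y)).const_mul _).measurable.ennreal_ofReal
  have he := (continuous_expInner (n := n) ρ).measurable.ennreal_ofReal
  simp_rw [ofReal_phi]
  have : ∀ y : EuclideanSpace ℝ (Fin n),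
      ENNReal.ofReal (Real.exp (-(t * ρ ^ 2)) * heatKernel t (x - y)) *
      (∫⁻ ω : sphere (0 : EuclideanSpace ℝ (Fin n)) 1,
        ENNReal.ofReal (Real.exp (-(ρ * ⟪y, (ω : EuclideanSpace ℝ (Fin n))⟫)))
        ∂(volume : Measure (EuclideanSpace ℝ (Fin n))).toSphere) =
      ∫⁻ ω : sphere (0 : EuclideanSpace ℝ (Fin n)) 1,
        ENNReal.ofReal (Real.exp (-(t * ρ ^ 2)) * heatKernel t (x - y)) *
        ENNReal.ofReal (Real.exp (-(ρ * ⟪y, (ω : EuclideanSpace ℝ (Fin n))⟫)))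
        ∂(volume : Measure (EuclideanSpace ℝ (Fin n))).toSphere := fun y =>
    (lintegral_const_mul _ (he.comp measurable_prodMk_left)).symm
  simp_rw [this]
  rw [lintegral_lintegral_swap ((hk.comp measurable_fst).mul he).aemeasurable]
  refine lintegral_congr fun ω => ?_
  exact lintegral_heat_exp ht ρ x ω (by simp)

/-- The transition density of `φ_{iρ}⁻¹ e^{-t(Δ+ρ²)} φ_{iρ}` with respect to Lebesgue measure. -/
def transDensity (ρ t : ℝ) (x y : EuclideanSpace ℝ (Fin n)) : ℝ :=
  (phi ρ x)⁻¹ * (Real.exp (-(t * ρ ^ 2)) * heatKernel t (x - y)) * phi ρ y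

theorem transDensity_nonneg [NeZero n] {t : ℝ} (ht : 0 < t) (ρ : ℝ)
    (x y : EuclideanSpace ℝ (Fin n)) : 0 ≤ transDensity ρ t x y := by
  have := heatKernel_nonneg ht (x - y)
  have := phi_pos ρ x
  have := phi_pos ρ y
  unfold transDensity
  positivity

theorem measurable_transDensity (ρ t : ℝ) : Measurable
    (Function.uncurry (transDensity ρ t : EuclideanSpace ℝ (Fin n) → _ → ℝ)) := by
  have h1 : Measurable fun z : EuclideanSpace ℝ (Fin n) × EuclideanSpace ℝ (Fin n) =>
      heatKernel t (z.1 - z.2) :=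
    ((continuous_heatKernel t).comp (by fun_prop)).measurable
  exact (((measurable_phi ρ).comp measurable_fst).inv.mul (h1.const_mul _)).mul
    ((measurable_phi ρ).comp measurable_snd)

/-- The transition probabilities of `φ_{iρ}⁻¹ e^{-t(Δ+ρ²)} φ_{iρ}`. -/
def transMeasure (ρ t : ℝ) (x : EuclideanSpace ℝ (Fin n)) :
    Measure (EuclideanSpace ℝ (Fin n)) :=
  volume.withDensity fun y => ENNReal.ofReal (transDensity ρ t x y)

theorem measurable_transDensity_right (ρ t : ℝ) (x : EuclideanSpace ℝ (Fin n)) :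
    Measurable fun y => ENNReal.ofReal (transDensity ρ t x y) :=
  ((measurable_transDensity ρ t).comp measurable_prodMk_left).ennreal_ofReal

theorem isProbabilityMeasure_transMeasure [NeZero n] {t : ℝ} (ht : 0 < t) (ρ : ℝ)
    (x : EuclideanSpace ℝ (Fin n)) : IsProbabilityMeasure (transMeasure ρ t x) := by
  refine ⟨?_⟩
  have hx := phi_pos ρ x
  rw [transMeasure, withDensity_apply _ MeasurableSet.univ, Measure.restrict_univ]
  have : ∀ y, ENNReal.ofReal (transDensity ρ t x y) = ENNReal.ofReal (phi ρ x)⁻¹ *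
      (ENNReal.ofReal (Real.exp (-(t * ρ ^ 2)) * heatKernel t (x - y)) *
        ENNReal.ofReal (phi ρ y)) := by
    intro y
    have := heatKernel_nonneg ht (x - y)
    rw [← ENNReal.ofReal_mul (by positivity), ← ENNReal.ofReal_mul (by positivity)]
    congr 1
    unfold transDensity
    ring
  simp_rw [this]
  rw [lintegral_const_mul' _ _ ENNReal.ofReal_ne_top, lintegral_heat_phi ht,
    ← ENNReal.ofReal_mul (by positivity), inv_mul_cancel₀ hx.ne', ENNReal.ofReal_one]

/-- The measure `φ_{iρ}(x)² dx` is invariant. -/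
theorem lintegral_weighted_trans [NeZero n] {t : ℝ} (ht : 0 < t) (ρ : ℝ)
    (y : EuclideanSpace ℝ (Fin n)) :
    ∫⁻ x, ENNReal.ofReal (phi ρ x ^ 2) * ENNReal.ofReal (transDensity ρ t x y) =
      ENNReal.ofReal (phi ρ y ^ 2) := by
  have hy := phi_pos ρ y
  have : ∀ x, ENNReal.ofReal (phi ρ x ^ 2) * ENNReal.ofReal (transDensity ρ t x y) =
      ENNReal.ofReal (phi ρ y) *
      (ENNReal.ofReal (Real.exp (-(t * ρ ^ 2)) * heatKernel t (y - x)) *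
        ENNReal.ofReal (phi ρ x)) := by
    intro x
    have hx := phi_pos ρ x
    have := heatKernel_nonneg ht (y - x)
    have e : heatKernel t (x - y) = heatKernel t (y - x) := by
      unfold heatKernel
      rw [norm_sub_rev]
    rw [← ENNReal.ofReal_mul (by positivity), ← ENNReal.ofReal_mul (by positivity),
      ← ENNReal.ofReal_mul (by positivity)]
    congr 1
    unfold transDensity
    rw [e]
    field_simp
  simp_rw [this]
  rw [lintegral_const_mul' _ _ ENNReal.ofReal_ne_top, lintegral_heat_phi ht,
    ← ENNReal.ofReal_mul hy.le, sq]

theorem lintegral_lintegral_trans [NeZero n] {t : ℝ} (ht : 0 < t) (ρ : ℝ)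
    {F : EuclideanSpace ℝ (Fin n) → ℝ≥0∞} (hF : Measurable F) :
    ∫⁻ x, ∫⁻ y, F y ∂transMeasure ρ t x ∂weightedMeasure n ρ =
      ∫⁻ y, F y ∂weightedMeasure n ρ := by
  have hT : Measurable fun z : EuclideanSpace ℝ (Fin n) × EuclideanSpace ℝ (Fin n) =>
      ENNReal.ofReal (transDensity ρ t z.1 z.2) :=
    (measurable_transDensity (n := n) ρ t).ennreal_ofReal
  have h1 : ∀ x, ∫⁻ y, F y ∂transMeasure ρ t x =
      ∫⁻ y, ENNReal.ofReal (transDensity ρ t x y) * F y := fun x => by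
    rw [transMeasure, lintegral_withDensity_eq_lintegral_mul _
      (measurable_transDensity_right ρ t x) hF]
    rfl
  have hmeas : Measurable fun z : EuclideanSpace ℝ (Fin n) × EuclideanSpace ℝ (Fin n) =>
      ENNReal.ofReal (transDensity ρ t z.1 z.2) * F z.2 := by
    exact Measurable.mul hT (hF.comp measurable_snd)
  have hin : Measurable fun x : EuclideanSpace ℝ (Fin n) =>
      ∫⁻ y, ENNReal.ofReal (transDensity ρ t x y) * F y := hmeas.lintegral_prod_right'
  have hbig : Measurable (Function.uncurry fun (x y : EuclideanSpace ℝ (Fin n)) =>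
      ENNReal.ofReal (phi ρ x ^ 2) * (ENNReal.ofReal (transDensity ρ t x y) * F y)) :=
    by exact Measurable.mul ((measurable_weight ρ).comp measurable_fst) hmeas
  have hw : ∀ {G : EuclideanSpace ℝ (Fin n) → ℝ≥0∞}, Measurable G →
      ∫⁻ x, G x ∂weightedMeasure n ρ = ∫⁻ x, ENNReal.ofReal (phi ρ x ^ 2) * G x := fun hG => by
    rw [weightedMeasure, lintegral_withDensity_eq_lintegral_mul _ (measurable_weight ρ) hG]
    rfl
  simp_rw [h1]
  rw [hw hin, hw hF]
  have h2 : ∀ x, ENNReal.ofReal (phi ρ x ^ 2) *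
      ∫⁻ y, ENNReal.ofReal (transDensity ρ t x y) * F y =
      ∫⁻ y, ENNReal.ofReal (phi ρ x ^ 2) * (ENNReal.ofReal (transDensity ρ t x y) * F y) :=
    fun x => (lintegral_const_mul' _ _ ENNReal.ofReal_ne_top).symm
  have h4 : ∀ y, ∫⁻ x, ENNReal.ofReal (phi ρ x ^ 2) *
      (ENNReal.ofReal (transDensity ρ t x y) * F y) = ENNReal.ofReal (phi ρ y ^ 2) * F y := by
    intro y
    have h6 : Measurable fun x : EuclideanSpace ℝ (Fin n) => (x, y) := measurable_prodMk_right
    have h7 : Measurable fun x : EuclideanSpace ℝ (Fin n) =>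
        ENNReal.ofReal (transDensity ρ t x y) := 
      ((measurable_transDensity ρ t).comp h6).ennreal_ofReal
    have h3 : Measurable fun x : EuclideanSpace ℝ (Fin n) => ENNReal.ofReal (phi ρ x ^ 2) *
        ENNReal.ofReal (transDensity ρ t x y) := by
      exact Measurable.mul (measurable_weight ρ) h7
    simp_rw [← mul_assoc]
    rw [lintegral_mul_const _ h3, lintegral_weighted_trans ht]
  have h5 := lintegral_lintegral_swap (μ := volume) (ν := volume) hbig.aemeasurable
  simp_rw [h4] at h5
  simp_rw [h2]
  exact h5

theorem conjHeatFun_zero [NeZero n] (ρ c : ℝ) (f : EuclideanSpace ℝ (Fin n) → ℂ) :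
    conjHeatFun ρ c 0 f = f := by
  funext x
  have : (phi ρ x : ℂ) ≠ 0 := by exact_mod_cast (phi_pos ρ x).ne'
  simp [conjHeatFun, heatOp, this]

theorem conjHeatFun_eq [NeZero n] (ρ c : ℝ) {t : ℝ≥0} (ht : 0 < t)
    (f : EuclideanSpace ℝ (Fin n) → ℂ) (x : EuclideanSpace ℝ (Fin n)) :
    conjHeatFun ρ c t f x = (Real.exp (c * t) : ℂ) * ∫ y, f y ∂transMeasure ρ t x := by
  have ht' : (0 : ℝ) < t := by exact_mod_cast ht
  rw [conjHeatFun, heatOp, if_neg ht.ne', transMeasure,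
    integral_withDensity_eq_integral_toReal_smul (measurable_transDensity_right ρ t x)
      (Filter.Eventually.of_forall fun _ => ENNReal.ofReal_lt_top), ← mul_assoc _ _ (∫ y, _),
      ← integral_const_mul]
  congr 2
  funext y
  rw [ENNReal.toReal_ofReal (transDensity_nonneg ht' ρ x y), transDensity, Complex.real_smul]
  push_cast
  ring

theorem conjHeatFun_congr (ρ c : ℝ) {t : ℝ≥0} (ht : 0 < t)
    {f g : EuclideanSpace ℝ (Fin n) → ℂ} (h : f =ᵐ[volume] g) (x : EuclideanSpace ℝ (Fin n)) :
    conjHeatFun ρ c t f x = conjHeatFun ρ c t g x := by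
  have : ∫ y, (heatKernel t (x - y) : ℂ) * ((phi ρ y : ℂ) * f y) =
      ∫ y, (heatKernel t (x - y) : ℂ) * ((phi ρ y : ℂ) * g y) := by
    refine integral_congr_ae ?_
    filter_upwards [h] with y hy
    rw [hy]
  simp only [conjHeatFun, heatOp, if_neg ht.ne', this]

theorem stronglyMeasurable_conjHeatFun (ρ c : ℝ) (t : ℝ≥0)
    {f : EuclideanSpace ℝ (Fin n) → ℂ} (hf : StronglyMeasurable f) :
    StronglyMeasurable (conjHeatFun ρ c t f) := by
  have hphi : Measurable fun x : EuclideanSpace ℝ (Fin n) => (phi ρ x : ℂ) :=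
    Complex.measurable_ofReal.comp (measurable_phi ρ)
  have h0 : Measurable (heatOp ρ t (fun y => (phi ρ y : ℂ) * f y)) := by
    unfold heatOp
    by_cases ht : t = 0
    · simp only [ht, if_true]
      exact hphi.mul hf.measurable
    · simp only [ht, if_false]
      have h1 : Measurable fun z : EuclideanSpace ℝ (Fin n) × EuclideanSpace ℝ (Fin n) =>
          (heatKernel t (z.1 - z.2) : ℂ) * ((phi ρ z.2 : ℂ) * f z.2) :=
        (Complex.measurable_ofReal.comp
          ((continuous_heatKernel t).comp (by fun_prop)).measurable).mul
          ((hphi.mul hf.measurable).comp measurable_snd)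
      exact h1.stronglyMeasurable.integral_prod_right.measurable.const_mul _
  exact ((hphi.inv.mul h0).const_mul _).stronglyMeasurable

theorem eLpNorm_integral_trans_le [NeZero n] {t : ℝ} (ht : 0 < t) (ρ : ℝ) {p : ℝ≥0∞}
    (hp : 1 ≤ p) {f : EuclideanSpace ℝ (Fin n) → ℂ} (hf : StronglyMeasurable f) :
    eLpNorm (fun x => ∫ y, f y ∂transMeasure ρ t x) p (weightedMeasure n ρ) ≤
      eLpNorm f p (weightedMeasure n ρ) := by
  have hJ : ∀ x, ‖∫ y, f y ∂transMeasure ρ t x‖ₑ ≤ eLpNorm f p (transMeasure ρ t x) := by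
    intro x
    have := isProbabilityMeasure_transMeasure ht ρ x
    refine (enorm_integral_le_lintegral_enorm f).trans ?_
    rw [← eLpNorm_one_eq_lintegral_enorm]
    exact eLpNorm_le_eLpNorm_of_exponent_le hp hf.aestronglyMeasurable
  by_cases hpt : p = ∞
  · subst hpt
    simp only [eLpNorm_exponent_top] at hJ ⊢
    refine essSup_le_of_ae_le _ (Filter.Eventually.of_forall fun x => (hJ x).trans ?_)
    refine eLpNormEssSup_mono_measure f ?_
    exact (withDensity_absolutelyContinuous _ _).trans (ac_weighted ρ)
  · have hp0 : p ≠ 0 := (zero_lt_one.trans_le hp).ne'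
    have hpos : 0 < p.toReal := ENNReal.toReal_pos hp0 hpt
    rw [eLpNorm_eq_lintegral_rpow_enorm_toReal hp0 hpt,
      eLpNorm_eq_lintegral_rpow_enorm_toReal hp0 hpt]
    refine ENNReal.rpow_le_rpow ?_ (by positivity)
    rw [← lintegral_lintegral_trans ht ρ (hf.enorm.pow_const p.toReal)]
    refine lintegral_mono fun x => ?_
    have h := ENNReal.rpow_le_rpow (hJ x) hpos.le
    rw [eLpNorm_eq_lintegral_rpow_enorm_toReal hp0 hpt, ← ENNReal.rpow_mul,
      one_div, inv_mul_cancel₀ hpos.ne', ENNReal.rpow_one] at h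
    exact h

theorem ae_integrable_trans [NeZero n] {t : ℝ} (ht : 0 < t) (ρ : ℝ) {p : ℝ≥0∞}
    (hp : 1 ≤ p) {f : EuclideanSpace ℝ (Fin n) → ℂ} (hf : StronglyMeasurable f)
    (hfp : MemLp f p (weightedMeasure n ρ)) :
    ∀ᵐ x ∂weightedMeasure n ρ, Integrable f (transMeasure ρ t x) := by
  have hall : ∀ᵐ x ∂weightedMeasure n ρ, MemLp f p (transMeasure ρ t x) := by
    by_cases hpt : p = ∞
    · subst hpt
      refine Filter.Eventually.of_forall fun x => ⟨hf.aestronglyMeasurable, ?_⟩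
      refine lt_of_le_of_lt ?_ hfp.2
      simp only [eLpNorm_exponent_top]
      exact eLpNormEssSup_mono_measure f
        ((withDensity_absolutelyContinuous _ _).trans (ac_weighted ρ))
    · have hp0 : p ≠ 0 := (zero_lt_one.trans_le hp).ne'
      have hF := hf.enorm.pow_const p.toReal
      have h1 := lintegral_lintegral_trans ht ρ hF
      have h2 : ∫⁻ y, ‖f y‖ₑ ^ p.toReal ∂weightedMeasure n ρ < ∞ :=
        lintegral_rpow_enorm_lt_top_of_eLpNorm_lt_top hp0 hpt hfp.2
      have hm : Measurable fun x => ∫⁻ y, ‖f y‖ₑ ^ p.toReal ∂transMeasure ρ t x := by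
        have : ∀ x, ∫⁻ y, ‖f y‖ₑ ^ p.toReal ∂transMeasure ρ t x =
            ∫⁻ y, ENNReal.ofReal (transDensity ρ t x y) * ‖f y‖ₑ ^ p.toReal := fun x => by
          rw [transMeasure, lintegral_withDensity_eq_lintegral_mul _
            (measurable_transDensity_right ρ t x) hF]
          rfl
        simp_rw [this]
        exact Measurable.lintegral_prod_right
          ((measurable_transDensity ρ t).ennreal_ofReal.mul (hF.comp measurable_snd))
      filter_upwards [ae_lt_top hm (by rw [h1]; exact h2.ne)] with x hx
      exact ⟨hf.aestronglyMeasurable,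
        (eLpNorm_lt_top_iff_lintegral_rpow_enorm_lt_top hp0 hpt).2 hx⟩
  filter_upwards [hall] with x hx
  have := isProbabilityMeasure_transMeasure ht ρ x
  exact hx.integrable hp

theorem eLpNorm_conjHeatFun_le [NeZero n] (ρ c : ℝ) (t : ℝ≥0) {p : ℝ≥0∞}
    (hp : 1 ≤ p) {f : EuclideanSpace ℝ (Fin n) → ℂ} (hf : StronglyMeasurable f) :
    eLpNorm (conjHeatFun ρ c t f) p (weightedMeasure n ρ) ≤
      ENNReal.ofReal (Real.exp (c * t)) * eLpNorm f p (weightedMeasure n ρ) := by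
  rcases eq_or_ne t 0 with rfl | ht
  · simp [conjHeatFun_zero]
  · have ht' : 0 < t := pos_iff_ne_zero.2 ht
    have he : conjHeatFun ρ c t f =
        (Real.exp (c * t) : ℂ) • fun x => ∫ y, f y ∂transMeasure ρ t x := by
      funext x
      rw [conjHeatFun_eq ρ c ht']
      rfl
    rw [he, eLpNorm_const_smul]
    have h1 : ‖(Real.exp (c * t) : ℂ)‖ₑ = ENNReal.ofReal (Real.exp (c * t)) := by
      rw [← ofReal_norm, Complex.norm_real, Real.norm_of_nonneg (Real.exp_pos _).le]
    rw [h1]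
    gcongr
    exact eLpNorm_integral_trans_le (by exact_mod_cast ht') ρ hp hf

theorem memLp_conjHeatFun [NeZero n] (ρ c : ℝ) (t : ℝ≥0) {p : ℝ≥0∞} [hp : Fact (1 ≤ p)]
    (f : Lp ℂ p (weightedMeasure n ρ)) :
    MemLp (conjHeatFun ρ c t f) p (weightedMeasure n ρ) := by
  have hf := Lp.stronglyMeasurable f
  refine ⟨(stronglyMeasurable_conjHeatFun ρ c t hf).aestronglyMeasurable, ?_⟩
  exact (eLpNorm_conjHeatFun_le ρ c t hp.out hf).trans_lt
    (ENNReal.mul_lt_top ENNReal.ofReal_lt_top (Lp.memLp f).2)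

theorem conjHeatFun_add [NeZero n] (ρ c : ℝ) (t : ℝ≥0) {p : ℝ≥0∞} [hp : Fact (1 ≤ p)]
    (f g : Lp ℂ p (weightedMeasure n ρ)) :
    conjHeatFun ρ c t (f + g : Lp ℂ p (weightedMeasure n ρ)) =ᵐ[weightedMeasure n ρ]
      fun x => conjHeatFun ρ c t f x + conjHeatFun ρ c t g x := by
  rcases eq_or_ne t 0 with rfl | ht
  · simp only [conjHeatFun_zero]
    exact Lp.coeFn_add f g
  · have ht' : 0 < t := pos_iff_ne_zero.2 ht
    have ht'' : (0 : ℝ) < t := by exact_mod_cast ht'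
    filter_upwards [ae_integrable_trans ht'' ρ hp.out (Lp.stronglyMeasurable f) (Lp.memLp f),
      ae_integrable_trans ht'' ρ hp.out (Lp.stronglyMeasurable g) (Lp.memLp g)] with x hx hy
    rw [conjHeatFun_congr ρ c ht' ((ac_weighted ρ).ae_le (Lp.coeFn_add f g)) x,
      conjHeatFun_eq ρ c ht', conjHeatFun_eq ρ c ht', conjHeatFun_eq ρ c ht', ← mul_add,
      ← integral_add hx hy]
    rfl

theorem conjHeatFun_smul [NeZero n] (ρ c : ℝ) (t : ℝ≥0) {p : ℝ≥0∞} (a : ℂ)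
    (f : Lp ℂ p (weightedMeasure n ρ)) :
    conjHeatFun ρ c t (a • f : Lp ℂ p (weightedMeasure n ρ)) =ᵐ[weightedMeasure n ρ]
      fun x => a * conjHeatFun ρ c t f x := by
  rcases eq_or_ne t 0 with rfl | ht
  · simp only [conjHeatFun_zero]
    exact Lp.coeFn_smul a f
  · have ht' : 0 < t := pos_iff_ne_zero.2 ht
    refine Filter.Eventually.of_forall fun x => ?_
    show _ = a * conjHeatFun ρ c t f x
    rw [conjHeatFun_congr ρ c ht' ((ac_weighted ρ).ae_le (Lp.coeFn_smul a f)) x,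
      conjHeatFun_eq ρ c ht', conjHeatFun_eq ρ c ht', mul_left_comm,
      ← integral_const_mul a]
    rfl

end Facts

/-- The operator `T̃_t^c = e^{ct} φ_{iρ}⁻¹ e^{-t(Δ+ρ²)} (φ_{iρ} ·)` on the Banach space
`L^p(ℝⁿ, φ_{iρ}(x)² dx)` of complex-valued functions, `1 ≤ p ≤ ∞`. For `p = ∞` this space is
`L^∞(ℝⁿ)`, since `φ_{iρ}(x)² dx` has the null sets of Lebesgue measure. -/
def conjHeat {n : ℕ} [NeZero n] (ρ : ℝ) (p : ℝ≥0∞) [hp : Fact (1 ≤ p)] (c : ℝ) (t : ℝ≥0) :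
    Lp ℂ p (weightedMeasure n ρ) →L[ℂ] Lp ℂ p (weightedMeasure n ρ) :=
  LinearMap.mkContinuous
    { toFun := fun f => (memLp_conjHeatFun ρ c t f).toLp (conjHeatFun ρ c t f)
      map_add' := fun f g => by
        rw [← MemLp.toLp_add]
        exact MemLp.toLp_congr _ _ (conjHeatFun_add ρ c t f g)
      map_smul' := fun a f => by
        rw [RingHom.id_apply, ← MemLp.toLp_const_smul]
        exact MemLp.toLp_congr _ _ (conjHeatFun_smul ρ c t a f) }
    (Real.exp (c * t))
    (fun f => by
      have h := eLpNorm_conjHeatFun_le ρ c t hp.out (Lp.stronglyMeasurable f)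
      have h2 := ENNReal.toReal_mono
        (ENNReal.mul_lt_top ENNReal.ofReal_lt_top (Lp.memLp f).2).ne h
      rw [ENNReal.toReal_mul, ENNReal.toReal_ofReal (Real.exp_pos _).le, ← Lp.norm_def] at h2
      simpa [Lp.norm_toLp] using h2)

/-- `γ_p = |2/p - 1|`. -/
def gammaExp (p : ℝ≥0∞) : ℝ := |2 / p.toReal - 1|

/-- `c_p = ρ² (1 - γ_p²)`. -/
def criticalConst (ρ : ℝ) (p : ℝ≥0∞) : ℝ := ρ ^ 2 * (1 - gammaExp p ^ 2)

end

end HeatChaos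

/-!
Write `φ = φ_{iρ}` and `γ = 1 - 2/p`.

**Chaos for `2 < p < ∞` and `c > c_p`.** The functions `φ⁻¹ exp (a x·ω)`, `|ω| = 1`, are
eigenfunctions of `T̃_t^c` with eigenvalue `exp (t (c - ρ² + a²))`. Since `φ` grows almost like
`e^{ρ|x|}` (`exists_mul_exp_le_phi`), they lie in `L^p (φ² dx)` as soon as `|Re a| < γρ`. A
functional that annihilates them for all `ω` and for a set of exponents `a` with an accumulation
point annihilates them for all `a` in the strip by analyticity; on the imaginary axis this says
that a Fourier transform vanishes, so that the functional is zero. The condition `c > c_p` says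
exactly that the curve `Re (c - ρ² + a²) = 0` meets the strip, so the eigenfunctions that grow
under the semigroup, those that decay and those that are periodic each span a dense subspace. The
Desch-Schappacher-Webb criterion `isChaotic_of_eigenvectors` then yields chaos
(`isChaotic_conjHeat`).

**No hypercyclicity for `2 < p < ∞` and `c ≤ c_p`.** Hölder's inequality bounds `T̃_t^c f` on the
unit ball by `e^{(c - ρ²) t} (∫ h_t^q φ^{2-q})^{1/q} ‖f‖`, where `q` is the conjugate exponent.
The sharp bound `φ(x) ≤ C e^{ρ|x|} (1 + ρ|x|)^{-(n-1)/2}` (`exists_phi_sq_mul_le`) shows that the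
last integral is at most a constant times `e^{q γ² ρ² t}` (`exists_lintegral_heatKernel_rpow_le`).
So at `c ≤ c_p`, the critical constant included, every orbit is bounded under the functional `f ↦
∫_{|x|<1} f φ² dx` (`not_isHypercyclic_of_le`).

**`p = ∞`.** A periodic point equals its image under `T̃_t^c` for some `t > 0`, so it is a
continuous function, and the indicator of the unit ball is not a uniform limit of continuous
functions (`not_dense_periodic_top`).

**`1 ≤ p ≤ 2`.** Put `G = φ f`. Then `G` is integrable if `p < 2`, and square integrable if `p =
2`. In both cases the heat semigroup multiplies the Fourier transform of `G` by `exp (-4π²t|ξ|²)`.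
For a periodic point `𝓕 G` is supported on a sphere, a null set, and is therefore zero. For `p <
2` the functional `f ↦ ∫ φ f dx` maps every orbit into a ray, and for `p = 2` the operators are
positive on a Hilbert space, so that the orbit of `v` stays away from `-v`; neither orbit is
dense.
-/

namespace HeatChaos

/-! ### Dynamics of one-parameter families of operators -/

section AbstractDynamics

open Filter Topology

variable {B : Type*} [NormedAddCommGroup B] [NormedSpace ℂ B]

theorem not_isHypercyclic_of_functional {T : ℝ≥0 → B →L[ℂ] B} (l : B →L[ℂ] ℂ) (hl : l ≠ 0)
    (h : ∀ v, ¬ Dense (range fun t : ℝ≥0 => l (T t v))) : ¬ IsHypercyclic T := by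
  rintro ⟨v, hv⟩
  refine h v ?_
  have hs : Function.Surjective l := LinearMap.surjective (f := l.toLinearMap) fun h0 =>
    hl (by ext x; exact LinearMap.congr_fun h0 x)
  have := hs.denseRange.dense_image l.continuous hv
  rwa [← range_comp] at this

/-- A subset of the complex plane all of whose points have real part bounded below is not dense. -/
theorem not_dense_of_le_re {s : Set ℂ} (K : ℝ) (h : ∀ z ∈ s, K ≤ z.re) : ¬ Dense s := by
  intro hd
  have h1 : closure s ⊆ {z : ℂ | K ≤ z.re} :=
    closure_minimal h (isClosed_le continuous_const Complex.continuous_re)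
  have h2 := h1 (hd ((K - 1 : ℝ) : ℂ))
  simp only [mem_ofPred_eq, Complex.ofReal_re] at h2
  linarith

variable {ι : Type*} {T : ℝ≥0 → B →L[ℂ] B} {e : ι → B} {μ : ι → ℂ}

/-- Linear combinations of eigenvectors whose eigenvalues `exp (t μ)` decay tend to zero under the
family. -/
theorem tendsto_zero_of_mem_span (hT : ∀ i t, T t (e i) = Complex.exp ((t : ℝ) * μ i) • e i) {v : B}
    (hv : v ∈ Submodule.span ℂ (e '' {i | (μ i).re < 0})) :
    Tendsto (fun t : ℝ≥0 => T t v) atTop (𝓝 0) := by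
  induction hv using Submodule.span_induction with
  | mem x hx =>
    obtain ⟨i, hi, rfl⟩ := hx
    simp_rw [hT]
    rw [← zero_smul ℂ (e i)]
    refine Tendsto.smul_const ?_ _
    rw [tendsto_zero_iff_norm_tendsto_zero]
    simp_rw [Complex.norm_exp, Complex.re_ofReal_mul]
    refine Real.tendsto_exp_atBot.comp ?_
    exact (NNReal.tendsto_coe_atTop.2 tendsto_id).atTop_mul_const_of_neg hi
  | zero => simp
  | add x y _ _ hx hy => simpa using hx.add hy
  | smul a x _ hx => simpa using hx.const_smul a

/-- Linear combinations of eigenvectors whose eigenvalues `exp (t μ)` grow have preimages under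
`T t` that tend to zero. -/
theorem exists_tendsto_zero_of_mem_span
    (hT : ∀ i t, T t (e i) = Complex.exp ((t : ℝ) * μ i) • e i) {v : B}
    (hv : v ∈ Submodule.span ℂ (e '' {i | 0 < (μ i).re})) :
    ∃ u : ℝ≥0 → B, Tendsto u atTop (𝓝 0) ∧ ∀ t, T t (u t) = v := by
  induction hv using Submodule.span_induction with
  | mem x hx =>
    obtain ⟨i, hi, rfl⟩ := hx
    refine ⟨fun t => Complex.exp (-((t : ℝ) * μ i)) • e i, ?_, fun t => ?_⟩
    · rw [← zero_smul ℂ (e i)]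
      refine Tendsto.smul_const ?_ _
      rw [tendsto_zero_iff_norm_tendsto_zero]
      simp_rw [Complex.norm_exp, Complex.neg_re, Complex.re_ofReal_mul]
      refine Real.tendsto_exp_neg_atTop_nhds_zero.comp ?_
      exact (NNReal.tendsto_coe_atTop.2 tendsto_id).atTop_mul_const hi
    · rw [map_smul, hT, smul_smul, ← Complex.exp_add]
      simp
  | zero => exact ⟨fun _ => 0, tendsto_const_nhds, by simp⟩
  | add x y _ _ hx hy =>
    obtain ⟨u, hu, hu'⟩ := hx
    obtain ⟨w, hw, hw'⟩ := hy
    exact ⟨fun t => u t + w t, by simpa using hu.add hw, fun t => by simp [hu', hw']⟩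
  | smul a x _ hx =>
    obtain ⟨u, hu, hu'⟩ := hx
    exact ⟨fun t => a • u t, by simpa using hu.const_smul a, fun t => by simp [hu']⟩

/-- Linear combinations of eigenvectors with `μ ∈ 2πiℚ` are periodic points. In the induction a
common period is carried along as the statement that all its multiples are periods, so that
linear combinations can be treated without the semigroup law. -/
theorem isPeriodicPoint_of_mem_span
    (hT : ∀ i t, T t (e i) = Complex.exp ((t : ℝ) * μ i) • e i) {v : B}
    (hv : v ∈ Submodule.span ℂ (e '' {i | ∃ q : ℚ, μ i = 2 * Real.pi * Complex.I * q})) :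
    IsPeriodicPoint T v := by
  have key : ∃ N : ℕ, 0 < N ∧ ∀ k : ℕ, T (N * k : ℕ) v = v := by
    induction hv using Submodule.span_induction with
    | mem x hx =>
      obtain ⟨i, ⟨q, hq⟩, rfl⟩ := hx
      refine ⟨q.den, q.den_pos, fun k => ?_⟩
      rw [hT, hq]
      have h1 : (((q.den * k : ℕ) : ℝ≥0) : ℝ) * (2 * Real.pi * Complex.I * q) =
          ((q.num * k : ℤ) : ℂ) * (2 * Real.pi * Complex.I) := by
        have h2 : (q.den : ℂ) * q = q.num := by exact_mod_cast Rat.den_mul_eq_num q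
        push_cast
        linear_combination (k * (2 * Real.pi * Complex.I)) * h2
      rw [h1, Complex.exp_int_mul_two_pi_mul_I, one_smul]
    | zero => exact ⟨1, one_pos, by simp⟩
    | add x y _ _ hx hy =>
      obtain ⟨N, hN, h⟩ := hx
      obtain ⟨M, hM, h'⟩ := hy
      refine ⟨N * M, Nat.mul_pos hN hM, fun k => ?_⟩
      rw [map_add, mul_assoc, h (M * k), ← mul_assoc, mul_comm N M, mul_assoc, h' (N * k)]
    | smul a x _ hx =>
      obtain ⟨N, hN, h⟩ := hx
      exact ⟨N, hN, fun k => by rw [map_smul, h]⟩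
  obtain ⟨N, hN, h⟩ := key
  exact ⟨N, by exact_mod_cast hN, by simpa using h 1⟩

/-- Eigenvector criterion for chaos: if the eigenvectors with growing, with decaying, and with
rationally periodic eigenvalues each span a dense subspace, then the family is chaotic. The dense
orbit comes from topological transitivity and the Baire category theorem. -/
theorem isChaotic_of_eigenvectors [CompleteSpace B] [SecondCountableTopology B]
    (hT : ∀ i t, T t (e i) = Complex.exp ((t : ℝ) * μ i) • e i)
    (hpos : Dense (Submodule.span ℂ (e '' {i | 0 < (μ i).re}) : Set B))
    (hneg : Dense (Submodule.span ℂ (e '' {i | (μ i).re < 0}) : Set B))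
    (hper : Dense (Submodule.span ℂ
      (e '' {i | ∃ q : ℚ, μ i = 2 * Real.pi * Complex.I * q}) : Set B)) :
    IsChaotic T := by
  refine ⟨?_, hper.mono fun v hv => isPeriodicPoint_of_mem_span hT hv⟩
  -- topological transitivity: `x + u t ∈ U` is mapped to `T t x + y ∈ V` for large `t`
  have htrans : ∀ U V : Set B, IsOpen U → U.Nonempty → IsOpen V → V.Nonempty →
      ∃ x ∈ U, ∃ t, T t x ∈ V := by
    intro U V hU hU' hV hV'
    obtain ⟨x, hxU, hx⟩ := hneg.exists_mem_open hU hU'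
    obtain ⟨y, hyV, hy⟩ := hpos.exists_mem_open hV hV'
    obtain ⟨u, hu, hu'⟩ := exists_tendsto_zero_of_mem_span hT hyV
    have h1 := tendsto_zero_of_mem_span hT hxU
    have h2 : Tendsto (fun t => x + u t) atTop (𝓝 x) := by simpa using hu.const_add x
    have h3 : Tendsto (fun t => T t x + y) atTop (𝓝 y) := by simpa using h1.add_const y
    obtain ⟨t, ht1, ht2⟩ := ((h2.eventually (hU.mem_nhds hx)).and
      (h3.eventually (hV.mem_nhds hy))).exists
    exact ⟨x + u t, ht1, t, by rwa [map_add, hu']⟩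
  let 𝓑 := TopologicalSpace.countableBasis B
  have hd : Dense (⋂₀ ((fun V => ⋃ t, T t ⁻¹' V) '' 𝓑)) := by
    refine dense_sInter_of_isOpen ?_ ((TopologicalSpace.countable_countableBasis B).image _) ?_
    · rintro _ ⟨V, hV, rfl⟩
      exact isOpen_iUnion fun t =>
        (TopologicalSpace.isOpen_of_mem_countableBasis hV).preimage (T t).continuous
    · rintro _ ⟨V, hV, rfl⟩
      refine dense_iff_inter_open.2 fun U hU hU' => ?_
      obtain ⟨x, hx, t, ht⟩ := htrans U V hU hU'
        (TopologicalSpace.isOpen_of_mem_countableBasis hV)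
        (TopologicalSpace.nonempty_of_mem_countableBasis hV)
      exact ⟨x, hx, mem_iUnion.2 ⟨t, ht⟩⟩
  obtain ⟨v, hv⟩ := hd.nonempty
  refine ⟨v, (TopologicalSpace.isBasis_countableBasis B).dense_iff.2 fun V hV _ => ?_⟩
  obtain ⟨t, ht⟩ := mem_iUnion.1 (hv _ ⟨V, hV, rfl⟩)
  exact ⟨T t v, ht, t, rfl⟩

end AbstractDynamics

/-! ### Bounds for the spherical function -/

section PhiBounds

variable {n : ℕ}

/-- Lower bound from the directions near `-x / |x|`: there `-ω·x` is close to `|x|`. -/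
theorem exists_mul_exp_le_phi [NeZero n] {ρ r : ℝ} (hρ : 0 < ρ) (hr : r < ρ) :
    ∃ C > 0, ∀ x : EuclideanSpace ℝ (Fin n), C * Real.exp (r * ‖x‖) ≤ phi ρ x := by
  have hδ : 0 < (ρ - r) / ρ := div_pos (sub_pos.2 hr) hρ
  set δ := (ρ - r) / ρ with hδdef
  have hn : Module.finrank ℝ (EuclideanSpace ℝ (Fin n)) = n := finrank_euclideanSpace_fin
  set σ := (volume : Measure (EuclideanSpace ℝ (Fin n))).toSphere with hσ
  set C := (Measure.toSphereBallBound n δ : ℝ) *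
    (volume : Measure (EuclideanSpace ℝ (Fin n))).real (ball 0 1) with hC
  have hCpos : 0 < C := by
    refine mul_pos (by exact_mod_cast Measure.toSphereBallBound_pos n δ) ?_
    exact ENNReal.toReal_pos (measure_ball_pos _ _ one_pos).ne' measure_ball_lt_top.ne
  obtain ⟨e₀, he₀⟩ : ∃ e : EuclideanSpace ℝ (Fin n), ‖e‖ = 1 := exists_norm_eq _ zero_le_one
  refine ⟨C, hCpos, fun x => ?_⟩
  obtain ⟨u, hu⟩ : ∃ u : sphere (0 : EuclideanSpace ℝ (Fin n)) 1, x = -(‖x‖ • (u : _)) := by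
    rcases eq_or_ne x 0 with rfl | hx
    · exact ⟨⟨e₀, by simp [he₀]⟩, by simp⟩
    · refine ⟨⟨-(‖x‖⁻¹ • x), by simp [norm_smul, hx]⟩, ?_⟩
      simp [smul_smul, hx]
  have hball : C ≤ σ.real (ball u δ) := by
    have := Measure.toSphereBallBound_mul_measureReal_unitBall_le_toSphere_ball
      (volume : Measure (EuclideanSpace ℝ (Fin n))) hδ u
    rwa [hn] at this
  have hint := integrable_expInner (n := n) ρ x
  rw [phi_eq]
  calc C * Real.exp (r * ‖x‖) ≤ σ.real (ball u δ) * Real.exp (r * ‖x‖) := by gcongr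
    _ = ∫ _ in ball u δ, Real.exp (r * ‖x‖) ∂σ := by simp
    _ ≤ ∫ ω in ball u δ, Real.exp (-(ρ * ⟪x, (ω : EuclideanSpace ℝ (Fin n))⟫)) ∂σ := by
      refine setIntegral_mono_on (integrable_const _) hint.integrableOn measurableSet_ball
        fun ω hω => ?_
      gcongr
      have h1 : ‖(ω : EuclideanSpace ℝ (Fin n)) - u‖ < δ := by
        rw [← dist_eq_norm]; exact hω
      have hu1 : ‖(u : EuclideanSpace ℝ (Fin n))‖ = 1 := by simp
      -- `⟪u, ω⟫ = 1 + ⟪u, ω - u⟫ ≥ 1 - δ`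
      have h2 : ⟪(u : EuclideanSpace ℝ (Fin n)), (ω : EuclideanSpace ℝ (Fin n))⟫ ≥ 1 - δ := by
        have h3 : ⟪(u : EuclideanSpace ℝ (Fin n)), (ω : EuclideanSpace ℝ (Fin n))⟫ =
            1 + ⟪(u : EuclideanSpace ℝ (Fin n)), (ω : EuclideanSpace ℝ (Fin n)) - u⟫ := by
          rw [inner_sub_right, real_inner_self_eq_norm_sq, hu1]; ring
        have h4 := abs_real_inner_le_norm (u : EuclideanSpace ℝ (Fin n))
          ((ω : EuclideanSpace ℝ (Fin n)) - u)
        rw [hu1, one_mul] at h4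
        have := neg_abs_le ⟪(u : EuclideanSpace ℝ (Fin n)), (ω : EuclideanSpace ℝ (Fin n)) - u⟫
        rw [h3]; linarith
      have h5 : ρ * (1 - δ) = r := by rw [hδdef]; field_simp; ring
      conv_rhs => rw [hu, inner_neg_left, real_inner_smul_left]
      have := mul_le_mul_of_nonneg_left h2 (mul_nonneg hρ.le (norm_nonneg x))
      rw [mul_assoc, mul_assoc, mul_left_comm, h5] at this
      linarith [mul_comm r ‖x‖]
    _ ≤ ∫ ω, Real.exp (-(ρ * ⟪x, (ω : EuclideanSpace ℝ (Fin n))⟫)) ∂σ :=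
      setIntegral_le_integral hint (Filter.Eventually.of_forall fun _ => (Real.exp_pos _).le)

theorem phi_sub_le (ρ : ℝ) (hρ : 0 < ρ) (x y : EuclideanSpace ℝ (Fin n)) :
    phi ρ y ≤ Real.exp (ρ * ‖x‖) * phi ρ (y - x) := by
  rw [phi_eq, phi_eq, ← integral_const_mul]
  refine integral_mono (integrable_expInner ρ y) ((integrable_expInner ρ (y - x)).const_mul _)
    fun ω => ?_
  simp only
  rw [← Real.exp_add]
  gcongr
  have h := abs_le.1 (abs_real_inner_le_norm x (ω : EuclideanSpace ℝ (Fin n)))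
  have hω : ‖(ω : EuclideanSpace ℝ (Fin n))‖ = 1 := by simp
  rw [hω, mul_one] at h
  rw [inner_sub_left]
  nlinarith [h.1]

theorem phi_eq_phi_one_smul (ρ : ℝ) (x : EuclideanSpace ℝ (Fin n)) :
    phi ρ x = phi 1 (ρ • x) := by
  simp_rw [phi_eq, real_inner_smul_left, one_mul]

/-- Integration in polar coordinates, over the radius first. -/
theorem lintegral_polar [NeZero n] {F : EuclideanSpace ℝ (Fin n) → ℝ≥0∞} (hF : Measurable F) :
    ∫⁻ y, F y = ∫⁻ ω : sphere (0 : EuclideanSpace ℝ (Fin n)) 1, (∫⁻ R in Ioi (0 : ℝ),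
      ENNReal.ofReal (R ^ (n - 1)) * F (R • (ω : EuclideanSpace ℝ (Fin n))))
      ∂(volume : Measure (EuclideanSpace ℝ (Fin n))).toSphere := by
  have hmp := (volume :
    Measure (EuclideanSpace ℝ (Fin n))).measurePreserving_homeomorphUnitSphereProd
  have hn : Module.finrank ℝ (EuclideanSpace ℝ (Fin n)) = n := finrank_euclideanSpace_fin
  rw [hn] at hmp
  have h1 : ∫⁻ y, F y = ∫⁻ y : ({0}ᶜ : Set (EuclideanSpace ℝ (Fin n))),
      F (y : EuclideanSpace ℝ (Fin n)) ∂((volume : Measure _).comap Subtype.val) := by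
    rw [lintegral_subtype_comap (measurableSet_singleton _).compl, restrict_compl_singleton]
  have hG : Measurable fun z : sphere (0 : EuclideanSpace ℝ (Fin n)) 1 × Ioi (0 : ℝ) =>
      F ((z.2 : ℝ) • (z.1 : EuclideanSpace ℝ (Fin n))) :=
    hF.comp (by fun_prop)
  have h2 := hmp.lintegral_comp hG
  rw [lintegral_prod _ hG.aemeasurable] at h2
  have h3 : ∀ y : ({0}ᶜ : Set (EuclideanSpace ℝ (Fin n))),
      F ((homeomorphUnitSphereProd (EuclideanSpace ℝ (Fin n)) y).2.1 •
        ((homeomorphUnitSphereProd (EuclideanSpace ℝ (Fin n)) y).1 : EuclideanSpace ℝ (Fin n))) =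
      F y := by
    intro y
    have : ‖(y : EuclideanSpace ℝ (Fin n))‖ ≠ 0 := norm_ne_zero_iff.2 y.2
    simp [smul_smul, this]
  simp_rw [h3] at h2
  rw [h1, h2]
  refine lintegral_congr fun ω => ?_
  have hm : Measurable fun R : ℝ => F (R • (ω : EuclideanSpace ℝ (Fin n))) :=
    hF.comp (by fun_prop)
  rw [Measure.volumeIoiPow, lintegral_withDensity_eq_lintegral_mul _ (by fun_prop)
    (show Measurable fun R : Ioi (0 : ℝ) => F ((R : ℝ) • (ω : EuclideanSpace ℝ (Fin n))) from
      hm.comp measurable_subtype_coe)]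
  exact lintegral_subtype_comap measurableSet_Ioi
    fun R : ℝ => ENNReal.ofReal (R ^ (n - 1)) * F (R • (ω : EuclideanSpace ℝ (Fin n)))

theorem integral_exp_neg_norm_sq_inner (w : EuclideanSpace ℝ (Fin n)) :
    ∫⁻ y : EuclideanSpace ℝ (Fin n), ENNReal.ofReal (Real.exp (-‖y‖ ^ 2 / 2 - ⟪y, w⟫)) =
      ENNReal.ofReal ((2 * Real.pi) ^ ((n : ℝ) / 2) * Real.exp (‖w‖ ^ 2 / 2)) := by
  have h0 : ∀ y : EuclideanSpace ℝ (Fin n), Real.exp (-‖y‖ ^ 2 / 2 - ⟪y, w⟫) =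
      Real.exp (‖w‖ ^ 2 / 2) * (2 * Real.pi) ^ ((n : ℝ) / 2) * heatKernel (1 / 2) (-w - y) := by
    intro y
    have h1 : (4 * Real.pi * (1 / 2)) = 2 * Real.pi := by ring
    have h2 : ‖-w - y‖ ^ 2 = ‖y‖ ^ 2 + 2 * ⟪y, w⟫ + ‖w‖ ^ 2 := by
      rw [← neg_add', norm_neg, add_comm, norm_add_sq_real]
    have h3 : (2 * Real.pi) ^ ((n : ℝ) / 2) * (2 * Real.pi) ^ (-(n : ℝ) / 2) = 1 := by
      rw [← Real.rpow_add (by positivity)]; simp [neg_div]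
    unfold heatKernel
    rw [h1, mul_assoc, ← mul_assoc (_ ^ _) (_ ^ _), h3, one_mul, ← Real.exp_add, h2]
    congr 1
    ring
  have hpos : 0 ≤ Real.exp (‖w‖ ^ 2 / 2) * (2 * Real.pi) ^ ((n : ℝ) / 2) := by positivity
  simp_rw [h0, ENNReal.ofReal_mul hpos]
  rw [lintegral_const_mul' _ _ ENNReal.ofReal_ne_top,
    lintegral_sub_left_eq_self (fun z => ENNReal.ofReal (heatKernel (1 / 2) z)) _,
    lintegral_heatKernel (by norm_num), mul_one, mul_comm]

/-- The Gaussian integral `∫ exp (-|y|²/2 - ⟪y, w⟫) dy` in polar coordinates, restricted to radii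
between `|w| - 1` and `|w|`, where the integrand is concentrated. -/
theorem phi_one_mul_le [NeZero n] (w : EuclideanSpace ℝ (Fin n)) (hw : 1 ≤ ‖w‖) :
    phi 1 (‖w‖ • w) * ((‖w‖ - 1) ^ (n - 1) * Real.exp (-‖w‖ ^ 2 / 2 - 1 / 2)) ≤
      (2 * Real.pi) ^ ((n : ℝ) / 2) * Real.exp (‖w‖ ^ 2 / 2) := by
  set s := ‖w‖ with hs
  have hK : 0 ≤ (s - 1) ^ (n - 1) * Real.exp (-s ^ 2 / 2 - 1 / 2) := by
    have : 0 ≤ s - 1 := by linarith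
    positivity
  rw [← ENNReal.ofReal_le_ofReal_iff (by positivity), ← integral_exp_neg_norm_sq_inner,
    lintegral_polar (by fun_prop), ENNReal.ofReal_mul' hK, ofReal_phi,
    ← lintegral_mul_const' _ _ ENNReal.ofReal_ne_top]
  refine lintegral_mono fun ω => ?_
  have hω : ‖(ω : EuclideanSpace ℝ (Fin n))‖ = 1 := by simp
  set τ := ⟪w, (ω : EuclideanSpace ℝ (Fin n))⟫ with hτ
  have hτs : -s ≤ τ := by
    have := (abs_le.1 (abs_real_inner_le_norm w (ω : EuclideanSpace ℝ (Fin n)))).1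
    rwa [hω, mul_one] at this
  rw [← ENNReal.ofReal_mul (Real.exp_pos _).le]
  calc ENNReal.ofReal (Real.exp (-(1 * ⟪s • w, (ω : EuclideanSpace ℝ (Fin n))⟫)) *
        ((s - 1) ^ (n - 1) * Real.exp (-s ^ 2 / 2 - 1 / 2)))
      = ∫⁻ _ in Ioc (s - 1) s, ENNReal.ofReal (Real.exp (-(1 * ⟪s • w,
        (ω : EuclideanSpace ℝ (Fin n))⟫)) *
        ((s - 1) ^ (n - 1) * Real.exp (-s ^ 2 / 2 - 1 / 2))) := by simp
    _ ≤ ∫⁻ R in Ioc (s - 1) s, ENNReal.ofReal (R ^ (n - 1)) *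
        ENNReal.ofReal (Real.exp (-‖R • (ω : EuclideanSpace ℝ (Fin n))‖ ^ 2 / 2 -
          ⟪R • (ω : EuclideanSpace ℝ (Fin n)), w⟫)) := by
      refine setLIntegral_mono' measurableSet_Ioc fun R hR => ?_
      have hR0 : 0 ≤ R := by linarith [hR.1]
      rw [← ENNReal.ofReal_mul (by positivity)]
      refine ENNReal.ofReal_le_ofReal ?_
      rw [mul_left_comm, ← Real.exp_add, norm_smul, hω, real_inner_smul_left, real_inner_smul_left,
        real_inner_comm w, ← hτ, mul_one, Real.norm_of_nonneg hR0]
      have h1 : 0 ≤ s - 1 := by linarith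
      have h2 : s - 1 ≤ R := hR.1.le
      gcongr
      -- the difference of the exponents is at least `(1 - (s - R) ^ 2) / 2`
      have h3 : 0 ≤ (s - R) * (τ + s) := mul_nonneg (by linarith [hR.2]) (by linarith)
      nlinarith [hR.1, hR.2]
    _ ≤ _ := lintegral_mono_set fun R hR => by
      have := hR.1
      simp only [mem_Ioi]; linarith

/-- The sharp upper bound `φ_{iρ}(x) ≤ C e^{ρ|x|} (1 + ρ|x|)^{-(n-1)/2}`, squared. It is
`phi_one_mul_le` for `w` in the direction of `x` with `|w|² = ρ|x|`. -/
theorem exists_phi_sq_mul_le [NeZero n] {ρ : ℝ} (hρ : 0 < ρ) :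
    ∃ C > 0, ∀ x : EuclideanSpace ℝ (Fin n),
      phi ρ x ^ 2 * (1 + ρ * ‖x‖) ^ (n - 1) ≤ C * Real.exp (2 * (ρ * ‖x‖)) := by
  set A := (2 * Real.pi) ^ ((n : ℝ) / 2) * Real.exp (1 / 2) with hA
  have hφ0 : ∀ x : EuclideanSpace ℝ (Fin n), phi ρ x ≤ phi ρ 0 * Real.exp (ρ * ‖x‖) := fun x => by
    rw [mul_comm]; simpa using phi_sub_le ρ hρ x x
  have h0 := phi_pos ρ (0 : EuclideanSpace ℝ (Fin n))
  refine ⟨phi ρ (0 : EuclideanSpace ℝ (Fin n)) ^ 2 * 5 ^ (n - 1) + A ^ 2 * 8 ^ (n - 1),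
    by positivity, fun x => ?_⟩
  have hx := phi_pos ρ x
  rcases le_or_gt (ρ * ‖x‖) 4 with h | h
  · have h1 : phi ρ x ^ 2 ≤ (phi ρ (0 : EuclideanSpace ℝ (Fin n)) * Real.exp (ρ * ‖x‖)) ^ 2 := by
      gcongr
      exact hφ0 x
    calc phi ρ x ^ 2 * (1 + ρ * ‖x‖) ^ (n - 1)
        ≤ (phi ρ (0 : EuclideanSpace ℝ (Fin n)) * Real.exp (ρ * ‖x‖)) ^ 2 * 5 ^ (n - 1) := by
          gcongr; linarith
      _ = phi ρ (0 : EuclideanSpace ℝ (Fin n)) ^ 2 * 5 ^ (n - 1) * Real.exp (2 * (ρ * ‖x‖)) := by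
          rw [two_mul (ρ * ‖x‖), Real.exp_add]; ring
      _ ≤ _ := by gcongr; exact le_add_of_nonneg_right (by positivity)
  · set s := √(ρ * ‖x‖) with hs
    have hs2 : s ^ 2 = ρ * ‖x‖ := Real.sq_sqrt (by linarith)
    have hs1 : 2 < s := by rw [hs, Real.lt_sqrt (by norm_num)]; linarith
    have hs0 : s ≠ 0 := by linarith
    have hw : ‖s⁻¹ • (ρ • x)‖ = s := by
      rw [norm_smul, norm_smul, Real.norm_of_nonneg (by positivity), Real.norm_of_nonneg hρ.le,
        ← hs2]
      field_simp
    have key := phi_one_mul_le (s⁻¹ • (ρ • x)) (by rw [hw]; linarith)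
    rw [hw, smul_smul, mul_inv_cancel₀ hs0, one_smul, ← phi_eq_phi_one_smul] at key
    have key2 : phi ρ x * (s - 1) ^ (n - 1) ≤ A * Real.exp (s ^ 2) := by
      have e1 : Real.exp (s ^ 2 / 2 + 1 / 2) * Real.exp (-s ^ 2 / 2 - 1 / 2) = 1 := by
        rw [← Real.exp_add]; ring_nf; exact Real.exp_zero
      have e2 : Real.exp (s ^ 2) = Real.exp (s ^ 2 / 2) * Real.exp (s ^ 2 / 2) := by
        rw [← Real.exp_add]; ring_nf
      calc phi ρ x * (s - 1) ^ (n - 1)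
          = phi ρ x * ((s - 1) ^ (n - 1) * Real.exp (-s ^ 2 / 2 - 1 / 2)) *
            Real.exp (s ^ 2 / 2 + 1 / 2) := by
            linear_combination (-(phi ρ x * (s - 1) ^ (n - 1))) * e1
        _ ≤ (2 * Real.pi) ^ ((n : ℝ) / 2) * Real.exp (s ^ 2 / 2) *
            Real.exp (s ^ 2 / 2 + 1 / 2) := by gcongr
        _ = A * Real.exp (s ^ 2) := by rw [e2, hA, Real.exp_add]; ring
    have h3 : 0 ≤ s - 1 := by linarith
    -- `1 + s² ≤ 8 (s - 1)²` for `s ≥ 2`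
    have h4 : 1 + ρ * ‖x‖ ≤ 8 * (s - 1) ^ 2 := by rw [← hs2]; nlinarith
    calc phi ρ x ^ 2 * (1 + ρ * ‖x‖) ^ (n - 1)
        ≤ phi ρ x ^ 2 * (8 * (s - 1) ^ 2) ^ (n - 1) := by gcongr
      _ = (phi ρ x * (s - 1) ^ (n - 1)) ^ 2 * 8 ^ (n - 1) := by
          rw [mul_pow, mul_pow, ← pow_mul, ← pow_mul]; ring
      _ ≤ (A * Real.exp (s ^ 2)) ^ 2 * 8 ^ (n - 1) := by gcongr
      _ = A ^ 2 * 8 ^ (n - 1) * Real.exp (2 * (ρ * ‖x‖)) := by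
          rw [← hs2, two_mul (s ^ 2), Real.exp_add]; ring
      _ ≤ _ := by gcongr; exact le_add_of_nonneg_left (by positivity)

end PhiBounds

/-! ### Functionals on `L^p` and integrable densities -/

section LpFunctionals

open Filter Topology

variable {α : Type*} [MeasurableSpace α] {μ : Measure α} {p : ℝ≥0∞}

/-- Dominated convergence in `L^p` for finite `p`. -/
theorem tendsto_eLpNorm_sub_of_dominated {ι : Type*} {l : Filter ι} [l.IsCountablyGenerated]
    (hp0 : p ≠ 0) (hp : p ≠ ∞) {F : ι → α → ℂ} {f g : α → ℂ}
    (hF : ∀ i, AEStronglyMeasurable (F i) μ) (hf : AEStronglyMeasurable f μ) (hg : MemLp g p μ)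
    (hFg : ∀ i, ∀ᵐ x ∂μ, ‖F i x‖ ≤ ‖g x‖) (hfg : ∀ᵐ x ∂μ, ‖f x‖ ≤ ‖g x‖)
    (hlim : ∀ᵐ x ∂μ, Tendsto (fun i => F i x) l (𝓝 (f x))) :
    Tendsto (fun i => eLpNorm (F i - f) p μ) l (𝓝 0) := by
  have hpos : 0 < p.toReal := ENNReal.toReal_pos hp0 hp
  simp_rw [eLpNorm_eq_lintegral_rpow_enorm_toReal hp0 hp]
  have h0 : (0 : ℝ≥0∞) = 0 ^ (1 / p.toReal) := by
    rw [ENNReal.zero_rpow_of_pos (by positivity)]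
  rw [h0]
  refine (ENNReal.continuous_rpow_const.tendsto _).comp ?_
  have hz : (0 : ℝ≥0∞) = ∫⁻ _, 0 ∂μ := by simp
  rw [hz]
  refine tendsto_lintegral_filter_of_dominated_convergence'
    (fun x => ‖(2 : ℂ) * g x‖ₑ ^ p.toReal)
    (Eventually.of_forall fun i => ((hF i).sub hf).enorm.pow_const _)
    (Eventually.of_forall fun i => ?_) ?_ ?_
  · filter_upwards [hFg i, hfg] with x h1 h2
    refine ENNReal.rpow_le_rpow (enorm_le_iff_norm_le.2 ?_) hpos.le
    refine (norm_sub_le _ _).trans ?_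
    rw [norm_mul, Complex.norm_ofNat]
    linarith
  · exact (lintegral_rpow_enorm_lt_top_of_eLpNorm_lt_top hp0 hp (hg.const_mul 2).2).ne
  · filter_upwards [hlim] with x hx
    have h1 : Tendsto (fun i => ‖F i x - f x‖ₑ) l (𝓝 0) := by
      have := (hx.sub_const (f x)).enorm
      simpa using this
    have h2 := (ENNReal.continuous_rpow_const (y := p.toReal)).tendsto 0 |>.comp h1
    simpa [Function.comp_def, ENNReal.zero_rpow_of_pos hpos] using h2

theorem memLp_mul_of_bounded {g : α → ℂ} (hg : MemLp g p μ) {u : α → ℂ} (hu : Measurable u) {K : ℝ}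
    (hK : ∀ x, ‖u x‖ ≤ K) : MemLp (fun x => u x * g x) p μ :=
  hg.of_le_mul (c := K) (hu.aestronglyMeasurable.mul hg.1) (Eventually.of_forall fun x => by
    rw [norm_mul]; gcongr; exact hK x)

variable [Fact (1 ≤ p)]

theorem tendsto_functional_of_dominated {ι : Type*} {l : Filter ι} [l.IsCountablyGenerated]
    (hp : p ≠ ∞) (Λ : Lp ℂ p μ →L[ℂ] ℂ) {F : ι → α → ℂ} {f g : α → ℂ}
    (hF : ∀ i, MemLp (F i) p μ) (hf : MemLp f p μ) (hg : MemLp g p μ)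
    (hFg : ∀ i, ∀ᵐ x ∂μ, ‖F i x‖ ≤ ‖g x‖) (hfg : ∀ᵐ x ∂μ, ‖f x‖ ≤ ‖g x‖)
    (hlim : ∀ᵐ x ∂μ, Tendsto (fun i => F i x) l (𝓝 (f x))) :
    Tendsto (fun i => Λ ((hF i).toLp (F i))) l (𝓝 (Λ (hf.toLp f))) := by
  refine (Λ.continuous.tendsto _).comp ?_
  rw [Lp.tendsto_Lp_iff_tendsto_eLpNorm'']
  exact tendsto_eLpNorm_sub_of_dominated (zero_lt_one.trans_le Fact.out).ne' hp
    (fun i => (hF i).1) hf.1 hg hFg hfg hlim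

/-- For `g ∈ L^p` with `p` finite, a functional `Λ` on `L^p` gives the complex measure
`A ↦ Λ (1_A g)`. -/
noncomputable def functionalMeasure (hp : p ≠ ∞) (Λ : Lp ℂ p μ →L[ℂ] ℂ) {g : α → ℂ}
    (hg : MemLp g p μ) : ComplexMeasure α where
  measureOf' A := open scoped Classical in
    if hA : MeasurableSet A then Λ ((hg.indicator hA).toLp (A.indicator g)) else 0
  empty' := by
    rw [dif_pos MeasurableSet.empty]
    have : (hg.indicator MeasurableSet.empty).toLp (indicator ∅ g) = 0 := by
      rw [← MemLp.toLp_zero (MemLp.zero' (ε := ℂ))]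
      exact MemLp.toLp_congr _ _ (by simp; rfl)
    rw [this, map_zero]
  not_measurable' A hA := dif_neg hA
  m_iUnion' A hA hd := by
    rw [dif_pos (MeasurableSet.iUnion hA)]
    simp_rw [dif_pos (hA _)]
    have hs : ∀ s : Finset ℕ, MemLp ((⋃ i ∈ s, A i).indicator g) p μ := fun s =>
      hg.indicator (s.measurableSet_biUnion fun i _ => hA i)
    have h1 : ∀ s : Finset ℕ, ∑ i ∈ s, Λ ((hg.indicator (hA i)).toLp ((A i).indicator g)) =
        Λ ((hs s).toLp _) := by
      intro s
      rw [← map_sum]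
      congr 1
      refine Lp.ext ?_
      have h2 : ∀ᵐ x ∂μ, ∀ i, (hg.indicator (hA i)).toLp ((A i).indicator g) x =
          (A i).indicator g x := ae_all_iff.2 fun i => MemLp.coeFn_toLp _
      filter_upwards [h2, (hs s).coeFn_toLp, Lp.coeFn_finsetSum s fun i =>
        (hg.indicator (hA i)).toLp ((A i).indicator g)] with x h3 h4 h5
      rw [h4, h5, Finset.sum_apply, Finset.sum_congr rfl fun i _ => h3 i,
        Finset.indicator_biUnion_apply _ _ (fun i _ j _ hij => hd hij)]
    unfold HasSum
    simp_rw [h1]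
    refine tendsto_functional_of_dominated hp Λ hs _ hg
      (fun s => Eventually.of_forall fun x => norm_indicator_le_norm_self _ _)
      (Eventually.of_forall fun x => norm_indicator_le_norm_self _ _)
      (Eventually.of_forall fun x => ?_)
    exact (tendsto_indicator_biUnion_finset A g x).mono_right (pure_le_nhds _)

theorem functionalMeasure_apply (hp : p ≠ ∞) (Λ : Lp ℂ p μ →L[ℂ] ℂ) {g : α → ℂ}
    (hg : MemLp g p μ) {A : Set α} (hA : MeasurableSet A) :
    functionalMeasure hp Λ hg A = Λ ((hg.indicator hA).toLp (A.indicator g)) :=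
  dif_pos hA

/-- Radon–Nikodym: the functional is integration against an integrable density on the indicator
functions times `g`. -/
theorem exists_density_indicator {ν : Measure α} [SigmaFinite ν] (hμν : μ ≪ ν) (hp : p ≠ ∞)
    (Λ : Lp ℂ p μ →L[ℂ] ℂ) {g : α → ℂ} (hg : MemLp g p μ) :
    ∃ h : α → ℂ, Integrable h ν ∧ ∀ (A : Set α) (hA : MeasurableSet A),
      Λ ((hg.indicator hA).toLp (A.indicator g)) = ∫ x in A, h x ∂ν := by
  set c := functionalMeasure hp Λ hg with hc
  have hac : c ≪ᵥ ν.toENNRealVectorMeasure := by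
    refine VectorMeasure.AbsolutelyContinuous.mk fun A hA hA0 => ?_
    rw [Measure.toENNRealVectorMeasure_apply_measurable hA] at hA0
    rw [hc, functionalMeasure_apply hp Λ hg hA]
    have : (hg.indicator hA).toLp (A.indicator g) = 0 := by
      rw [← MemLp.toLp_zero (MemLp.zero' (ε := ℂ))]
      refine MemLp.toLp_congr _ _ ?_
      filter_upwards [measure_eq_zero_iff_ae_notMem.1 (hμν hA0)] with x hx
      simp [hx]
    rw [this, map_zero]
  rw [ComplexMeasure.absolutelyContinuous_ennreal_iff] at hac
  refine ⟨c.rnDeriv ν, c.integrable_rnDeriv ν, fun A hA => ?_⟩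
  rw [← functionalMeasure_apply hp Λ hg hA, ← hc]
  have h1 := (SignedMeasure.absolutelyContinuous_iff_withDensityᵥ_rnDeriv_eq _ _).1 hac.1
  have h2 := (SignedMeasure.absolutelyContinuous_iff_withDensityᵥ_rnDeriv_eq _ _).1 hac.2
  have h1' := congrArg (fun v : SignedMeasure α => v A) h1
  have h2' := congrArg (fun v : SignedMeasure α => v A) h2
  rw [withDensityᵥ_apply (SignedMeasure.integrable_rnDeriv _ _) hA] at h1' h2'
  apply Complex.ext
  · rw [← RCLike.re_eq_complex_re, ← integral_re (c.integrable_rnDeriv ν).integrableOn]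
    exact h1'.symm
  · rw [← RCLike.im_eq_complex_im, ← integral_im (c.integrable_rnDeriv ν).integrableOn]
    exact h2'.symm

/-- On bounded multiples of a fixed `g ∈ L^p`, `p` finite, a functional is integration against an
integrable density. -/
theorem exists_density {ν : Measure α} [SigmaFinite ν] (hμν : μ ≪ ν) (hp : p ≠ ∞)
    (Λ : Lp ℂ p μ →L[ℂ] ℂ) {g : α → ℂ} (hg : MemLp g p μ) :
    ∃ h : α → ℂ, Integrable h ν ∧ ∀ (u : α → ℂ) (K : ℝ) (_ : Measurable u) (_ : ∀ x, ‖u x‖ ≤ K)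
      (hug : MemLp (fun x => u x * g x) p μ), Λ (hug.toLp _) = ∫ x, u x * h x ∂ν := by
  obtain ⟨h, hh, hA⟩ := exists_density_indicator hμν hp Λ hg
  refine ⟨h, hh, ?_⟩
  have hsimple : ∀ (s : SimpleFunc α ℂ) (hs : MemLp (fun x => s x * g x) p μ),
      Λ (hs.toLp _) = ∫ x, s x * h x ∂ν := by
    intro s
    induction s using SimpleFunc.induction with
    | @const z A hAm =>
      intro hs
      have h1 : hs.toLp _ = z • (hg.indicator hAm).toLp (A.indicator g) := by
        rw [← MemLp.toLp_const_smul]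
        refine MemLp.toLp_congr _ _ (Eventually.of_forall fun x => ?_)
        by_cases hx : x ∈ A <;> simp [hx]
      rw [h1, map_smul, hA A hAm, ← integral_indicator hAm, smul_eq_mul, ← integral_const_mul]
      refine integral_congr_ae (Eventually.of_forall fun x => ?_)
      by_cases hx : x ∈ A <;> simp [hx]
    | @add s₁ s₂ _ h₁ h₂ =>
      intro hs
      have b : ∀ s : SimpleFunc α ℂ, ∃ K, ∀ x, ‖s x‖ ≤ K := fun s => s.exists_forall_norm_le
      obtain ⟨K₁, hK₁⟩ := b s₁
      obtain ⟨K₂, hK₂⟩ := b s₂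
      have m₁ := memLp_mul_of_bounded hg s₁.measurable hK₁
      have m₂ := memLp_mul_of_bounded hg s₂.measurable hK₂
      have h3 : hs.toLp _ = m₁.toLp _ + m₂.toLp _ := by
        rw [← MemLp.toLp_add]
        refine MemLp.toLp_congr _ _ (Eventually.of_forall fun x => ?_)
        simp [add_mul]
      rw [h3, map_add, h₁ m₁, h₂ m₂, ← integral_add]
      · refine integral_congr_ae (Eventually.of_forall fun x => ?_)
        simp [add_mul]
      · exact hh.bdd_mul s₁.measurable.aestronglyMeasurable (Eventually.of_forall hK₁)
      · exact hh.bdd_mul s₂.measurable.aestronglyMeasurable (Eventually.of_forall hK₂)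
  intro u K hu hK hug
  have hK0 : ∀ x : α, 0 ≤ K := fun x => (norm_nonneg _).trans (hK x)
  let s := hu.stronglyMeasurable.approxBounded K
  have hsK : ∀ k x, ‖s k x‖ ≤ K := fun k x =>
    StronglyMeasurable.norm_approxBounded_le _ (hK0 x) k x
  have hsu : ∀ x, Tendsto (fun k => s k x) atTop (𝓝 (u x)) := fun x =>
    hu.stronglyMeasurable.tendsto_approxBounded_of_norm_le (hK x)
  have hm : ∀ k, MemLp (fun x => s k x * g x) p μ := fun k =>
    memLp_mul_of_bounded hg (s k).measurable (hsK k)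
  have hlim1 : Tendsto (fun k => Λ ((hm k).toLp _)) atTop (𝓝 (Λ (hug.toLp _))) := by
    refine tendsto_functional_of_dominated hp Λ hm hug (hg.const_mul (K : ℂ)) (fun k => ?_) ?_ ?_
    · refine Eventually.of_forall fun x => ?_
      rw [norm_mul, norm_mul, Complex.norm_real, Real.norm_of_nonneg (hK0 x)]
      gcongr
      exact hsK k x
    · refine Eventually.of_forall fun x => ?_
      rw [norm_mul, norm_mul, Complex.norm_real, Real.norm_of_nonneg (hK0 x)]
      gcongr
      exact hK x
    · exact Eventually.of_forall fun x => (hsu x).mul_const _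
  have hlim2 : Tendsto (fun k => ∫ x, s k x * h x ∂ν) atTop (𝓝 (∫ x, u x * h x ∂ν)) := by
    refine tendsto_integral_of_dominated_convergence (fun x => K * ‖h x‖)
      (fun k => (s k).measurable.aestronglyMeasurable.mul hh.1) (hh.norm.const_mul K) (fun k => ?_)
      (Eventually.of_forall fun x => (hsu x).mul_const _)
    refine Eventually.of_forall fun x => ?_
    rw [norm_mul]
    gcongr
    exact hsK k x
  refine tendsto_nhds_unique hlim1 ?_
  simp_rw [hsimple _ (hm _)]
  exact hlim2

/-- A functional that vanishes on all bounded multiples of a nowhere vanishing `g ∈ L^p` is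
zero. -/
theorem functional_eq_zero_of_bounded_mul (hp : p ≠ ∞) (Λ : Lp ℂ p μ →L[ℂ] ℂ) {g : α → ℂ}
    (hgm : Measurable g) (hg0 : ∀ x, g x ≠ 0)
    (h : ∀ (u : α → ℂ) (K : ℝ) (_ : Measurable u) (_ : ∀ x, ‖u x‖ ≤ K)
      (hug : MemLp (fun x => u x * g x) p μ), Λ (hug.toLp _) = 0) : Λ = 0 := by
  ext f
  have hfm := (Lp.stronglyMeasurable f).measurable
  have hf := Lp.memLp f
  let A : ℕ → Set α := fun k => {x | ‖f x / g x‖ ≤ k}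
  have hA : ∀ k, MeasurableSet (A k) := fun k =>
    measurableSet_le (hfm.div hgm).norm measurable_const
  have hm : ∀ k, MemLp ((A k).indicator f) p μ := fun k => hf.indicator (hA k)
  have hlim : Tendsto (fun k => Λ ((hm k).toLp _)) atTop (𝓝 (Λ (hf.toLp f))) := by
    refine tendsto_functional_of_dominated hp Λ hm hf hf
      (fun k => Eventually.of_forall fun x => norm_indicator_le_norm_self _ _)
      (Eventually.of_forall fun _ => le_rfl) (Eventually.of_forall fun x => ?_)
    obtain ⟨N, hN⟩ := exists_nat_ge ‖f x / g x‖
    refine tendsto_const_nhds.congr' ?_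
    filter_upwards [eventually_ge_atTop N] with k hk
    rw [indicator_of_mem]
    exact hN.trans (by exact_mod_cast hk)
  have hz : ∀ k, Λ ((hm k).toLp _) = 0 := by
    intro k
    have e : (A k).indicator f = fun x => (A k).indicator (fun x => f x / g x) x * g x := by
      funext x
      by_cases hx : x ∈ A k <;> simp [hx, hg0 x]
    have hm' := hm k
    have := h ((A k).indicator fun x => f x / g x) k ((hfm.div hgm).indicator (hA k))
      (fun x => by
        by_cases hx : x ∈ A k
        · rw [indicator_of_mem hx]; exact hx
        · simp [hx]) (by rw [← e]; exact hm')
    rw [← this]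
    congr 1
    exact MemLp.toLp_congr _ _ (Eventually.of_forall fun x => congrFun e x)
  simp_rw [hz] at hlim
  rw [Lp.toLp_coeFn] at hlim
  exact (tendsto_nhds_unique hlim tendsto_const_nhds)

end LpFunctionals

/-- A subspace on which no nonzero continuous functional vanishes is dense. -/
theorem dense_of_forall_functional {B : Type*} [NormedAddCommGroup B] [NormedSpace ℂ B]
    (S : Submodule ℂ B) (h : ∀ Λ : B →L[ℂ] ℂ, (∀ x ∈ S, Λ x = 0) → Λ = 0) : Dense (S : Set B) := by
  by_contra hS
  obtain ⟨x, hx⟩ : ∃ x, x ∉ closure (S : Set B) := by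
    by_contra! hcl
    exact hS hcl
  obtain ⟨f, u, hf, hfx⟩ := RCLike.geometric_hahn_banach_closed_point (𝕜 := ℂ)
    (s := closure (S : Set B)) ((S.restrictScalars ℝ).convex.closure) isClosed_closure hx
  have hz : ∀ y ∈ S, f y = 0 := by
    intro y hy
    by_contra hne
    have h1 := hf ((((u / ‖f y‖ ^ 2 : ℝ) : ℂ) * (starRingEnd ℂ) (f y)) • y)
      (subset_closure (S.smul_mem _ hy))
    rw [map_smul, smul_eq_mul, mul_assoc, ← Complex.normSq_eq_conj_mul_self,
      ← Complex.ofReal_mul, RCLike.re_eq_complex_re, Complex.ofReal_re,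
      Complex.normSq_eq_norm_sq] at h1
    have : ‖f y‖ ^ 2 ≠ 0 := by simpa using hne
    field_simp at h1
    linarith
  have h0 := h f hz
  have h1 := hf 0 (subset_closure S.zero_mem)
  rw [h0] at h1 hfx
  simp at h1 hfx
  linarith

/-! ### Exponentials, Fourier uniqueness and analytic continuation -/

section Exponentials

open Filter Topology FourierTransform

variable {n : ℕ}

theorem integrable_exp_neg_mul_norm [NeZero n] {δ : ℝ} (hδ : 0 < δ) :
    Integrable fun x : EuclideanSpace ℝ (Fin n) => Real.exp (-δ * ‖x‖) := by
  rw [integrable_fun_norm_addHaar volume (f := fun r => Real.exp (-δ * r))]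
  have hn : (-1 : ℝ) < (n - 1 : ℕ) := by
    have : (0 : ℝ) ≤ (n - 1 : ℕ) := Nat.cast_nonneg _
    linarith
  have h := integrableOn_rpow_mul_exp_neg_mul_rpow hn one_pos hδ
  rw [finrank_euclideanSpace_fin]
  simpa [Real.rpow_natCast] using h

/-- Uniqueness for the Fourier transform of integrable functions. -/
theorem ae_eq_zero_of_fourier_eq_zero {k : EuclideanSpace ℝ (Fin n) → ℂ} (hk : Integrable k)
    (h : ∀ ξ, 𝓕 k ξ = 0) : ∀ᵐ x, k x = 0 := by
  refine ae_eq_zero_of_integral_contDiff_smul_eq_zero hk.locallyIntegrable fun g hg hgc => ?_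
  have hg' : ContDiff ℝ (⊤ : ℕ∞) (fun x => (g x : ℂ)) := Complex.ofRealCLM.contDiff.comp hg
  have hgc' : HasCompactSupport (fun x => (g x : ℂ)) := hgc.comp_left Complex.ofReal_zero
  let ψ : SchwartzMap (EuclideanSpace ℝ (Fin n)) ℂ := hgc'.toSchwartzMap hg'
  set η : SchwartzMap (EuclideanSpace ℝ (Fin n)) ℂ := 𝓕⁻ ψ with hη
  have h1 := VectorFourier.integral_bilin_fourierIntegral_eq_flip
    (ContinuousLinearMap.mul ℂ ℂ) (μ := volume) (ν := volume) (L := innerₗ _)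
    Real.continuous_fourierChar continuous_inner hk η.integrable
  have h2 : ∀ x, VectorFourier.fourierIntegral Real.fourierChar volume
      (innerₗ (EuclideanSpace ℝ (Fin n))).flip η x = g x := by
    intro x
    rw [flip_innerₗ]
    change 𝓕 (⇑η) x = g x
    rw [hη, ← SchwartzMap.fourier_coe, FourierTransform.fourier_fourierInv_eq]
    rfl
  have h3 : ∀ ξ, VectorFourier.fourierIntegral Real.fourierChar volume
      (innerₗ (EuclideanSpace ℝ (Fin n))) k ξ = 0 := h
  simp only [h2, h3, map_zero, zero_apply, integral_zero,
    ContinuousLinearMap.mul_apply'] at h1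
  rw [h1]
  refine integral_congr_ae (Eventually.of_forall fun x => ?_)
  simp [mul_comm]

/-- The Laplace transform of `e^{-r|x|} h` along the direction `ω`, for integrable `h`, is
holomorphic in the strip `|Re a| < r`. -/
theorem differentiableOn_laplace {h : EuclideanSpace ℝ (Fin n) → ℂ} (hh : Integrable h) (r : ℝ)
    {ω : EuclideanSpace ℝ (Fin n)} (hω : ‖ω‖ = 1) :
    DifferentiableOn ℂ (fun a : ℂ => ∫ x, Complex.exp (a * (⟪x, ω⟫ : ℝ) - (r * ‖x‖ : ℝ)) * h x)
      {a : ℂ | |a.re| < r} := by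
  intro a₀ ha₀
  simp only [mem_ofPred_eq] at ha₀
  obtain ⟨s, hs1, hs2⟩ := exists_between ha₀
  have hδ : 0 < r - s := sub_pos.2 hs2
  have hin : ∀ x : EuclideanSpace ℝ (Fin n), |⟪x, ω⟫| ≤ ‖x‖ := fun x => by
    simpa [hω] using abs_real_inner_le_norm x ω
  have hcont : ∀ a : ℂ, Continuous fun x : EuclideanSpace ℝ (Fin n) =>
      Complex.exp (a * (⟪x, ω⟫ : ℝ) - (r * ‖x‖ : ℝ)) := fun a => by fun_prop
  have hre : ∀ (a : ℂ) (x : EuclideanSpace ℝ (Fin n)), |a.re| ≤ s →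
      ‖Complex.exp (a * (⟪x, ω⟫ : ℝ) - (r * ‖x‖ : ℝ))‖ ≤ Real.exp (-((r - s) * ‖x‖)) := by
    intro a x ha
    rw [Complex.norm_exp, Complex.sub_re, Complex.re_mul_ofReal, Complex.ofReal_re]
    gcongr
    have h1 : a.re * ⟪x, ω⟫ ≤ s * ‖x‖ := (le_abs_self _).trans (by
      rw [abs_mul]
      exact mul_le_mul ha (hin x) (abs_nonneg _) ((abs_nonneg _).trans ha))
    linarith
  have hU : {a : ℂ | |a.re| < s} ∈ 𝓝 a₀ :=
    (isOpen_lt (by fun_prop) continuous_const).mem_nhds hs1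
  refine (hasDerivAt_integral_of_dominated_loc_of_deriv_le (s := {a : ℂ | |a.re| < s})
    (F' := fun a x => (⟪x, ω⟫ : ℝ) * Complex.exp (a * (⟪x, ω⟫ : ℝ) - (r * ‖x‖ : ℝ)) * h x)
    (bound := fun x => (1 / (r - s)) * ‖h x‖) hU
    (Eventually.of_forall fun a => (hcont a).aestronglyMeasurable.mul hh.1) ?_ ?_ ?_
    (hh.norm.const_mul _) ?_).2.differentiableAt.differentiableWithinAt
  · refine hh.bdd_mul (c := 1) (hcont a₀).aestronglyMeasurable (Eventually.of_forall fun x => ?_)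
    refine (hre a₀ x hs1.le).trans (Real.exp_le_one_iff.2 ?_)
    have := mul_nonneg hδ.le (norm_nonneg x)
    linarith
  · exact ((by fun_prop : Continuous fun x : EuclideanSpace ℝ (Fin n) =>
      ((⟪x, ω⟫ : ℝ) : ℂ)).mul (hcont a₀)).aestronglyMeasurable.mul hh.1
  · refine Eventually.of_forall fun x a ha => ?_
    rw [norm_mul, norm_mul, Complex.norm_real, Real.norm_eq_abs]
    gcongr
    calc |⟪x, ω⟫| * ‖Complex.exp (a * (⟪x, ω⟫ : ℝ) - (r * ‖x‖ : ℝ))‖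
        ≤ ‖x‖ * Real.exp (-((r - s) * ‖x‖)) := by
          gcongr
          · exact hin x
          · exact hre a x (le_of_lt ha)
      _ ≤ 1 / (r - s) := by
          rw [Real.exp_neg, le_div_iff₀ hδ, mul_right_comm, ← div_eq_mul_inv,
            div_le_one (Real.exp_pos _)]
          have := Real.add_one_le_exp ((r - s) * ‖x‖)
          linarith
  · refine Eventually.of_forall fun x a _ => ?_
    have h1 : HasDerivAt (fun a : ℂ => a * (⟪x, ω⟫ : ℝ) - (r * ‖x‖ : ℝ)) ((⟪x, ω⟫ : ℝ) : ℂ) a := by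
      simpa using ((hasDerivAt_id a).mul_const ((⟪x, ω⟫ : ℝ) : ℂ)).sub_const ((r * ‖x‖ : ℝ) : ℂ)
    convert! (h1.cexp.mul_const (h x)) using 1
    ring

/-- If the Laplace transforms along all directions vanish on a set with an accumulation point in
the strip of holomorphy, then the function vanishes. -/
theorem ae_eq_zero_of_frequently_laplace {h : EuclideanSpace ℝ (Fin n) → ℂ} (hh : Integrable h)
    {r : ℝ} {a₀ : ℂ} (ha₀ : |a₀.re| < r) [NeZero n]
    (hfr : ∀ ω : EuclideanSpace ℝ (Fin n), ‖ω‖ = 1 → ∃ᶠ a in 𝓝[≠] a₀,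
      ∫ x, Complex.exp (a * (⟪x, ω⟫ : ℝ) - (r * ‖x‖ : ℝ)) * h x = 0) : ∀ᵐ x, h x = 0 := by
  have hr : 0 < r := (abs_nonneg _).trans_lt ha₀
  have hopen : IsOpen {a : ℂ | |a.re| < r} := isOpen_lt (by fun_prop) continuous_const
  have hconv : Convex ℝ {a : ℂ | |a.re| < r} := by
    have : {a : ℂ | |a.re| < r} = Complex.reLm ⁻¹' (Ioo (-r) r) := by
      ext a; simp [abs_lt]
    rw [this]
    exact (convex_Ioo _ _).linear_preimage Complex.reLm
  have hzero : ∀ ω : EuclideanSpace ℝ (Fin n), ‖ω‖ = 1 → ∀ a : ℂ, |a.re| < r →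
      ∫ x, Complex.exp (a * (⟪x, ω⟫ : ℝ) - (r * ‖x‖ : ℝ)) * h x = 0 := fun ω hω a ha =>
    ((differentiableOn_laplace hh r hω).analyticOnNhd hopen
      ).eqOn_zero_of_preconnected_of_frequently_eq_zero hconv.isPreconnected ha₀ (hfr ω hω) ha
  have hk : Integrable fun x : EuclideanSpace ℝ (Fin n) => Complex.exp (-(r * ‖x‖ : ℝ)) * h x := by
    refine hh.bdd_mul (c := 1) (by fun_prop : Continuous _).aestronglyMeasurable
      (Eventually.of_forall fun x => ?_)
    rw [Complex.norm_exp]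
    refine Real.exp_le_one_iff.2 ?_
    have := mul_nonneg hr.le (norm_nonneg x)
    simpa using this
  obtain ⟨e₀, he₀⟩ : ∃ e : EuclideanSpace ℝ (Fin n), ‖e‖ = 1 := exists_norm_eq _ zero_le_one
  have hF : ∀ ξ,
      𝓕 (fun x : EuclideanSpace ℝ (Fin n) => Complex.exp (-(r * ‖x‖ : ℝ)) * h x) ξ = 0 := by
    intro ξ
    obtain ⟨ω, hω, hξ⟩ : ∃ ω : EuclideanSpace ℝ (Fin n), ‖ω‖ = 1 ∧ ξ = ‖ξ‖ • ω := by
      rcases eq_or_ne ξ 0 with rfl | hξ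
      · exact ⟨e₀, he₀, by simp⟩
      · exact ⟨‖ξ‖⁻¹ • ξ, by simp [norm_smul, hξ], by simp [smul_smul, hξ]⟩
    have h1 := hzero ω hω (-(2 * Real.pi * ‖ξ‖ : ℝ) * Complex.I) (by simpa using hr)
    rw [Real.fourier_eq', ← h1]
    refine integral_congr_ae (Eventually.of_forall fun x => ?_)
    simp only [smul_eq_mul]
    rw [← mul_assoc, ← Complex.exp_add]
    congr 2
    conv_lhs => rw [hξ, real_inner_smul_right]
    push_cast
    ring
  filter_upwards [ae_eq_zero_of_fourier_eq_zero hk hF] with x hx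
  exact (mul_eq_zero.1 hx).resolve_left (Complex.exp_ne_zero _)

/-- Exponentials are eigenfunctions of the heat semigroup. -/
theorem integral_heatKernel_mul_cexp {t : ℝ} (ht : 0 < t) (a : ℂ)
    {ω : EuclideanSpace ℝ (Fin n)} (hω : ‖ω‖ = 1) (x : EuclideanSpace ℝ (Fin n)) :
    ∫ y, (heatKernel t (x - y) : ℂ) * Complex.exp (a * (⟪y, ω⟫ : ℝ)) =
      Complex.exp (t * a ^ 2) * Complex.exp (a * (⟪x, ω⟫ : ℝ)) := by
  have hb : 0 < ((1 / (4 * t) : ℝ) : ℂ).re := by rw [Complex.ofReal_re]; positivity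
  have h1 := GaussianFourier.integral_cexp_neg_mul_sq_norm_add hb (-a) ω
  rw [← integral_sub_left_eq_self _ volume x]
  have h2 : ∀ y : EuclideanSpace ℝ (Fin n),
      (heatKernel t (x - (x - y)) : ℂ) * Complex.exp (a * (⟪x - y, ω⟫ : ℝ)) =
      (((4 * Real.pi * t) ^ (-(n : ℝ) / 2) : ℝ) : ℂ) * Complex.exp (a * (⟪x, ω⟫ : ℝ)) *
      Complex.exp (-((1 / (4 * t) : ℝ) : ℂ) * (‖y‖ : ℂ) ^ 2 + -a * (⟪ω, y⟫ : ℝ)) := by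
    intro y
    rw [sub_sub_cancel, heatKernel, inner_sub_left, real_inner_comm ω y]
    rw [Complex.ofReal_mul, Complex.ofReal_exp, mul_assoc _ (Complex.exp _),
      mul_assoc _ (Complex.exp _), ← Complex.exp_add, ← Complex.exp_add]
    congr 2
    push_cast
    ring
  simp_rw [h2]
  rw [integral_const_mul, h1, finrank_euclideanSpace_fin, hω]
  have e1 : ((Real.pi : ℂ) / ((1 / (4 * t) : ℝ) : ℂ)) = ((4 * Real.pi * t : ℝ) : ℂ) := by
    push_cast
    have : (t : ℂ) ≠ 0 := by exact_mod_cast ht.ne'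
    field_simp
  have e2 : (((4 * Real.pi * t : ℝ) : ℂ) ^ ((n : ℂ) / 2)) =
      (((4 * Real.pi * t) ^ ((n : ℝ) / 2) : ℝ) : ℂ) := by
    rw [Complex.ofReal_cpow (by positivity)]
    push_cast
    rfl
  have e3 : (((4 * Real.pi * t) ^ (-(n : ℝ) / 2) : ℝ) : ℂ) *
      (((4 * Real.pi * t) ^ ((n : ℝ) / 2) : ℝ) : ℂ) = 1 := by
    rw [← Complex.ofReal_mul, ← Real.rpow_add (by positivity)]
    simp [neg_div]
  have e4 : (-a) ^ 2 * ((1 : ℝ) : ℂ) ^ 2 / (4 * ((1 / (4 * t) : ℝ) : ℂ)) = t * a ^ 2 := by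
    push_cast
    have : (t : ℂ) ≠ 0 := by exact_mod_cast ht.ne'
    field_simp
  rw [e1, e2, e4]
  linear_combination (Complex.exp (a * (⟪x, ω⟫ : ℝ)) * Complex.exp (t * a ^ 2)) * e3

end Exponentials

/-! ### Chaos above the critical constant -/

section Chaos

open Filter Topology

variable {n : ℕ}

theorem lintegral_weightedMeasure (ρ : ℝ) {F : EuclideanSpace ℝ (Fin n) → ℝ≥0∞}
    (hF : Measurable F) :
    ∫⁻ x, F x ∂weightedMeasure n ρ = ∫⁻ x, ENNReal.ofReal (phi ρ x ^ 2) * F x := by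
  rw [weightedMeasure, lintegral_withDensity_eq_lintegral_mul _ (measurable_weight ρ) hF]
  rfl

instance (ρ : ℝ) : SigmaFinite (weightedMeasure n ρ) :=
  SigmaFinite.withDensity_ofReal _

theorem conjHeat_coeFn [NeZero n] (ρ : ℝ) (p : ℝ≥0∞) [Fact (1 ≤ p)] (c : ℝ) (t : ℝ≥0)
    (f : Lp ℂ p (weightedMeasure n ρ)) :
    conjHeat ρ p c t f =ᵐ[weightedMeasure n ρ] conjHeatFun ρ c t f :=
  MemLp.coeFn_toLp (memLp_conjHeatFun ρ c t f)

theorem conjHeat_toLp [NeZero n] (ρ : ℝ) (p : ℝ≥0∞) [Fact (1 ≤ p)] (c : ℝ) (t : ℝ≥0)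
    {f : EuclideanSpace ℝ (Fin n) → ℂ} (hf : MemLp f p (weightedMeasure n ρ)) :
    conjHeat ρ p c t (hf.toLp f) =ᵐ[weightedMeasure n ρ] conjHeatFun ρ c t f := by
  refine (conjHeat_coeFn ρ p c t _).trans ?_
  rcases eq_or_ne t 0 with rfl | ht
  · rw [conjHeatFun_zero, conjHeatFun_zero]
    exact hf.coeFn_toLp
  · exact Eventually.of_forall fun x =>
      conjHeatFun_congr ρ c (pos_iff_ne_zero.2 ht) ((ac_weighted ρ).ae_le hf.coeFn_toLp) x

/-- The functions `φ_{iρ}⁻¹ exp (a ⟪x, ω⟫)`, which are joint eigenfunctions of the operators. -/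
noncomputable def expEigenfun (ρ : ℝ) (a : ℂ) (ω x : EuclideanSpace ℝ (Fin n)) : ℂ :=
  (phi ρ x : ℂ)⁻¹ * Complex.exp (a * (⟪x, ω⟫ : ℝ))

theorem conjHeatFun_expEigenfun [NeZero n] (ρ c : ℝ) (t : ℝ≥0) (a : ℂ)
    {ω : EuclideanSpace ℝ (Fin n)} (hω : ‖ω‖ = 1) (x : EuclideanSpace ℝ (Fin n)) :
    conjHeatFun ρ c t (expEigenfun ρ a ω) x =
      Complex.exp ((t : ℝ) * ((c - ρ ^ 2 : ℝ) + a ^ 2)) * expEigenfun ρ a ω x := by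
  rcases eq_or_ne t 0 with rfl | ht
  · simp [conjHeatFun_zero]
  have ht' : (0 : ℝ) < t := by exact_mod_cast pos_iff_ne_zero.2 ht
  have h1 : ∀ y : EuclideanSpace ℝ (Fin n), (phi ρ y : ℂ) * expEigenfun ρ a ω y =
      Complex.exp (a * (⟪y, ω⟫ : ℝ)) := by
    intro y
    have : (phi ρ y : ℂ) ≠ 0 := by exact_mod_cast (phi_pos ρ y).ne'
    rw [expEigenfun, mul_inv_cancel_left₀ this]
  rw [conjHeatFun, heatOp, if_neg ht]
  simp_rw [h1]
  rw [integral_heatKernel_mul_cexp ht' a hω, expEigenfun]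
  have h2 : Complex.exp ((t : ℝ) * ((c - ρ ^ 2 : ℝ) + a ^ 2)) =
      (Real.exp (c * t) : ℂ) * (Real.exp (-(t * ρ ^ 2)) : ℂ) * Complex.exp ((t : ℝ) * a ^ 2) := by
    push_cast
    rw [← Complex.exp_add, ← Complex.exp_add]
    congr 1
    ring
  rw [h2]
  ring

/-- `e^{r|x|} / φ_{iρ}` belongs to `L^p (φ_{iρ}² dx)` if `p r < (p - 2) ρ`. -/
theorem memLp_exp_div_phi [NeZero n] {ρ r : ℝ} (hρ : 0 < ρ) {p : ℝ≥0∞} (hp2 : 2 < p)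
    (hp : p ≠ ∞) (hr : r < (1 - 2 / p.toReal) * ρ) :
    MemLp (fun x : EuclideanSpace ℝ (Fin n) => ((Real.exp (r * ‖x‖) / phi ρ x : ℝ) : ℂ)) p
      (weightedMeasure n ρ) := by
  have hP : 2 < p.toReal := by
    have := (ENNReal.toReal_lt_toReal ENNReal.ofNat_ne_top hp).2 hp2
    simpa using this
  set P := p.toReal with hPdef
  have hp0 : p ≠ 0 := (lt_trans (by norm_num) hp2).ne'
  have hr1 : r * P / (P - 2) < ρ := by
    rw [div_lt_iff₀ (by linarith)]
    have h1 := mul_lt_mul_of_pos_right hr (by linarith : 0 < P)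
    have h2 : (1 - 2 / P) * ρ * P = ρ * (P - 2) := by field_simp
    linarith
  obtain ⟨s, hs1, hs2⟩ := exists_between hr1
  rw [div_lt_iff₀ (by linarith)] at hs1
  obtain ⟨C, hC, hlow⟩ := exists_mul_exp_le_phi (n := n) hρ hs2
  have hmeas : Measurable fun x : EuclideanSpace ℝ (Fin n) =>
      ((Real.exp (r * ‖x‖) / phi ρ x : ℝ) : ℂ) :=
    Complex.measurable_ofReal.comp
      ((by fun_prop : Measurable fun x : EuclideanSpace ℝ (Fin n) => Real.exp (r * ‖x‖)).div
        (measurable_phi ρ))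
  refine ⟨hmeas.aestronglyMeasurable, ?_⟩
  rw [eLpNorm_lt_top_iff_lintegral_rpow_enorm_lt_top hp0 hp,
    lintegral_weightedMeasure ρ (hmeas.enorm.pow_const _)]
  have hint : Integrable fun x : EuclideanSpace ℝ (Fin n) =>
      C ^ (2 - P) * Real.exp (-(s * (P - 2) - r * P) * ‖x‖) :=
    (integrable_exp_neg_mul_norm (by linarith)).const_mul _
  refine lt_of_le_of_lt (lintegral_mono fun x => ?_) hint.lintegral_lt_top
  have hφ := phi_pos ρ x
  rw [← ofReal_norm, Complex.norm_real, Real.norm_of_nonneg (by positivity),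
    ENNReal.ofReal_rpow_of_nonneg (by positivity) (by linarith),
    ← ENNReal.ofReal_mul (by positivity)]
  refine ENNReal.ofReal_le_ofReal ?_
  have h1 : phi ρ x ^ 2 * (Real.exp (r * ‖x‖) / phi ρ x) ^ P =
      Real.exp (r * P * ‖x‖) * phi ρ x ^ (2 - P) := by
    rw [Real.div_rpow (Real.exp_pos _).le hφ.le, ← Real.exp_mul, Real.rpow_sub hφ]
    norm_num
    rw [mul_right_comm r]
    ring
  have h2 : phi ρ x ^ (2 - P) ≤ (C * Real.exp (s * ‖x‖)) ^ (2 - P) :=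
    Real.rpow_le_rpow_of_nonpos (by positivity) (hlow x) (by linarith)
  calc _ = Real.exp (r * P * ‖x‖) * phi ρ x ^ (2 - P) := h1
    _ ≤ Real.exp (r * P * ‖x‖) * (C * Real.exp (s * ‖x‖)) ^ (2 - P) := by gcongr
    _ = _ := by
      rw [Real.mul_rpow hC.le (Real.exp_pos _).le, ← Real.exp_mul, mul_left_comm, ← Real.exp_add]
      congr 2
      ring

theorem expEigenfun_eq_mul (ρ r : ℝ) (a : ℂ) (ω x : EuclideanSpace ℝ (Fin n)) :
    expEigenfun ρ a ω x = Complex.exp (a * (⟪x, ω⟫ : ℝ) - (r * ‖x‖ : ℝ)) *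
      ((Real.exp (r * ‖x‖) / phi ρ x : ℝ) : ℂ) := by
  rw [Complex.exp_sub, expEigenfun]
  push_cast
  field_simp [Complex.exp_ne_zero]

theorem norm_cexp_sub_le_one {r : ℝ} {a : ℂ} (ha : |a.re| ≤ r)
    {ω : EuclideanSpace ℝ (Fin n)} (hω : ‖ω‖ = 1) (x : EuclideanSpace ℝ (Fin n)) :
    ‖Complex.exp (a * (⟪x, ω⟫ : ℝ) - (r * ‖x‖ : ℝ))‖ ≤ 1 := by
  rw [Complex.norm_exp, Complex.sub_re, Complex.re_mul_ofReal, Complex.ofReal_re,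
    Real.exp_le_one_iff, sub_nonpos]
  refine (le_abs_self _).trans ?_
  rw [abs_mul]
  refine mul_le_mul ha ?_ (abs_nonneg _) ((abs_nonneg _).trans ha)
  simpa [hω] using abs_real_inner_le_norm x ω

theorem memLp_expEigenfun [NeZero n] {ρ : ℝ} (hρ : 0 < ρ) {p : ℝ≥0∞} (hp2 : 2 < p)
    (hp : p ≠ ∞) {a : ℂ} (ha : |a.re| < (1 - 2 / p.toReal) * ρ)
    {ω : EuclideanSpace ℝ (Fin n)} (hω : ‖ω‖ = 1) :
    MemLp (expEigenfun ρ a ω) p (weightedMeasure n ρ) := by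
  have h := memLp_mul_of_bounded (memLp_exp_div_phi (n := n) hρ hp2 hp ha)
    (u := fun x => Complex.exp (a * (⟪x, ω⟫ : ℝ) - (|a.re| * ‖x‖ : ℝ)))
    (by fun_prop : Continuous _).measurable (norm_cexp_sub_le_one le_rfl hω)
  refine h.ae_eq ?_
  exact Eventually.of_forall fun x => (expEigenfun_eq_mul ρ _ a ω x).symm

/-- The parameters of the eigenfunctions in `L^p`: the exponent `a` in the open strip
`|Re a| < γ_p ρ` and the direction `ω`. -/
abbrev EigenIndex (n : ℕ) (ρ : ℝ) (p : ℝ≥0∞) : Type :=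
  {z : ℂ × EuclideanSpace ℝ (Fin n) // |z.1.re| < (1 - 2 / p.toReal) * ρ ∧ ‖z.2‖ = 1}

/-- The eigenfunctions whose exponents lie in a set with an accumulation point in the strip span a
dense subspace. -/
theorem dense_span_expEigenfun [NeZero n] {ρ : ℝ} (hρ : 0 < ρ) {p : ℝ≥0∞} [Fact (1 ≤ p)]
    (hp2 : 2 < p) (hp : p ≠ ∞) (S : Set ℂ) {a₀ : ℂ} (ha₀ : |a₀.re| < (1 - 2 / p.toReal) * ρ)
    (hS : ∃ᶠ a in 𝓝[≠] a₀, a ∈ S) :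
    Dense (Submodule.span ℂ ((fun i : EigenIndex n ρ p =>
      (memLp_expEigenfun hρ hp2 hp i.2.1 i.2.2).toLp (expEigenfun ρ i.1.1 i.1.2)) ''
        {i | i.1.1 ∈ S}) : Set (Lp ℂ p (weightedMeasure n ρ))) := by
  refine dense_of_forall_functional _ fun Λ hΛ => ?_
  obtain ⟨r, hr1, hr2⟩ := exists_between ha₀
  have hg := memLp_exp_div_phi (n := n) hρ hp2 hp hr2
  obtain ⟨h, hh, hrep⟩ := exists_density (weighted_ac (n := n) ρ) hp Λ hg
  have hz : ∀ᵐ x, h x = 0 := by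
    refine ae_eq_zero_of_frequently_laplace hh hr1 fun ω hω => ?_
    have hstrip : ∀ᶠ a in 𝓝[≠] a₀, |a.re| < r :=
      nhdsWithin_le_nhds ((isOpen_lt (by fun_prop) continuous_const).mem_nhds hr1)
    refine (hS.and_eventually hstrip).mono fun a ⟨haS, har⟩ => ?_
    have hb := norm_cexp_sub_le_one har.le hω
    have hm : Measurable fun x : EuclideanSpace ℝ (Fin n) =>
        Complex.exp (a * (⟪x, ω⟫ : ℝ) - (r * ‖x‖ : ℝ)) := (by fun_prop : Continuous _).measurable
    rw [← hrep _ 1 hm hb (memLp_mul_of_bounded hg hm hb)]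
    rw [← hΛ _ (Submodule.subset_span ⟨⟨(a, ω), har.trans hr2, hω⟩, haS, rfl⟩)]
    congr 1
    exact MemLp.toLp_congr _ _ (Eventually.of_forall fun x => (expEigenfun_eq_mul ρ r a ω x).symm)
  refine functional_eq_zero_of_bounded_mul hp Λ (g := fun x =>
    ((Real.exp (r * ‖x‖) / phi ρ x : ℝ) : ℂ)) ?_ (fun x => ?_) fun u K hu hK hug => ?_
  · exact Complex.measurable_ofReal.comp
      ((by fun_prop : Measurable fun x : EuclideanSpace ℝ (Fin n) => Real.exp (r * ‖x‖)).div
        (measurable_phi ρ))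
  · have := phi_pos ρ x
    exact_mod_cast (div_pos (Real.exp_pos _) this).ne'
  · rw [hrep u K hu hK hug]
    refine integral_eq_zero_of_ae ?_
    filter_upwards [hz] with x hx
    simp [hx]

/-- On the level set `Re (a² - κ) = 0` the exponents with `a² - κ ∈ 2πiℚ` accumulate. -/
theorem frequently_sq_eq_rat {κ x y : ℝ} (hx : 0 < x) (hxy : x ^ 2 - y ^ 2 = κ) :
    ∃ᶠ a in 𝓝[≠] ((x : ℂ) + y * Complex.I),
      ∃ q : ℚ, a ^ 2 - κ = 2 * Real.pi * Complex.I * q := by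
  set a₀ : ℂ := (x : ℂ) + y * Complex.I with ha₀
  have ha0 : a₀ ≠ 0 := fun h => hx.ne' (by simpa [ha₀] using congrArg Complex.re h)
  -- squaring is open at `a₀ ≠ 0`
  have hmap : Filter.map (fun a : ℂ => a ^ 2) (𝓝 a₀) = 𝓝 (a₀ ^ 2) := by
    have h := (hasStrictDerivAt_pow 2 a₀)
    refine h.map_nhds_eq ?_
    simpa using ha0
  set τ : ℝ := x * y / Real.pi with hτ
  have hsq : a₀ ^ 2 = κ + 2 * Real.pi * Complex.I * τ := by
    have hπ : (Real.pi : ℂ) ≠ 0 := by exact_mod_cast Real.pi_ne_zero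
    rw [ha₀, hτ, ← hxy]
    push_cast
    field_simp
    linear_combination (y : ℂ) ^ 2 * Complex.I_sq
  rw [frequently_iff]
  intro U hU
  rw [mem_nhdsWithin_iff_exists_mem_nhds_inter] at hU
  obtain ⟨V, hV, hVU⟩ := hU
  have hV2 : (fun a : ℂ => a ^ 2) '' V ∈ 𝓝 (a₀ ^ 2) := by
    rw [← hmap]; exact image_mem_map hV
  have hc : Tendsto (fun s : ℝ => (κ : ℂ) + 2 * Real.pi * Complex.I * s) (𝓝 τ) (𝓝 (a₀ ^ 2)) := by
    rw [hsq]
    exact (by fun_prop : Continuous fun s : ℝ => (κ : ℂ) + 2 * Real.pi * Complex.I * s).tendsto τ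
  obtain ⟨ε, hε, hball⟩ := Metric.mem_nhds_iff.1 (hc hV2)
  obtain ⟨q, hq1, hq2⟩ := exists_rat_btwn (lt_add_of_pos_right τ hε)
  have hqb : (q : ℝ) ∈ ball τ ε := by
    rw [mem_ball, Real.dist_eq, abs_lt]
    constructor <;> linarith
  obtain ⟨a, haV, ha⟩ := hball hqb
  simp only at ha
  refine ⟨a, hVU ⟨haV, fun h => ?_⟩, q, ?_⟩
  · rw [mem_singleton_iff] at h
    rw [h, hsq] at ha
    have h2 : (2 * Real.pi * Complex.I : ℂ) ≠ 0 := by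
      simp [Real.pi_ne_zero]
    have h3 := mul_left_cancel₀ h2 (add_left_cancel ha)
    exact hq1.ne (by exact_mod_cast h3)
  · rw [ha]; push_cast; ring

theorem isChaotic_conjHeat [NeZero n] {ρ : ℝ} (hρ : 0 < ρ) {p : ℝ≥0∞} [Fact (1 ≤ p)]
    (hp2 : 2 < p) (hp : p ≠ ∞) {c : ℝ} (hc : ρ ^ 2 * (1 - (1 - 2 / p.toReal) ^ 2) < c) :
    IsChaotic (conjHeat (n := n) ρ p c) := by
  have : Fact (p ≠ ∞) := ⟨hp⟩
  have hP : 2 < p.toReal := by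
    have := (ENNReal.toReal_lt_toReal ENNReal.ofNat_ne_top hp).2 hp2
    simpa using this
  set γ := 1 - 2 / p.toReal with hγ
  have hγ0 : 0 < γ := by
    rw [hγ, sub_pos, div_lt_one (by linarith)]; exact hP
  have hγρ : 0 < γ * ρ := mul_pos hγ0 hρ
  -- `x` in the strip with `x² > ρ² - c`
  obtain ⟨x, hx0, hxγ, hxκ⟩ : ∃ x, 0 < x ∧ x < γ * ρ ∧ ρ ^ 2 - c < x ^ 2 := by
    have h1 : max 0 (ρ ^ 2 - c) < (γ * ρ) ^ 2 := max_lt (by positivity) (by nlinarith)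
    obtain ⟨w, hw1, hw2⟩ := exists_between h1
    have hw0 : 0 < w := (le_max_left _ _).trans_lt hw1
    refine ⟨√w, Real.sqrt_pos.2 hw0, ?_, ?_⟩
    · rw [Real.sqrt_lt' hγρ]; exact hw2
    · rw [Real.sq_sqrt hw0.le]; exact (le_max_right _ _).trans_lt hw1
  have hcont : Continuous fun a : ℂ => (((c - ρ ^ 2 : ℝ) : ℂ) + a ^ 2).re := by fun_prop
  refine isChaotic_of_eigenvectors
    (e := fun i : EigenIndex n ρ p =>
      (memLp_expEigenfun hρ hp2 hp i.2.1 i.2.2).toLp (expEigenfun ρ i.1.1 i.1.2))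
    (μ := fun i => ((c - ρ ^ 2 : ℝ) : ℂ) + i.1.1 ^ 2) ?_ ?_ ?_ ?_
  · intro i t
    refine Lp.ext ?_
    refine (conjHeat_toLp ρ p c t (memLp_expEigenfun hρ hp2 hp i.2.1 i.2.2)).trans ?_
    have h1 := Lp.coeFn_smul (Complex.exp ((t : ℝ) * (((c - ρ ^ 2 : ℝ) : ℂ) + i.1.1 ^ 2)))
      ((memLp_expEigenfun hρ hp2 hp i.2.1 i.2.2).toLp (expEigenfun ρ i.1.1 i.1.2))
    filter_upwards [h1, (memLp_expEigenfun hρ hp2 hp i.2.1 i.2.2).coeFn_toLp] with y hy1 hy2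
    rw [hy1, Pi.smul_apply, hy2, conjHeatFun_expEigenfun ρ c t i.1.1 i.2.2, smul_eq_mul]
  · refine dense_span_expEigenfun hρ hp2 hp {a | 0 < (((c - ρ ^ 2 : ℝ) : ℂ) + a ^ 2).re}
      (a₀ := x) ?_ ?_
    · rw [Complex.ofReal_re, abs_of_pos hx0]; exact hxγ
    · refine Eventually.frequently (nhdsWithin_le_nhds
        ((isOpen_lt continuous_const hcont).mem_nhds ?_))
      show 0 < (((c - ρ ^ 2 : ℝ) : ℂ) + (x : ℂ) ^ 2).re
      rw [← Complex.ofReal_pow, ← Complex.ofReal_add, Complex.ofReal_re]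
      linarith
  · set y := √(c ^ 2 + 1) with hy
    refine dense_span_expEigenfun hρ hp2 hp {a | (((c - ρ ^ 2 : ℝ) : ℂ) + a ^ 2).re < 0}
      (a₀ := y * Complex.I) ?_ ?_
    · simpa using hγρ
    · refine Eventually.frequently (nhdsWithin_le_nhds
        ((isOpen_lt hcont continuous_const).mem_nhds ?_))
      show (((c - ρ ^ 2 : ℝ) : ℂ) + ((y : ℂ) * Complex.I) ^ 2).re < 0
      have h1 : ((y : ℂ) * Complex.I) ^ 2 = ((-(c ^ 2 + 1) : ℝ) : ℂ) := by
        rw [mul_pow, Complex.I_sq, ← Complex.ofReal_pow, hy, Real.sq_sqrt (by positivity)]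
        push_cast; ring
      rw [h1, ← Complex.ofReal_add, Complex.ofReal_re]
      nlinarith [sq_nonneg (c - 1), sq_nonneg ρ]
  · have hfr := frequently_sq_eq_rat (κ := ρ ^ 2 - c) (y := √(x ^ 2 - (ρ ^ 2 - c))) hx0 (by
      rw [Real.sq_sqrt (by linarith)]; ring)
    refine dense_span_expEigenfun hρ hp2 hp
      {a | ∃ q : ℚ, ((c - ρ ^ 2 : ℝ) : ℂ) + a ^ 2 = 2 * Real.pi * Complex.I * q} ?_
      (hfr.mono fun a ⟨q, hq⟩ => ⟨q, by rw [← hq]; push_cast; ring⟩)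
    simpa [abs_of_pos hx0] using hxγ

end Chaos

/-! ### Boundedness at and below the critical constant -/

section Boundedness

open Filter Topology

variable {n : ℕ}

/-- The exponent of `h_t^q φ^{2-q}` at radius `r`, with the square completed around the radius
`2tργ`, where `q γ = 2 - q`; the linear term `(N q / 2) ρ |r - 2tργ| / √t` coming from polynomial
factors is absorbed into the Gaussian. -/
theorem exponent_le {q γ ρ t r N : ℝ} (hq : 0 < q) (hγ : q * γ = 2 - q) (ht : 0 < t) :
    -(q * (r ^ 2 / (4 * t))) + (2 - q) * (ρ * r) +
      N * q / 2 * (2 * ρ ^ 2 * γ + ρ * (|r - 2 * t * ρ * γ| / √t)) ≤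
    t * (q * γ ^ 2 * ρ ^ 2) + (N * q * ρ ^ 2 * γ + N ^ 2 * q * ρ ^ 2 / 2) +
      -(q / (8 * t)) * (r - 2 * t * ρ * γ) ^ 2 := by
  set w := √t with hw
  have hw0 : 0 < w := Real.sqrt_pos.2 ht
  have hw2 : t = w ^ 2 := (Real.sq_sqrt ht.le).symm
  obtain ⟨v, hv⟩ : ∃ v, r = 2 * t * ρ * γ + w * v := ⟨(r - 2 * t * ρ * γ) / w, by field_simp; ring⟩
  have e1 : r - 2 * t * ρ * γ = w * v := by rw [hv]; ring
  have e2 : |r - 2 * t * ρ * γ| / w = |v| := by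
    rw [e1, abs_mul, abs_of_pos hw0, mul_div_cancel_left₀ _ hw0.ne']
  have e3 : -(q / (8 * t)) * (r - 2 * t * ρ * γ) ^ 2 = -(q / 8) * |v| ^ 2 := by
    rw [e1, hw2, sq_abs]; field_simp
  have e4 : -(q * (r ^ 2 / (4 * t))) + (2 - q) * (ρ * r) =
      t * (q * γ ^ 2 * ρ ^ 2) - q / 4 * |v| ^ 2 := by
    rw [hv, ← hγ, hw2, sq_abs]; field_simp; ring
  rw [e2, e3, e4]
  nlinarith [mul_nonneg hq.le (sq_nonneg (|v| - 2 * N * ρ))]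

/-- The bound of the radial integrand. The surplus power `t^{-n q/2} s^{(n-1) q/2}`, with
`s = 1 + ρ r` of order `t` near the centre `2tργ` of the Gaussian, is at most of order `t^{-1/2}`. -/
theorem radial_bound {q γ ρ t r C : ℝ} [NeZero n] (hq1 : 1 < q) (hq2 : q < 2)
    (hγ : q * γ = 2 - q) (hρ : 0 < ρ) (ht : 1 ≤ t) (hr : 0 ≤ r) (hC : 0 < C) :
    r ^ (n - 1) * (((4 * Real.pi * t) ^ (-(n : ℝ) / 2) * Real.exp (-r ^ 2 / (4 * t))) ^ q *
      (C * Real.exp (2 * (ρ * r)) / (1 + ρ * r) ^ (n - 1)) ^ ((2 - q) / 2)) ≤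
    C ^ ((2 - q) / 2) * ρ⁻¹ ^ (n - 1) *
      Real.exp ((n - 1 : ℕ) * q * ρ ^ 2 * γ + ((n - 1 : ℕ) : ℝ) ^ 2 * q * ρ ^ 2 / 2) *
      (t ^ (-(1 / 2) : ℝ) * Real.exp (t * (q * γ ^ 2 * ρ ^ 2))) *
      Real.exp (-(q / (8 * t)) * (r - 2 * t * ρ * γ) ^ 2) := by
  have ht0 : 0 < t := by linarith
  have hq0 : 0 < q := by linarith
  have hγ0 : 0 ≤ γ := by
    by_contra! h
    nlinarith
  set N := n - 1 with hN
  have hnN : (n : ℝ) = N + 1 := by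
    have : 1 ≤ n := NeZero.one_le
    rw [hN, Nat.cast_sub this]; simp
  set s := 1 + ρ * r with hs
  have hs1 : 1 ≤ s := by have := mul_nonneg hρ.le hr; linarith
  have hs0 : 0 < s := by linarith
  set V := 2 * ρ ^ 2 * γ + ρ * (|r - 2 * t * ρ * γ| / √t) with hV
  have hst : s ≤ t * Real.exp V := by
    have h1 : √t ≤ t := by
      rw [Real.sqrt_le_left (by linarith)]; nlinarith
    have h2 : r - 2 * t * ρ * γ ≤ t * (|r - 2 * t * ρ * γ| / √t) := by
      refine (le_abs_self _).trans ?_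
      rw [mul_div_assoc', le_div_iff₀ (Real.sqrt_pos.2 ht0), mul_comm]
      gcongr
    have h3 := Real.add_one_le_exp V
    have h4 : s ≤ t * (V + 1) := by
      rw [hs, hV]
      nlinarith
    exact h4.trans (by gcongr)
  have hsN : (s ^ N) ^ (q / 2) ≤ (t ^ (N : ℝ)) ^ (q / 2) * Real.exp (N * q / 2 * V) := by
    calc (s ^ N) ^ (q / 2) ≤ ((t * Real.exp V) ^ N) ^ (q / 2) := by gcongr
      _ = _ := by
        rw [mul_pow, Real.mul_rpow (by positivity) (by positivity), ← Real.rpow_natCast t,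
          ← Real.exp_nat_mul, ← Real.exp_mul]
        congr 2
        ring
  have hrN : r ^ N ≤ ρ⁻¹ ^ N * s ^ N := by
    rw [← mul_pow]
    gcongr
    rw [inv_mul_eq_div, le_div_iff₀ hρ, hs]
    linarith
  have hpi : (4 * Real.pi * t) ^ (-(n : ℝ) / 2) ≤ t ^ (-(n : ℝ) / 2) := by
    refine Real.rpow_le_rpow_of_nonpos ht0 ?_ ?_
    · nlinarith [Real.pi_gt_three]
    · have : (0 : ℝ) ≤ n := Nat.cast_nonneg n
      linarith
  have hpow : (t ^ (-(n : ℝ) / 2)) ^ q * (t ^ (N : ℝ)) ^ (q / 2) ≤ t ^ (-(1 / 2) : ℝ) := by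
    rw [← Real.rpow_mul ht0.le, ← Real.rpow_mul ht0.le, ← Real.rpow_add ht0]
    refine Real.rpow_le_rpow_of_exponent_le ht ?_
    rw [hnN]
    nlinarith
  have hquot : (C * Real.exp (2 * (ρ * r)) / s ^ N) ^ ((2 - q) / 2) =
      C ^ ((2 - q) / 2) * Real.exp ((2 - q) * (ρ * r)) * (s ^ N) ^ (-((2 - q) / 2)) := by
    rw [Real.div_rpow (by positivity) (by positivity), Real.mul_rpow hC.le (by positivity),
      ← Real.exp_mul, Real.rpow_neg (by positivity), div_eq_mul_inv]
    congr 3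
    ring
  have hcomb : s ^ N * (s ^ N) ^ (-((2 - q) / 2)) = (s ^ N) ^ (q / 2) := by
    nth_rewrite 1 [← Real.rpow_one (s ^ N)]
    rw [← Real.rpow_add (by positivity)]
    congr 1
    ring
  have hexp := exponent_le (N := N) (r := r) (ρ := ρ) hq0 hγ ht0
  rw [← hV] at hexp
  calc r ^ N * (((4 * Real.pi * t) ^ (-(n : ℝ) / 2) * Real.exp (-r ^ 2 / (4 * t))) ^ q *
      (C * Real.exp (2 * (ρ * r)) / s ^ N) ^ ((2 - q) / 2))
      ≤ (ρ⁻¹ ^ N * s ^ N) * ((t ^ (-(n : ℝ) / 2) * Real.exp (-r ^ 2 / (4 * t))) ^ q *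
      (C * Real.exp (2 * (ρ * r)) / s ^ N) ^ ((2 - q) / 2)) := by gcongr
    _ = C ^ ((2 - q) / 2) * ρ⁻¹ ^ N * ((t ^ (-(n : ℝ) / 2)) ^ q * (s ^ N) ^ (q / 2)) *
        Real.exp (-(q * (r ^ 2 / (4 * t))) + (2 - q) * (ρ * r)) := by
      rw [hquot, Real.mul_rpow (by positivity) (by positivity), ← Real.exp_mul, Real.exp_add,
        ← hcomb, show -r ^ 2 / (4 * t) * q = -(q * (r ^ 2 / (4 * t))) by ring]
      ring
    _ ≤ C ^ ((2 - q) / 2) * ρ⁻¹ ^ N * ((t ^ (-(n : ℝ) / 2)) ^ q *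
        ((t ^ (N : ℝ)) ^ (q / 2) * Real.exp (N * q / 2 * V))) *
        Real.exp (-(q * (r ^ 2 / (4 * t))) + (2 - q) * (ρ * r)) := by gcongr
    _ = C ^ ((2 - q) / 2) * ρ⁻¹ ^ N * ((t ^ (-(n : ℝ) / 2)) ^ q * (t ^ (N : ℝ)) ^ (q / 2)) *
        Real.exp (-(q * (r ^ 2 / (4 * t))) + (2 - q) * (ρ * r) + N * q / 2 * V) := by
      rw [Real.exp_add _ (N * q / 2 * V)]; ring
    _ ≤ C ^ ((2 - q) / 2) * ρ⁻¹ ^ N * t ^ (-(1 / 2) : ℝ) *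
        Real.exp (t * (q * γ ^ 2 * ρ ^ 2) + (N * q * ρ ^ 2 * γ + (N : ℝ) ^ 2 * q * ρ ^ 2 / 2) +
          -(q / (8 * t)) * (r - 2 * t * ρ * γ) ^ 2) := by gcongr
    _ = _ := by rw [Real.exp_add, Real.exp_add]; ring

theorem lintegral_gaussian_shift {b : ℝ} (hb : 0 < b) (s : ℝ) :
    ∫⁻ r : ℝ, ENNReal.ofReal (Real.exp (-b * (r - s) ^ 2)) = ENNReal.ofReal √(Real.pi / b) := by
  rw [lintegral_sub_right_eq_self (fun r : ℝ => ENNReal.ofReal (Real.exp (-b * r ^ 2))) s,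
    ← ofReal_integral_eq_lintegral_ofReal (integrable_exp_neg_mul_sq hb)
      (Eventually.of_forall fun _ => (Real.exp_pos _).le), integral_gaussian]

/-- The decisive estimate: the norm of `φ_{iρ}⁻¹ h_t` in `L^q (φ_{iρ}² dx)` is
`O(e^{tγ²ρ²})` where `γ = 2/q - 1`. No power of `t` is lost: after the polynomial decay of
`e^{-ρ|x|} φ_{iρ}` has been used, a factor `t^{-1/2}` remains, and it is absorbed by the width
`t^{1/2}` of the Gaussian in the radius. -/
theorem exists_lintegral_heatKernel_rpow_le [NeZero n] {q γ ρ : ℝ} (hq1 : 1 < q) (hq2 : q < 2)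
    (hγ : q * γ = 2 - q) (hρ : 0 < ρ) :
    ∃ K : ℝ, 0 ≤ K ∧ ∀ t : ℝ, 1 ≤ t →
      ∫⁻ y : EuclideanSpace ℝ (Fin n), ENNReal.ofReal (heatKernel t y ^ q * phi ρ y ^ (2 - q)) ≤
        ENNReal.ofReal (K * Real.exp (t * (q * γ ^ 2 * ρ ^ 2))) := by
  obtain ⟨C, hC, hφ⟩ := exists_phi_sq_mul_le (n := n) hρ
  set σ := (volume : Measure (EuclideanSpace ℝ (Fin n))).toSphere with hσ
  set K₁ := C ^ ((2 - q) / 2) * ρ⁻¹ ^ (n - 1) *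
      Real.exp ((n - 1 : ℕ) * q * ρ ^ 2 * γ + ((n - 1 : ℕ) : ℝ) ^ 2 * q * ρ ^ 2 / 2) with hK₁
  have hK₁0 : 0 ≤ K₁ := by positivity
  have hq0 : 0 < q := by linarith
  refine ⟨K₁ * √(Real.pi * 8 / q) * σ.real univ, by positivity, fun t ht => ?_⟩
  have ht0 : 0 < t := by linarith
  set G : EuclideanSpace ℝ (Fin n) → ℝ≥0∞ := fun y => ENNReal.ofReal
    (((4 * Real.pi * t) ^ (-(n : ℝ) / 2) * Real.exp (-‖y‖ ^ 2 / (4 * t))) ^ q *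
      (C * Real.exp (2 * (ρ * ‖y‖)) / (1 + ρ * ‖y‖) ^ (n - 1)) ^ ((2 - q) / 2)) with hG
  have hGm : Measurable G := by
    refine Measurable.ennreal_ofReal ?_
    fun_prop
  have h1 : ∀ y : EuclideanSpace ℝ (Fin n),
      ENNReal.ofReal (heatKernel t y ^ q * phi ρ y ^ (2 - q)) ≤ G y := by
    intro y
    refine ENNReal.ofReal_le_ofReal ?_
    have hp := phi_pos ρ y
    have h2 : phi ρ y ^ (2 - q) = (phi ρ y ^ 2) ^ ((2 - q) / 2) := by
      rw [← Real.rpow_natCast, ← Real.rpow_mul hp.le]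
      congr 1
      push_cast
      ring
    have hβ : 0 ≤ (2 - q) / 2 := by linarith
    have hpos : 0 < (1 + ρ * ‖y‖) ^ (n - 1) := by positivity
    rw [h2]
    unfold heatKernel
    gcongr
    rw [le_div_iff₀ hpos]
    exact hφ y
  refine (lintegral_mono h1).trans ?_
  rw [lintegral_polar hGm]
  have h2 : ∀ ω : sphere (0 : EuclideanSpace ℝ (Fin n)) 1,
      ∫⁻ R in Ioi (0 : ℝ), ENNReal.ofReal (R ^ (n - 1)) *
        G (R • (ω : EuclideanSpace ℝ (Fin n))) ≤
      ENNReal.ofReal (K₁ * √(Real.pi * 8 / q) * Real.exp (t * (q * γ ^ 2 * ρ ^ 2))) := by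
    intro ω
    have hω : ‖(ω : EuclideanSpace ℝ (Fin n))‖ = 1 := by simp
    calc ∫⁻ R in Ioi (0 : ℝ), ENNReal.ofReal (R ^ (n - 1)) *
        G (R • (ω : EuclideanSpace ℝ (Fin n)))
        ≤ ∫⁻ R in Ioi (0 : ℝ), ENNReal.ofReal
          (K₁ * (t ^ (-(1 / 2) : ℝ) * Real.exp (t * (q * γ ^ 2 * ρ ^ 2)))) *
          ENNReal.ofReal (Real.exp (-(q / (8 * t)) * (R - 2 * t * ρ * γ) ^ 2)) := by
          refine setLIntegral_mono' measurableSet_Ioi fun R hR => ?_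
          have hR0 : 0 ≤ R := le_of_lt hR
          simp only [hG]
          rw [← ENNReal.ofReal_mul (by positivity), ← ENNReal.ofReal_mul (by positivity),
            norm_smul, hω, mul_one, Real.norm_of_nonneg hR0]
          exact ENNReal.ofReal_le_ofReal (radial_bound hq1 hq2 hγ hρ ht hR0 hC)
      _ ≤ ∫⁻ R : ℝ, ENNReal.ofReal
          (K₁ * (t ^ (-(1 / 2) : ℝ) * Real.exp (t * (q * γ ^ 2 * ρ ^ 2)))) *
          ENNReal.ofReal (Real.exp (-(q / (8 * t)) * (R - 2 * t * ρ * γ) ^ 2)) :=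
          setLIntegral_le_lintegral _ _
      _ = _ := by
          rw [lintegral_const_mul' _ _ ENNReal.ofReal_ne_top,
            lintegral_gaussian_shift (by positivity), ← ENNReal.ofReal_mul (by positivity)]
          congr 1
          have e1 : Real.pi / (q / (8 * t)) = (Real.pi * 8 / q) * t := by field_simp
          have e2 : t ^ (-(1 / 2) : ℝ) * √t = 1 := by
            rw [Real.sqrt_eq_rpow, ← Real.rpow_add ht0]; simp
          rw [e1, Real.sqrt_mul (by positivity)]
          linear_combination (K₁ * Real.exp (t * (q * γ ^ 2 * ρ ^ 2)) * √(Real.pi * 8 / q)) * e2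
  refine (lintegral_mono h2).trans ?_
  rw [lintegral_const, ← ENNReal.ofReal_toReal (measure_ne_top σ univ),
    ← ENNReal.ofReal_mul (by positivity)]
  refine ENNReal.ofReal_le_ofReal (le_of_eq ?_)
  rw [Measure.real]; ring

end Boundedness

section NotHypercyclic

open Filter Topology

variable {n : ℕ}

/-- Integration against a function in the dual Lebesgue space as a continuous functional. -/
theorem exists_pairing {α : Type*} [MeasurableSpace α] {μ : Measure α} {p q : ℝ≥0∞}
    [Fact (1 ≤ p)] [Fact (1 ≤ q)] [ENNReal.HolderConjugate q p] {w : α → ℂ} (hw : MemLp w q μ) :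
    ∃ l : Lp ℂ p μ →L[ℂ] ℂ, ∀ f : Lp ℂ p μ, l f = ∫ x, w x * f x ∂μ := by
  refine ⟨(ContinuousLinearMap.mul ℂ ℂ).lpPairing μ q p (hw.toLp w), fun f => ?_⟩
  rw [ContinuousLinearMap.lpPairing_eq_integral]
  refine integral_congr_ae ?_
  filter_upwards [hw.coeFn_toLp] with x hx
  rw [hx, ContinuousLinearMap.mul_apply']

theorem norm_conjHeat_le [NeZero n] (ρ : ℝ) (p : ℝ≥0∞) [Fact (1 ≤ p)] (c : ℝ) (t : ℝ≥0) :
    ‖conjHeat (n := n) ρ p c t‖ ≤ Real.exp (c * t) :=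
  LinearMap.mkContinuous_norm_le _ (Real.exp_pos _).le _

theorem weightedMeasure_ball_lt_top [NeZero n] {ρ : ℝ} (hρ : 0 < ρ) :
    weightedMeasure n ρ (ball 0 1) < ∞ := by
  rw [weightedMeasure, withDensity_apply _ measurableSet_ball]
  have h0 := phi_pos ρ (0 : EuclideanSpace ℝ (Fin n))
  calc ∫⁻ x in ball (0 : EuclideanSpace ℝ (Fin n)) 1, ENNReal.ofReal (phi ρ x ^ 2)
      ≤ ∫⁻ _ in ball (0 : EuclideanSpace ℝ (Fin n)) 1,
        ENNReal.ofReal ((Real.exp ρ * phi ρ (0 : EuclideanSpace ℝ (Fin n))) ^ 2) := by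
        refine setLIntegral_mono' measurableSet_ball fun x hx => ?_
        have hx1 : ‖x‖ < 1 := by simpa using hx
        have h1 := phi_sub_le ρ hρ x x
        rw [sub_self] at h1
        have h2 := phi_pos ρ x
        refine ENNReal.ofReal_le_ofReal ?_
        gcongr
        refine h1.trans ?_
        gcongr
        nlinarith
    _ < ∞ := by
        rw [setLIntegral_const]
        exact ENNReal.mul_lt_top ENNReal.ofReal_lt_top measure_ball_lt_top

/-- Hölder's inequality for the heat convolution of `φ_{iρ} f` at points of the unit ball. -/
theorem enorm_integral_heatKernel_phi_le [NeZero n] {ρ : ℝ} (hρ : 0 < ρ) {P Q : ℝ}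
    (hPQ : P.HolderConjugate Q) (hQ2 : Q < 2) {t : ℝ} (ht : 0 < t)
    {f : EuclideanSpace ℝ (Fin n) → ℂ} (hf : Measurable f) {x : EuclideanSpace ℝ (Fin n)}
    (hx : ‖x‖ ≤ 1) :
    ‖∫ y, (heatKernel t (x - y) : ℂ) * ((phi ρ y : ℂ) * f y)‖ₑ ≤
      (ENNReal.ofReal (Real.exp (ρ * (2 - Q))) *
        ∫⁻ y : EuclideanSpace ℝ (Fin n), ENNReal.ofReal (heatKernel t y ^ Q * phi ρ y ^ (2 - Q)))
        ^ (1 / Q) *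
      (∫⁻ y, ‖f y‖ₑ ^ P ∂weightedMeasure n ρ) ^ (1 / P) := by
  have hQ0 : 0 < Q := hPQ.symm.pos
  have hP0 : 0 < P := hPQ.pos
  have hPQ' : P⁻¹ + Q⁻¹ = 1 := hPQ.inv_add_inv_eq_one
  have hhm : Measurable fun y : EuclideanSpace ℝ (Fin n) => heatKernel t (x - y) :=
    ((continuous_heatKernel t).comp (by fun_prop : Continuous fun y => x - y)).measurable
  have hφm := measurable_phi (n := n) ρ
  refine (enorm_integral_le_lintegral_enorm _).trans ?_
  have e1 : ∀ y : EuclideanSpace ℝ (Fin n),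
      ‖(heatKernel t (x - y) : ℂ) * ((phi ρ y : ℂ) * f y)‖ₑ =
      ((fun y : EuclideanSpace ℝ (Fin n) =>
          ENNReal.ofReal (heatKernel t (x - y) * phi ρ y ^ (1 - 2 / P))) *
        fun y => ENNReal.ofReal (phi ρ y ^ (2 / P)) * ‖f y‖ₑ) y := by
    intro y
    have hp := phi_pos ρ y
    have hh := heatKernel_nonneg ht (x - y)
    have e2 : phi ρ y ^ (1 - 2 / P) * phi ρ y ^ (2 / P) = phi ρ y := by
      rw [← Real.rpow_add hp]; simp
    rw [Pi.mul_apply, ← mul_assoc (ENNReal.ofReal _) (ENNReal.ofReal _) _,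
      ← ENNReal.ofReal_mul (by positivity), mul_assoc (heatKernel _ _), e2, ← mul_assoc,
      enorm_mul, ← Complex.ofReal_mul, ← ofReal_norm (Complex.ofReal _), Complex.norm_real,
      Real.norm_of_nonneg (by positivity)]
  simp_rw [e1]
  refine (ENNReal.lintegral_mul_le_Lp_mul_Lq volume hPQ.symm
    (hhm.mul (hφm.pow_const _)).ennreal_ofReal.aemeasurable
    ((hφm.pow_const _).ennreal_ofReal.mul hf.enorm).aemeasurable).trans ?_
  have hA : ∫⁻ y : EuclideanSpace ℝ (Fin n),
      ENNReal.ofReal (heatKernel t (x - y) * phi ρ y ^ (1 - 2 / P)) ^ Q ≤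
      ENNReal.ofReal (Real.exp (ρ * (2 - Q))) *
        ∫⁻ y : EuclideanSpace ℝ (Fin n),
          ENNReal.ofReal (heatKernel t y ^ Q * phi ρ y ^ (2 - Q)) := by
    rw [← lintegral_const_mul' _ _ ENNReal.ofReal_ne_top, ← lintegral_sub_right_eq_self (fun y =>
      ENNReal.ofReal (Real.exp (ρ * (2 - Q))) *
        ENNReal.ofReal (heatKernel t y ^ Q * phi ρ y ^ (2 - Q))) x]
    refine lintegral_mono fun y => ?_
    have hp := phi_pos ρ y
    have hp' := phi_pos ρ (y - x)
    have hh := heatKernel_nonneg ht (y - x)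
    have e3 : heatKernel t (x - y) = heatKernel t (y - x) := by
      unfold heatKernel; rw [norm_sub_rev]
    have e4 : (1 - 2 / P) * Q = 2 - Q := by
      have : P⁻¹ * Q = Q - 1 := by
        rw [eq_sub_of_add_eq hPQ', sub_mul, inv_mul_cancel₀ hQ0.ne', one_mul]
      rw [sub_mul, one_mul, div_eq_mul_inv, mul_assoc, this]; ring
    rw [e3, ENNReal.ofReal_rpow_of_nonneg (by positivity) hQ0.le,
      ← ENNReal.ofReal_mul (by positivity)]
    refine ENNReal.ofReal_le_ofReal ?_
    rw [Real.mul_rpow hh (by positivity), ← Real.rpow_mul hp.le, e4, mul_left_comm]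
    have h2Q : 0 ≤ 2 - Q := by linarith
    gcongr
    calc phi ρ y ^ (2 - Q) ≤ (Real.exp (ρ * ‖x‖) * phi ρ (y - x)) ^ (2 - Q) := by
          gcongr
          exact phi_sub_le ρ hρ x y
      _ = Real.exp (ρ * ‖x‖ * (2 - Q)) * phi ρ (y - x) ^ (2 - Q) := by
          rw [Real.mul_rpow (by positivity) hp'.le, ← Real.exp_mul]
      _ ≤ _ := by
          gcongr
          nlinarith
  have hB : ∫⁻ y : EuclideanSpace ℝ (Fin n), (ENNReal.ofReal (phi ρ y ^ (2 / P)) * ‖f y‖ₑ) ^ P =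
      ∫⁻ y, ‖f y‖ₑ ^ P ∂weightedMeasure n ρ := by
    rw [lintegral_weightedMeasure ρ (hf.enorm.pow_const _)]
    refine lintegral_congr fun y => ?_
    have hp := phi_pos ρ y
    rw [ENNReal.mul_rpow_of_nonneg _ _ hP0.le, ENNReal.ofReal_rpow_of_nonneg (by positivity) hP0.le,
      ← Real.rpow_mul hp.le, div_mul_cancel₀ _ hP0.ne', Real.rpow_ofNat]
  rw [← hB]
  gcongr
  · exact hA
  · exact le_rfl

/-- For `c ≤ c_p` each orbit is bounded on the unit ball. -/
theorem exists_norm_conjHeatFun_le [NeZero n] {ρ : ℝ} (hρ : 0 < ρ) {p : ℝ≥0∞} (hp2 : 2 < p)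
    (hp : p ≠ ∞) {c : ℝ} (hc : c ≤ ρ ^ 2 * (1 - (1 - 2 / p.toReal) ^ 2))
    {f : EuclideanSpace ℝ (Fin n) → ℂ} (hfm : Measurable f)
    (hf : MemLp f p (weightedMeasure n ρ)) :
    ∃ K : ℝ, 0 ≤ K ∧ ∀ t : ℝ≥0, 1 ≤ t → ∀ x : EuclideanSpace ℝ (Fin n), ‖x‖ ≤ 1 →
      ‖conjHeatFun ρ c t f x‖ ≤ K := by
  have hP : 2 < p.toReal := by
    have := (ENNReal.toReal_lt_toReal ENNReal.ofNat_ne_top hp).2 hp2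
    simpa using this
  have hp0 : p ≠ 0 := (lt_trans (by norm_num) hp2).ne'
  set P := p.toReal with hPdef
  set Q := P.conjExponent with hQdef
  have hPQ : P.HolderConjugate Q := Real.HolderConjugate.conjExponent (by linarith)
  have hQ : Q = P / (P - 1) := rfl
  have hQ1 : 1 < Q := by rw [hQ, lt_div_iff₀ (by linarith)]; linarith
  have hQ2 : Q < 2 := by rw [hQ, div_lt_iff₀ (by linarith)]; linarith
  have hQ0 : 0 < Q := by linarith
  set γ := 1 - 2 / P with hγdef
  have hγ : Q * γ = 2 - Q := by
    have : P - 1 ≠ 0 := by linarith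
    rw [hQ, hγdef]; field_simp; ring
  obtain ⟨K, hK0, hK⟩ := exists_lintegral_heatKernel_rpow_le (n := n) hQ1 hQ2 hγ hρ
  obtain ⟨D, hD, hlow⟩ := exists_mul_exp_le_phi (n := n) hρ hρ
  have hfin := lintegral_rpow_enorm_lt_top_of_eLpNorm_lt_top hp0 hp hf.2
  set M := ((∫⁻ y, ‖f y‖ₑ ^ P ∂weightedMeasure n ρ) ^ (1 / P)).toReal with hM
  set L := (Real.exp (ρ * (2 - Q)) * K) ^ (1 / Q) with hL
  refine ⟨D⁻¹ * (L * M), by positivity, fun t ht x hx => ?_⟩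
  have ht' : (1 : ℝ) ≤ t := by exact_mod_cast ht
  have ht0 : (0 : ℝ) < t := by linarith
  have htne : t ≠ 0 := (lt_of_lt_of_le one_pos ht).ne'
  have hφx := phi_pos ρ x
  have hφlow : D ≤ phi ρ x :=
    (le_mul_of_one_le_right hD.le (Real.one_le_exp (by positivity))).trans (hlow x)
  have key : ‖∫ y, (heatKernel (t : ℝ) (x - y) : ℂ) * ((phi ρ y : ℂ) * f y)‖ ≤
      L * Real.exp (t * (γ ^ 2 * ρ ^ 2)) * M := by
    have h1 := enorm_integral_heatKernel_phi_le hρ hPQ hQ2 ht0 hfm hx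
    have h2 : (ENNReal.ofReal (Real.exp (ρ * (2 - Q))) * ∫⁻ y : EuclideanSpace ℝ (Fin n),
        ENNReal.ofReal (heatKernel (t : ℝ) y ^ Q * phi ρ y ^ (2 - Q))) ^ (1 / Q) ≤
        ENNReal.ofReal (L * Real.exp (t * (γ ^ 2 * ρ ^ 2))) := by
      calc _ ≤ (ENNReal.ofReal (Real.exp (ρ * (2 - Q))) *
          ENNReal.ofReal (K * Real.exp (t * (Q * γ ^ 2 * ρ ^ 2)))) ^ (1 / Q) := by
            gcongr
            exact hK t ht'
        _ = _ := by
            rw [← ENNReal.ofReal_mul (by positivity),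
              ENNReal.ofReal_rpow_of_nonneg (by positivity) (by positivity), ← mul_assoc,
              Real.mul_rpow (by positivity) (by positivity), ← Real.exp_mul]
            congr 3
            field_simp
    have h3 := h1.trans (mul_le_mul_left h2 _)
    have hMtop : (∫⁻ y, ‖f y‖ₑ ^ P ∂weightedMeasure n ρ) ^ (1 / P) ≠ ∞ :=
      (ENNReal.rpow_lt_top_of_nonneg (by positivity) hfin.ne).ne
    rw [← ENNReal.ofReal_toReal hMtop, ← hM, ← ENNReal.ofReal_mul (by positivity),
      ← ofReal_norm, ENNReal.ofReal_le_ofReal_iff (by positivity)] at h3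
    exact h3
  rw [conjHeatFun, heatOp, if_neg htne, norm_mul, norm_mul, norm_mul, norm_inv, Complex.norm_real,
    Complex.norm_real, Complex.norm_real, Real.norm_of_nonneg (Real.exp_pos _).le,
    Real.norm_of_nonneg (Real.exp_pos _).le, Real.norm_of_nonneg hφx.le]
  have hexp : Real.exp (c * t) * (Real.exp (-(t * ρ ^ 2)) *
      Real.exp (t * (γ ^ 2 * ρ ^ 2))) ≤ 1 := by
    rw [← Real.exp_add, ← Real.exp_add, Real.exp_le_one_iff]
    nlinarith
  calc _ ≤ Real.exp (c * t) * (D⁻¹ * (Real.exp (-(t * ρ ^ 2)) *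
        (L * Real.exp (t * (γ ^ 2 * ρ ^ 2)) * M))) := by gcongr
    _ = (Real.exp (c * t) * (Real.exp (-(t * ρ ^ 2)) * Real.exp (t * (γ ^ 2 * ρ ^ 2)))) *
        (D⁻¹ * (L * M)) := by ring
    _ ≤ 1 * (D⁻¹ * (L * M)) := by gcongr
    _ = _ := one_mul _

theorem not_isHypercyclic_of_le [NeZero n] {ρ : ℝ} (hρ : 0 < ρ) {p : ℝ≥0∞} [Fact (1 ≤ p)]
    (hp2 : 2 < p) (hp : p ≠ ∞) {c : ℝ} (hc : c ≤ ρ ^ 2 * (1 - (1 - 2 / p.toReal) ^ 2)) :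
    ¬ IsHypercyclic (conjHeat (n := n) ρ p c) := by
  have hconj : ENNReal.HolderConjugate p (1 - p⁻¹)⁻¹ :=
    ENNReal.HolderConjugate.inv_one_sub_inv' Fact.out
  have : ENNReal.HolderConjugate (1 - p⁻¹)⁻¹ p := hconj.symm
  have : Fact (1 ≤ (1 - p⁻¹)⁻¹) := ⟨ENNReal.HolderConjugate.one_le _ p⟩
  have hfin := weightedMeasure_ball_lt_top (n := n) hρ
  have hw : ∀ q, MemLp ((ball (0 : EuclideanSpace ℝ (Fin n)) 1).indicator fun _ => (1 : ℂ)) q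
      (weightedMeasure n ρ) := fun q =>
    memLp_indicator_const q measurableSet_ball 1 (Or.inr hfin.ne)
  obtain ⟨l, hl⟩ := exists_pairing (p := p) (hw (1 - p⁻¹)⁻¹)
  have hl' : ∀ f : Lp ℂ p (weightedMeasure n ρ), l f =
      ∫ x in ball 0 1, f x ∂weightedMeasure n ρ := by
    intro f
    rw [hl, ← integral_indicator measurableSet_ball]
    congr 1
    funext x
    by_cases hx : x ∈ ball (0 : EuclideanSpace ℝ (Fin n)) 1 <;> simp [hx]
  refine not_isHypercyclic_of_functional l (fun h0 => ?_) fun v => ?_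
  · have h1 := hl' ((hw p).toLp _)
    have h2 : ∫ x in ball 0 1, (hw p).toLp _ x ∂weightedMeasure n ρ =
        ∫ _ in ball (0 : EuclideanSpace ℝ (Fin n)) 1, (1 : ℂ) ∂weightedMeasure n ρ := by
      refine setIntegral_congr_ae measurableSet_ball ?_
      filter_upwards [(hw p).coeFn_toLp] with x hx hxb
      rw [hx, indicator_of_mem hxb]
    rw [h0, zero_apply, h2, setIntegral_const] at h1
    have h3 : (weightedMeasure n ρ).real (ball 0 1) = 0 := by simpa using h1.symm
    have h4 := (measureReal_eq_zero_iff hfin.ne).1 h3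
    exact (measure_ball_pos volume (0 : EuclideanSpace ℝ (Fin n)) one_pos).ne' (ac_weighted ρ h4)
  · obtain ⟨K, hK0, hK⟩ := exists_norm_conjHeatFun_le hρ hp2 hp hc
      (Lp.stronglyMeasurable v).measurable (Lp.memLp v)
    set m := (weightedMeasure n ρ).real (ball 0 1) with hm
    refine not_dense_of_le_re (-(K * m + ‖l‖ * (Real.exp |c| * ‖v‖))) ?_
    rintro _ ⟨t, rfl⟩
    refine (neg_le_neg ?_).trans (neg_le_of_abs_le (Complex.abs_re_le_norm _))
    simp only
    rcases le_total t 1 with ht | ht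
    · have h1 : ‖conjHeat ρ p c t v‖ ≤ Real.exp |c| * ‖v‖ := by
        refine ((conjHeat ρ p c t).le_opNorm v).trans ?_
        gcongr
        refine (norm_conjHeat_le ρ p c t).trans ?_
        gcongr
        have ht' : (t : ℝ) ≤ 1 := by exact_mod_cast ht
        calc c * t ≤ |c| * t := by gcongr; exact le_abs_self c
          _ ≤ |c| * 1 := by gcongr
          _ = |c| := mul_one _
      calc ‖l (conjHeat ρ p c t v)‖ ≤ ‖l‖ * ‖conjHeat ρ p c t v‖ := l.le_opNorm _
        _ ≤ ‖l‖ * (Real.exp |c| * ‖v‖) := by gcongr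
        _ ≤ _ := le_add_of_nonneg_left (by positivity)
    · have h1 : ‖l (conjHeat ρ p c t v)‖ ≤ K * m := by
        rw [hl']
        refine norm_setIntegral_le_of_norm_le_const_ae' hfin ?_
        filter_upwards [conjHeat_coeFn ρ p c t v] with x hx hxb
        rw [hx]
        exact hK t ht x (by simpa using (mem_ball_zero_iff.1 hxb).le)
      exact h1.trans (le_add_of_nonneg_right (by positivity))

end NotHypercyclic

/-! ### The space of essentially bounded functions -/

section EssentiallyBounded

open Filter Topology

variable {n : ℕ}

theorem continuous_phi (ρ : ℝ) : Continuous (phi ρ : EuclideanSpace ℝ (Fin n) → ℝ) := by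
  have h := continuous_parametric_integral_of_continuous
    (μ := (volume : Measure (EuclideanSpace ℝ (Fin n))).toSphere)
    (f := fun (x : EuclideanSpace ℝ (Fin n)) ω =>
      Real.exp (-(ρ * ⟪x, (ω : EuclideanSpace ℝ (Fin n))⟫)))
    (continuous_expInner (n := n) ρ) isCompact_univ
  simp only [Measure.restrict_univ] at h
  exact (funext fun x => phi_eq ρ x) ▸ h

/-- The heat convolution of `φ_{iρ} f` with bounded `f` is continuous. -/
theorem continuous_integral_heatKernel_phi [NeZero n] {ρ : ℝ} (hρ : 0 < ρ) {t : ℝ} (ht : 0 < t)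
    {f : EuclideanSpace ℝ (Fin n) → ℂ} (hf : Measurable f) {M : ℝ} (hM : ∀ᵐ y, ‖f y‖ ≤ M) :
    Continuous fun x : EuclideanSpace ℝ (Fin n) =>
      ∫ y, (heatKernel t (x - y) : ℂ) * ((phi ρ y : ℂ) * f y) := by
  have hφ0 : ∀ y : EuclideanSpace ℝ (Fin n), phi ρ y ≤ Real.exp (ρ * ‖y‖) *
      phi ρ (0 : EuclideanSpace ℝ (Fin n)) := fun y => by simpa using phi_sub_le ρ hρ y y
  have h0 := phi_pos ρ (0 : EuclideanSpace ℝ (Fin n))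
  refine continuous_iff_continuousAt.2 fun x₀ => ?_
  set R := ‖x₀‖ + 1 with hR
  set A := (4 * Real.pi * t) ^ (-(n : ℝ) / 2) with hA
  have hA0 : 0 ≤ A := by positivity
  refine continuousAt_of_dominated (bound := fun y => A * Real.exp (R ^ 2 / (4 * t)) *
      phi ρ (0 : EuclideanSpace ℝ (Fin n)) * M * Real.exp (2 * t * (ρ + 1) ^ 2) *
      Real.exp (-1 * ‖y‖)) (Eventually.of_forall fun x => ?_) ?_ ?_ ?_
  · have h1 : Continuous fun y : EuclideanSpace ℝ (Fin n) => heatKernel t (x - y) :=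
      (continuous_heatKernel t).comp (by fun_prop)
    exact ((Complex.measurable_ofReal.comp h1.measurable).mul
      ((Complex.measurable_ofReal.comp (measurable_phi ρ)).mul hf)).aestronglyMeasurable
  · filter_upwards [ball_mem_nhds x₀ one_pos] with x hx
    filter_upwards [hM] with y hy
    have hp := phi_pos ρ y
    have hxR : ‖x‖ ≤ R := by
      have h1 : ‖x - x₀‖ < 1 := by rw [← dist_eq_norm]; exact hx
      have h2 := norm_add_le x₀ (x - x₀)
      rw [add_sub_cancel] at h2
      linarith
    have hM0 : 0 ≤ M := (norm_nonneg _).trans hy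
    have hk : heatKernel t (x - y) ≤
        A * Real.exp (R ^ 2 / (4 * t)) * Real.exp (-‖y‖ ^ 2 / (8 * t)) := by
      unfold heatKernel
      rw [mul_assoc A, ← Real.exp_add]
      refine mul_le_mul_of_nonneg_left (Real.exp_le_exp.2 ?_) hA0
      have h1 : ‖y‖ ≤ ‖x - y‖ + R := by
        have := norm_sub_le x (x - y)
        rw [sub_sub_cancel] at this
        linarith
      have h2 : ‖y‖ ^ 2 ≤ 2 * ‖x - y‖ ^ 2 + 2 * R ^ 2 := by
        have := pow_le_pow_left₀ (norm_nonneg y) h1 2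
        nlinarith [sq_nonneg (‖x - y‖ - R)]
      have h3 : R ^ 2 / (4 * t) + -‖y‖ ^ 2 / (8 * t) = (R ^ 2 - ‖y‖ ^ 2 / 2) / (4 * t) := by
        field_simp; ring
      rw [h3]
      gcongr
      linarith
    have he : Real.exp (-‖y‖ ^ 2 / (8 * t)) * Real.exp (ρ * ‖y‖) ≤
        Real.exp (2 * t * (ρ + 1) ^ 2) * Real.exp (-1 * ‖y‖) := by
      rw [← Real.exp_add, ← Real.exp_add]
      refine Real.exp_le_exp.2 ?_
      have h1 : 2 * t * (ρ + 1) ^ 2 + -1 * ‖y‖ - (-‖y‖ ^ 2 / (8 * t) + ρ * ‖y‖) =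
          (‖y‖ - 4 * t * (ρ + 1)) ^ 2 / (8 * t) := by field_simp; ring
      have h2 : 0 ≤ (‖y‖ - 4 * t * (ρ + 1)) ^ 2 / (8 * t) := by positivity
      linarith
    rw [norm_mul, norm_mul, Complex.norm_real, Complex.norm_real,
      Real.norm_of_nonneg (heatKernel_nonneg ht _), Real.norm_of_nonneg hp.le]
    calc heatKernel t (x - y) * (phi ρ y * ‖f y‖)
        ≤ (A * Real.exp (R ^ 2 / (4 * t)) * Real.exp (-‖y‖ ^ 2 / (8 * t))) *
          ((Real.exp (ρ * ‖y‖) * phi ρ (0 : EuclideanSpace ℝ (Fin n))) * M) := by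
          gcongr
          exact hφ0 y
      _ = A * Real.exp (R ^ 2 / (4 * t)) * phi ρ (0 : EuclideanSpace ℝ (Fin n)) * M *
          (Real.exp (-‖y‖ ^ 2 / (8 * t)) * Real.exp (ρ * ‖y‖)) := by ring
      _ ≤ A * Real.exp (R ^ 2 / (4 * t)) * phi ρ (0 : EuclideanSpace ℝ (Fin n)) * M *
          (Real.exp (2 * t * (ρ + 1) ^ 2) * Real.exp (-1 * ‖y‖)) := by gcongr
      _ = _ := by ring
  · exact (integrable_exp_neg_mul_norm one_pos).const_mul _
  · refine Eventually.of_forall fun y => Continuous.continuousAt ?_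
    have h1 : Continuous fun x : EuclideanSpace ℝ (Fin n) => heatKernel t (x - y) :=
      (continuous_heatKernel t).comp (by fun_prop)
    exact (Complex.continuous_ofReal.comp h1).mul continuous_const

/-- The operators with `t > 0` map bounded functions to continuous ones. -/
theorem continuous_conjHeatFun [NeZero n] {ρ : ℝ} (hρ : 0 < ρ) (c : ℝ) {t : ℝ≥0} (ht : 0 < t)
    {f : EuclideanSpace ℝ (Fin n) → ℂ} (hf : Measurable f) {M : ℝ} (hM : ∀ᵐ y, ‖f y‖ ≤ M) :
    Continuous (conjHeatFun ρ c t f) := by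
  unfold conjHeatFun heatOp
  simp only [if_neg ht.ne']
  refine continuous_const.mul (Continuous.mul ?_ (continuous_const.mul
    (continuous_integral_heatKernel_phi hρ (by exact_mod_cast ht) hf hM)))
  exact (Complex.continuous_ofReal.comp (continuous_phi ρ)).inv₀ fun x =>
    Complex.ofReal_ne_zero.2 (phi_pos ρ x).ne'

theorem ae_norm_le_norm_top {α : Type*} [MeasurableSpace α] {μ : Measure α} (f : Lp ℂ ∞ μ) :
    ∀ᵐ x ∂μ, ‖f x‖ ≤ ‖f‖ := by
  filter_upwards [ae_le_eLpNormEssSup (f := f) (μ := μ)] with x hx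
  rw [Lp.norm_def, eLpNorm_exponent_top, ← toReal_enorm]
  refine ENNReal.toReal_mono ?_ hx
  rw [← eLpNorm_exponent_top]
  exact (Lp.memLp f).2.ne

/-- The indicator of the unit ball cannot be approximated uniformly by a continuous function. -/
theorem not_ae_norm_indicator_sub_le [NeZero n] {g : EuclideanSpace ℝ (Fin n) → ℂ}
    (hg : Continuous g)
    (h : ∀ᵐ x, ‖(ball (0 : EuclideanSpace ℝ (Fin n)) 1).indicator (fun _ => (1 : ℂ)) x - g x‖ ≤
      1 / 3) : False := by
  obtain ⟨e, he⟩ : ∃ e : EuclideanSpace ℝ (Fin n), ‖e‖ = 1 := exists_norm_eq _ zero_le_one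
  -- on an open set where the indicator is constant the bound holds at every point
  have key : ∀ (U : Set (EuclideanSpace ℝ (Fin n))) (z : ℂ), IsOpen U →
      (∀ x ∈ U, (ball (0 : EuclideanSpace ℝ (Fin n)) 1).indicator (fun _ => (1 : ℂ)) x = z) →
      ∀ x ∈ U, ‖z - g x‖ ≤ 1 / 3 := by
    intro U z hU hz x hx
    by_contra! hlt
    have hopen : IsOpen (U ∩ {x | 1 / 3 < ‖z - g x‖}) :=
      hU.inter (isOpen_lt continuous_const (by fun_prop))
    have hnull : volume (U ∩ {x | 1 / 3 < ‖z - g x‖}) = 0 := by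
      refine measure_mono_null (fun y hy => ?_) (ae_iff.1 h)
      simp only [mem_ofPred_eq, not_le, hz y hy.1]
      exact hy.2
    rw [hopen.measure_eq_zero_iff (μ := volume)] at hnull
    exact (hnull ▸ (show x ∈ U ∩ {x | 1 / 3 < ‖z - g x‖} from ⟨hx, hlt⟩) : x ∈ (∅ : Set _))
  have hray : Tendsto (fun s : ℝ => g (s • e)) (𝓝 1) (𝓝 (g e)) := by
    have : Continuous fun s : ℝ => g (s • e) := by fun_prop
    simpa using this.tendsto 1
  have h1 : ‖1 - g e‖ ≤ 1 / 3 := by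
    have hlim := ((hray.mono_left (nhdsWithin_le_nhds (s := Iio 1))).const_sub 1).norm
    refine le_of_tendsto hlim ?_
    filter_upwards [self_mem_nhdsWithin, Ioo_mem_nhdsLT (show (-1 : ℝ) < 1 by norm_num)] with s _ hs
    refine key (ball 0 1) 1 isOpen_ball (fun x hx => by rw [indicator_of_mem hx]) _ ?_
    rw [mem_ball_zero_iff, norm_smul, he, mul_one, Real.norm_eq_abs, abs_lt]
    exact hs
  have h2 : ‖0 - g e‖ ≤ 1 / 3 := by
    have hlim := ((hray.mono_left (nhdsWithin_le_nhds (s := Ioi 1))).const_sub 0).norm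
    refine le_of_tendsto hlim ?_
    filter_upwards [self_mem_nhdsWithin] with s hs
    refine key (closedBall 0 1)ᶜ 0 isClosed_closedBall.isOpen_compl (fun x hx => ?_) _ ?_
    · rw [indicator_of_notMem]
      exact fun hxb => hx (ball_subset_closedBall hxb)
    · rw [mem_compl_iff, mem_closedBall_zero_iff, norm_smul, he, mul_one, not_le]
      exact (show (1 : ℝ) < s from hs).trans_le (le_abs_self s)
  have h3 := norm_sub_le (1 - g e) (0 - g e)
  rw [sub_sub_sub_cancel_right, sub_zero, norm_one] at h3
  linarith

/-- The indicator of the unit ball has distance at least `1/3` to all periodic points, since these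
are continuous functions. -/
theorem not_dense_periodic_top [NeZero n] {ρ : ℝ} (hρ : 0 < ρ) (c : ℝ) :
    ¬ Dense {v : Lp ℂ ∞ (weightedMeasure n ρ) | IsPeriodicPoint (conjHeat ρ ∞ c) v} := by
  intro hd
  have hu : MemLp ((ball (0 : EuclideanSpace ℝ (Fin n)) 1).indicator fun _ => (1 : ℂ)) ∞
      (weightedMeasure n ρ) := memLp_indicator_const _ measurableSet_ball 1
        (Or.inr (weightedMeasure_ball_lt_top hρ).ne)
  obtain ⟨v, ⟨t, ht, hv⟩, hdist⟩ := hd.exists_dist_lt (hu.toLp _)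
    (show (0 : ℝ) < 1 / 3 by norm_num)
  have hb := (ac_weighted ρ).ae_le (ae_norm_le_norm_top v)
  refine not_ae_norm_indicator_sub_le (continuous_conjHeatFun hρ c ht
    (Lp.stronglyMeasurable v).measurable hb) ?_
  rw [dist_eq_norm] at hdist
  have hcoe : v =ᵐ[weightedMeasure n ρ] conjHeatFun ρ c t v := by
    conv_lhs => rw [← hv]
    exact conjHeat_coeFn ρ ∞ c t v
  refine (ac_weighted ρ).ae_le ?_
  filter_upwards [hcoe, hu.coeFn_toLp, Lp.coeFn_sub (hu.toLp _) v,
    ae_norm_le_norm_top (hu.toLp _ - v)] with x h1 h2 h3 h4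
  rw [h3, Pi.sub_apply, h2, h1] at h4
  exact h4.trans hdist.le

end EssentiallyBounded

/-! ### The Fourier transform of a heat convolution -/

section HeatFourier

open Filter Topology FourierTransform SchwartzMap

variable {n : ℕ}

/-- The Fourier multiplier `exp (-4π²t|ξ|²)` of convolution with the heat kernel, for the
normalization `𝓕 g ξ = ∫ exp (-2πi x·ξ) g(x) dx`. -/
noncomputable def heatSymbol (t : ℝ) (ξ : EuclideanSpace ℝ (Fin n)) : ℝ :=
  Real.exp (-(4 * Real.pi ^ 2 * t * ‖ξ‖ ^ 2))

theorem heatSymbol_pos (t : ℝ) (ξ : EuclideanSpace ℝ (Fin n)) : 0 < heatSymbol t ξ :=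
  Real.exp_pos _

theorem continuous_heatSymbol (t : ℝ) :
    Continuous (heatSymbol t : EuclideanSpace ℝ (Fin n) → ℝ) := by
  unfold heatSymbol
  fun_prop

theorem heatSymbol_le_one {t : ℝ} (ht : 0 < t) (ξ : EuclideanSpace ℝ (Fin n)) :
    heatSymbol t ξ ≤ 1 :=
  Real.exp_le_one_iff.2 (neg_nonpos.2 (by positivity))

theorem heatKernel_sub_comm (t : ℝ) (x y : EuclideanSpace ℝ (Fin n)) :
    heatKernel t (x - y) = heatKernel t (y - x) := by
  unfold heatKernel
  rw [norm_sub_rev]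

theorem integrable_heatKernel {t : ℝ} (ht : 0 < t) :
    Integrable (heatKernel t : EuclideanSpace ℝ (Fin n) → ℝ) := by
  refine ⟨(continuous_heatKernel t).aestronglyMeasurable, ?_⟩
  rw [hasFiniteIntegral_iff_ofReal (Eventually.of_forall fun x => heatKernel_nonneg ht x),
    lintegral_heatKernel ht]
  exact ENNReal.one_lt_top

/-- The characters are eigenfunctions of the heat semigroup, with the multiplier as eigenvalue. -/
theorem integral_heatKernel_mul_character [NeZero n] {t : ℝ} (ht : 0 < t)
    (x ξ : EuclideanSpace ℝ (Fin n)) :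
    ∫ y, (heatKernel t (x - y) : ℂ) * Complex.exp (((-2 * Real.pi * ⟪y, ξ⟫ : ℝ) : ℂ) * Complex.I) =
      (heatSymbol t ξ : ℂ) * Complex.exp (((-2 * Real.pi * ⟪x, ξ⟫ : ℝ) : ℂ) * Complex.I) := by
  obtain ⟨ω, hω, hξ⟩ : ∃ ω : EuclideanSpace ℝ (Fin n), ‖ω‖ = 1 ∧ ξ = ‖ξ‖ • ω := by
    rcases eq_or_ne ξ 0 with rfl | h
    · obtain ⟨e, he⟩ : ∃ e : EuclideanSpace ℝ (Fin n), ‖e‖ = 1 := exists_norm_eq _ zero_le_one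
      exact ⟨e, he, by simp⟩
    · have h0 : ‖ξ‖ ≠ 0 := norm_ne_zero_iff.2 h
      refine ⟨‖ξ‖⁻¹ • ξ, ?_, by rw [smul_inv_smul₀ h0]⟩
      rw [norm_smul, norm_inv, norm_norm, inv_mul_cancel₀ h0]
  have key := integral_heatKernel_mul_cexp ht (-2 * Real.pi * ‖ξ‖ * Complex.I) hω x
  have e : ∀ z : EuclideanSpace ℝ (Fin n), ((-2 * Real.pi * ⟪z, ξ⟫ : ℝ) : ℂ) * Complex.I =
      (-2 * Real.pi * ‖ξ‖ * Complex.I) * (⟪z, ω⟫ : ℝ) := by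
    intro z
    conv_lhs => rw [hξ, inner_smul_right]
    push_cast
    ring
  simp_rw [e, key]
  congr 1
  rw [heatSymbol, Complex.ofReal_exp]
  congr 1
  push_cast
  rw [mul_pow, Complex.I_sq]
  ring

theorem fourier_heatKernel_sub [NeZero n] {t : ℝ} (ht : 0 < t) (x ξ : EuclideanSpace ℝ (Fin n)) :
    𝓕 (fun y : EuclideanSpace ℝ (Fin n) => (heatKernel t (x - y) : ℂ)) ξ =
      (heatSymbol t ξ : ℂ) * Complex.exp (((-2 * Real.pi * ⟪x, ξ⟫ : ℝ) : ℂ) * Complex.I) := by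
  rw [Real.fourier_eq', ← integral_heatKernel_mul_character ht]
  simp_rw [smul_eq_mul, mul_comm]

theorem fourier_heatConvolution [NeZero n] {t : ℝ} (ht : 0 < t)
    {G : EuclideanSpace ℝ (Fin n) → ℂ} (hG : Integrable G) (ξ : EuclideanSpace ℝ (Fin n)) :
    𝓕 (fun x => ∫ y, (heatKernel t (x - y) : ℂ) * G y) ξ = heatSymbol t ξ * 𝓕 G ξ := by
  have h := Real.fourier_mul_convolution_eq hG (integrable_heatKernel (n := n) ht).ofReal ξ
  have h0 : 𝓕 (fun y : EuclideanSpace ℝ (Fin n) => (heatKernel t y : ℂ)) ξ = heatSymbol t ξ := by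
    have := fourier_heatKernel_sub ht 0 ξ
    simp_rw [heatKernel_sub_comm t 0, sub_zero] at this
    simpa using this
  have h1 : (fun x => ∫ y, (heatKernel t (x - y) : ℂ) * G y) =
      convolution G (fun y => (heatKernel t y : ℂ)) (ContinuousLinearMap.mul ℂ ℂ) volume := by
    funext x
    simp_rw [convolution_def, ContinuousLinearMap.mul_apply', mul_comm]
  rw [h1]
  refine h.trans ?_
  rw [mul_comm]
  exact congrArg (· * _) h0

theorem hasTemperateGrowth_heatSymbol {t : ℝ} (ht : 0 < t) :
    (fun ξ : EuclideanSpace ℝ (Fin n) => (heatSymbol t ξ : ℂ)).HasTemperateGrowth := by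
  have h : (Real.exp ∘ fun ξ : EuclideanSpace ℝ (Fin n) =>
      -(4 * Real.pi ^ 2 * t * ‖ξ‖ ^ 2)).HasTemperateGrowth := by
    refine Function.HasTemperateGrowth.comp' (t := Iic (0 : ℝ)) ?_ (uniqueDiffOn_Iic 0)
      Real.contDiff_exp.contDiffOn (fun _ => ⟨0, (1 : ℝ), zero_le_one, fun k _ x hx => ?_⟩)
      (by fun_prop)
    · rintro _ ⟨ξ, rfl⟩
      exact neg_nonpos.2 (show 0 ≤ 4 * Real.pi ^ 2 * t * ‖ξ‖ ^ 2 by positivity)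
    · rw [norm_iteratedFDerivWithin_eq_norm_iteratedDerivWithin,
        iteratedDerivWithin_eq_iteratedDeriv (uniqueDiffOn_Iic 0) Real.contDiff_exp.contDiffAt hx,
        iteratedDeriv_eq_iterate, Real.iter_deriv_exp, Real.norm_of_nonneg (Real.exp_pos _).le]
      simpa using hx
  exact Function.HasTemperateGrowth.comp Complex.ofRealCLM.hasTemperateGrowth h

/-- The multiplication formula `∫ 𝓕 ψ · g = ∫ ψ · 𝓕 g` for a translate `g` of the heat kernel. -/
theorem heatConvolution_fourier [NeZero n] {t : ℝ} (ht : 0 < t)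
    (ψ : 𝓢(EuclideanSpace ℝ (Fin n), ℂ)) (x : EuclideanSpace ℝ (Fin n)) :
    ∫ y, (heatKernel t (x - y) : ℂ) * 𝓕 ψ y =
      𝓕 (smulLeftCLM ℂ (fun ξ => (heatSymbol t ξ : ℂ)) ψ) x := by
  have h1 : Integrable fun y : EuclideanSpace ℝ (Fin n) => (heatKernel t (x - y) : ℂ) :=
    ((integrable_heatKernel (n := n) ht).comp_sub_left x).ofReal
  have h2 : ∫ y, 𝓕 (ψ : EuclideanSpace ℝ (Fin n) → ℂ) y * (heatKernel t (x - y) : ℂ) =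
      ∫ v, ψ v * 𝓕 (fun y : EuclideanSpace ℝ (Fin n) => (heatKernel t (x - y) : ℂ)) v := by
    have h := VectorFourier.integral_fourierIntegral_smul_eq_flip
      (L := innerₗ (EuclideanSpace ℝ (Fin n))) Real.continuous_fourierChar continuous_inner
      (ψ.integrable (μ := volume)) h1
    rw [flip_innerₗ] at h
    exact h
  rw [SchwartzMap.fourier_coe, SchwartzMap.fourier_coe, Real.fourier_eq']
  simp_rw [fourier_heatKernel_sub ht] at h2
  simp_rw [mul_comm (heatKernel _ _ : ℂ), h2,
    smulLeftCLM_apply_apply (hasTemperateGrowth_heatSymbol ht)]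
  refine integral_congr_ae (Eventually.of_forall fun y => ?_)
  simp only [smul_eq_mul, real_inner_comm x y]
  ring

/-- Convolution with the heat kernel is symmetric on square integrable functions. -/
theorem integral_heatConvolution_mul {t : ℝ} (ht : 0 < t)
    {G η : EuclideanSpace ℝ (Fin n) → ℂ} (hG : MemLp G 2) (hη : MemLp η 2) :
    ∫ x, (∫ y, (heatKernel t (x - y) : ℂ) * G y) * η x =
      ∫ y, G y * ∫ x, (heatKernel t (y - x) : ℂ) * η x := by
  have hk := integrable_heatKernel (n := n) ht
  -- the integrand is dominated through `|G(y)| |η(x)| ≤ |G(y)|² + |η(x)|²`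
  have hint : Integrable (Function.uncurry fun x y : EuclideanSpace ℝ (Fin n) =>
      (heatKernel t (x - y) : ℂ) * G y * η x) (volume.prod volume) := by
    have b1 := ((memLp_two_iff_integrable_sq_norm hG.1).1 hG).convolution_integrand
      (ContinuousLinearMap.mul ℝ ℝ) hk
    have b2 := (((memLp_two_iff_integrable_sq_norm hη.1).1 hη).convolution_integrand
      (ContinuousLinearMap.mul ℝ ℝ) hk).swap
    refine (b1.add b2).mono' ?_ (Eventually.of_forall fun z => ?_)
    · have hkm : Continuous fun z : EuclideanSpace ℝ (Fin n) × EuclideanSpace ℝ (Fin n) =>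
          heatKernel t (z.1 - z.2) := (continuous_heatKernel t).comp (by fun_prop)
      exact ((Complex.continuous_ofReal.comp hkm).aestronglyMeasurable.mul hG.1.comp_snd).mul
        hη.1.comp_fst
    · have h0 := heatKernel_nonneg ht (z.1 - z.2)
      simp only [Function.uncurry, Pi.add_apply, Function.comp_apply, Prod.fst_swap,
        Prod.snd_swap, ContinuousLinearMap.mul_apply', norm_mul, Complex.norm_real,
        Real.norm_of_nonneg h0, heatKernel_sub_comm t z.2 z.1]
      have h2 : ‖G z.2‖ * ‖η z.1‖ ≤ ‖G z.2‖ ^ 2 + ‖η z.1‖ ^ 2 := by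
        nlinarith [sq_nonneg (‖G z.2‖ - ‖η z.1‖), sq_nonneg ‖G z.2‖, sq_nonneg ‖η z.1‖]
      calc _ = heatKernel t (z.1 - z.2) * (‖G z.2‖ * ‖η z.1‖) := by ring
        _ ≤ heatKernel t (z.1 - z.2) * (‖G z.2‖ ^ 2 + ‖η z.1‖ ^ 2) := by gcongr
        _ = _ := by ring
  calc _ = ∫ x, ∫ y, (heatKernel t (x - y) : ℂ) * G y * η x := by
        simp_rw [integral_mul_const]
    _ = ∫ y, ∫ x, (heatKernel t (x - y) : ℂ) * G y * η x := integral_integral_swap hint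
    _ = _ := by
        simp_rw [← integral_const_mul]
        refine integral_congr_ae (Eventually.of_forall fun y => ?_)
        refine integral_congr_ae (Eventually.of_forall fun x => ?_)
        simp only [heatKernel_sub_comm t y x]
        ring

/-- On `L²` the convolution with the heat kernel is the Fourier multiplier `heatSymbol`: both sides
have the same integrals against smooth functions with compact support, because the convolution and
the Fourier transform can be moved to the test function. -/
theorem fourier_heatConvolution_toLp [NeZero n] {t : ℝ} (ht : 0 < t)
    {G : EuclideanSpace ℝ (Fin n) → ℂ} (hG : MemLp G 2)
    (hH : MemLp (fun x => ∫ y, (heatKernel t (x - y) : ℂ) * G y) 2) :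
    (𝓕 (hH.toLp _) : Lp ℂ 2 (volume : Measure (EuclideanSpace ℝ (Fin n)))) =ᵐ[volume]
      fun ξ => heatSymbol t ξ *
        (𝓕 (hG.toLp G) : Lp ℂ 2 (volume : Measure (EuclideanSpace ℝ (Fin n)))) ξ := by
  have hM : MemLp (fun ξ => (heatSymbol t ξ : ℂ) *
      (𝓕 (hG.toLp G) : Lp ℂ 2 (volume : Measure (EuclideanSpace ℝ (Fin n)))) ξ) 2 := by
    refine memLp_mul_of_bounded (K := 1) (Lp.memLp _)
      (Complex.continuous_ofReal.comp (continuous_heatSymbol t)).measurable fun ξ => ?_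
    simpa [abs_of_pos (heatSymbol_pos t ξ)] using heatSymbol_le_one ht ξ
  -- duality with the Fourier transform of a Schwartz function
  have dual : ∀ (F : EuclideanSpace ℝ (Fin n) → ℂ) (hF : MemLp F 2)
      (ψ : 𝓢(EuclideanSpace ℝ (Fin n), ℂ)),
      ∫ ξ, ψ ξ * (𝓕 (hF.toLp F) : Lp ℂ 2 (volume : Measure (EuclideanSpace ℝ (Fin n)))) ξ =
        ∫ x, F x * 𝓕 ψ x := by
    intro F hF ψ
    have h := congrArg (fun D : 𝓢'(EuclideanSpace ℝ (Fin n), ℂ) => D ψ)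
      (Lp.fourier_toTemperedDistribution_eq (hF.toLp F))
    simp only [TemperedDistribution.fourier_apply, Lp.toTemperedDistribution_apply,
      smul_eq_mul] at h
    rw [← h]
    refine integral_congr_ae ?_
    filter_upwards [hF.coeFn_toLp] with x hx
    rw [hx, mul_comm]
  refine ae_eq_of_integral_contDiff_smul_eq ((Lp.memLp _).locallyIntegrable (by norm_num))
    (hM.locallyIntegrable (by norm_num)) fun g g_smooth g_cpt => ?_
  have hg₁ : HasCompactSupport (Complex.ofRealCLM ∘ g) := g_cpt.comp_left rfl
  have hg₂ : ContDiff ℝ (⊤ : ℕ∞) (Complex.ofRealCLM ∘ g) := by fun_prop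
  set ψ : 𝓢(EuclideanSpace ℝ (Fin n), ℂ) := hg₁.toSchwartzMap hg₂ with hψ
  have hψg : ∀ x, ψ x = g x := fun x => rfl
  calc _ = ∫ ξ, ψ ξ * (𝓕 (hH.toLp _) : Lp ℂ 2 (volume : Measure (EuclideanSpace ℝ (Fin n)))) ξ := by
        simp_rw [hψg, Complex.real_smul]
    _ = ∫ x, (∫ y, (heatKernel t (x - y) : ℂ) * G y) * 𝓕 ψ x := dual _ hH ψ
    _ = ∫ y, G y * ∫ x, (heatKernel t (y - x) : ℂ) * 𝓕 ψ x :=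
        integral_heatConvolution_mul ht hG ((𝓕 ψ).memLp 2 volume)
    _ = ∫ y, G y * 𝓕 (smulLeftCLM ℂ (fun ξ => (heatSymbol t ξ : ℂ)) ψ) y := by
        simp_rw [heatConvolution_fourier ht]
    _ = _ := by
        rw [← dual G hG]
        refine integral_congr_ae (Eventually.of_forall fun ξ => ?_)
        simp only [smulLeftCLM_apply_apply (hasTemperateGrowth_heatSymbol ht), hψg,
          smul_eq_mul, Complex.real_smul]
        ring

/-- A level set of the multiplier is contained in a sphere, hence negligible. -/
theorem ae_mul_heatSymbol_ne_one [NeZero n] {t : ℝ} (ht : 0 < t) (κ : ℝ) :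
    ∀ᵐ ξ : EuclideanSpace ℝ (Fin n), κ * heatSymbol t ξ ≠ 1 := by
  have hs := Measure.addHaar_sphere (volume : Measure (EuclideanSpace ℝ (Fin n))) 0
    (Real.sqrt (Real.log κ / (4 * Real.pi ^ 2 * t)))
  refine ae_iff.2 (measure_mono_null (fun ξ hξ => ?_) hs)
  have h1 : κ * heatSymbol t ξ = 1 := not_not.1 hξ
  have h2 : κ = Real.exp (4 * Real.pi ^ 2 * t * ‖ξ‖ ^ 2) := by
    rw [heatSymbol, Real.exp_neg] at h1
    exact (mul_inv_eq_one₀ (Real.exp_ne_zero _)).1 h1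
  rw [mem_sphere_zero_iff_norm, h2, Real.log_exp, mul_div_cancel_left₀ _ (by positivity),
    Real.sqrt_sq (norm_nonneg _)]

end HeatFourier

/-! ### Exponents at most two -/

section SmallExponents

open Filter Topology FourierTransform

variable {n : ℕ}

theorem integrable_weightedMeasure_iff (ρ : ℝ) {F : EuclideanSpace ℝ (Fin n) → ℂ} :
    Integrable F (weightedMeasure n ρ) ↔ Integrable fun x => (phi ρ x : ℂ) ^ 2 * F x := by
  rw [weightedMeasure, integrable_withDensity_iff_integrable_smul' (measurable_weight ρ)
    (Eventually.of_forall fun _ => ENNReal.ofReal_lt_top)]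
  refine integrable_congr (Eventually.of_forall fun x => ?_)
  simp [ENNReal.toReal_ofReal (sq_nonneg (phi ρ x))]

theorem integral_weightedMeasure (ρ : ℝ) (F : EuclideanSpace ℝ (Fin n) → ℂ) :
    ∫ x, F x ∂weightedMeasure n ρ = ∫ x, (phi ρ x : ℂ) ^ 2 * F x := by
  rw [weightedMeasure, integral_withDensity_eq_integral_toReal_smul (measurable_weight ρ)
    (Eventually.of_forall fun _ => ENNReal.ofReal_lt_top)]
  refine integral_congr_ae (Eventually.of_forall fun x => ?_)
  simp [ENNReal.toReal_ofReal (sq_nonneg (phi ρ x))]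

/-- In terms of `φ_{iρ} f` the operators are multiples of the heat semigroup. -/
theorem phi_mul_conjHeatFun [NeZero n] (ρ c : ℝ) {t : ℝ≥0} (ht : 0 < t)
    (f : EuclideanSpace ℝ (Fin n) → ℂ) (x : EuclideanSpace ℝ (Fin n)) :
    (phi ρ x : ℂ) * conjHeatFun ρ c t f x = (Real.exp ((c - ρ ^ 2) * t) : ℂ) *
      ∫ y, (heatKernel (t : ℝ) (x - y) : ℂ) * ((phi ρ y : ℂ) * f y) := by
  have hφ : (phi ρ x : ℂ) ≠ 0 := Complex.ofReal_ne_zero.2 (phi_pos ρ x).ne'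
  have he : Real.exp ((c - ρ ^ 2) * t) = Real.exp (c * t) * Real.exp (-(t * ρ ^ 2)) := by
    rw [← Real.exp_add]
    congr 1
    ring
  rw [conjHeatFun, heatOp, if_neg ht.ne', he]
  push_cast
  field_simp

/-- The dual exponent `q` of `p < 2` exceeds `2`, hence `φ_{iρ}⁻¹ ∈ L^q (φ_{iρ}² dx)`. -/
theorem memLp_inv_phi [NeZero n] {ρ : ℝ} (hρ : 0 < ρ) {p q : ℝ≥0∞} (hp2 : p < 2)
    [ENNReal.HolderConjugate q p] :
    MemLp (fun x : EuclideanSpace ℝ (Fin n) => (phi ρ x : ℂ)⁻¹) q (weightedMeasure n ρ) := by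
  obtain ⟨C, hC, hlow⟩ := exists_mul_exp_le_phi (n := n) hρ hρ
  have hlow' : ∀ x : EuclideanSpace ℝ (Fin n), C ≤ phi ρ x := fun x =>
    (le_mul_of_one_le_right hC.le (Real.one_le_exp (by positivity))).trans (hlow x)
  have hm : Measurable fun x : EuclideanSpace ℝ (Fin n) => (phi ρ x : ℂ)⁻¹ :=
    (Complex.measurable_ofReal.comp (measurable_phi ρ)).inv
  rcases eq_or_ne q ∞ with rfl | hq
  · refine memLp_top_of_bound hm.aestronglyMeasurable C⁻¹ (Eventually.of_forall fun x => ?_)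
    rw [norm_inv, Complex.norm_real, Real.norm_of_nonneg (phi_pos ρ x).le]
    exact inv_anti₀ hC (hlow' x)
  · have hq2 : 2 < q := by
      by_contra! hle
      have h1 := ENNReal.HolderConjugate.inv_add_inv_eq_one q p
      have h2 : (2 : ℝ≥0∞)⁻¹ + 2⁻¹ < q⁻¹ + p⁻¹ :=
        ENNReal.add_lt_add_of_le_of_lt (by simp) (ENNReal.inv_le_inv.2 hle)
          (ENNReal.inv_lt_inv.2 hp2)
      rw [h1, ENNReal.inv_two_add_inv_two] at h2
      exact lt_irrefl _ h2
    have hQ : 2 < q.toReal := by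
      simpa using (ENNReal.toReal_lt_toReal ENNReal.ofNat_ne_top hq).2 hq2
    have hr : 0 < (1 - 2 / q.toReal) * ρ := by
      refine mul_pos (sub_pos.2 ?_) hρ
      rw [div_lt_one (by linarith)]
      exact hQ
    refine (memLp_exp_div_phi (n := n) hρ hq2 hq hr).ae_eq (Eventually.of_forall fun x => ?_)
    simp

/-- Hölder's inequality for `∫ φ_{iρ} f dx = ∫ φ_{iρ}⁻¹ f φ_{iρ}² dx`. -/
theorem integrable_phi_mul [NeZero n] {ρ : ℝ} (hρ : 0 < ρ) {p : ℝ≥0∞} [hp : Fact (1 ≤ p)]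
    (hp2 : p < 2) {f : EuclideanSpace ℝ (Fin n) → ℂ} (hf : MemLp f p (weightedMeasure n ρ)) :
    Integrable fun x => (phi ρ x : ℂ) * f x := by
  have hconj : ENNReal.HolderConjugate p (1 - p⁻¹)⁻¹ :=
    ENNReal.HolderConjugate.inv_one_sub_inv' hp.out
  have : ENNReal.HolderConjugate (1 - p⁻¹)⁻¹ p := hconj.symm
  have h := memLp_one_iff_integrable.1
    (hf.mul (r := 1) (memLp_inv_phi (n := n) (q := (1 - p⁻¹)⁻¹) hρ hp2))
  refine ((integrable_weightedMeasure_iff ρ).1 h).congr (Eventually.of_forall fun x => ?_)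
  have hφ : (phi ρ x : ℂ) ≠ 0 := Complex.ofReal_ne_zero.2 (phi_pos ρ x).ne'
  simp only [Pi.mul_apply]
  field_simp

theorem memLp_phi_mul [NeZero n] (ρ : ℝ) {f : EuclideanSpace ℝ (Fin n) → ℂ}
    (hf : MemLp f 2 (weightedMeasure n ρ)) : MemLp (fun x => (phi ρ x : ℂ) * f x) 2 := by
  have hm : AEStronglyMeasurable (fun x => (phi ρ x : ℂ) * f x) :=
    (Complex.measurable_ofReal.comp (measurable_phi ρ)).aestronglyMeasurable.mul
      (hf.1.mono_ac (ac_weighted ρ))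
  rw [memLp_two_iff_integrable_sq_norm hm]
  have h := ((memLp_two_iff_integrable_sq_norm hf.1).1 hf).ofReal (𝕜 := ℂ)
  refine ((integrable_weightedMeasure_iff ρ).1 h).re.congr (Eventually.of_forall fun x => ?_)
  simp only [norm_mul, mul_pow, Complex.norm_real, Real.norm_eq_abs, sq_abs]
  norm_cast
  exact Complex.re_ofReal_mul _ _

theorem eq_zero_of_phi_mul_ae_eq_zero [NeZero n] (ρ : ℝ) {p : ℝ≥0∞}
    {f : Lp ℂ p (weightedMeasure n ρ)} (h : ∀ᵐ x, (phi ρ x : ℂ) * f x = 0) : f = 0 := by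
  refine (Lp.eq_zero_iff_ae_eq_zero).2 ((weighted_ac ρ).ae_le ?_)
  filter_upwards [h] with x hx
  exact (mul_eq_zero.1 hx).resolve_left (Complex.ofReal_ne_zero.2 (phi_pos ρ x).ne')

theorem phi_mul_conjHeat [NeZero n] (ρ : ℝ) (p : ℝ≥0∞) [Fact (1 ≤ p)] (c : ℝ) {t : ℝ≥0}
    (ht : 0 < t) (f : Lp ℂ p (weightedMeasure n ρ)) :
    ∀ᵐ x, (phi ρ x : ℂ) * conjHeat ρ p c t f x = (Real.exp ((c - ρ ^ 2) * t) : ℂ) *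
      ∫ y, (heatKernel (t : ℝ) (x - y) : ℂ) * ((phi ρ y : ℂ) * f y) := by
  filter_upwards [(ac_weighted ρ).ae_le (conjHeat_coeFn ρ p c t f)] with x hx
  rw [hx, phi_mul_conjHeatFun ρ c ht]

/-- For a periodic point the continuous function `𝓕 (φ_{iρ} f)` vanishes off a sphere, hence
everywhere. -/
theorem eq_zero_of_isPeriodicPoint_of_lt_two [NeZero n] {ρ : ℝ} (hρ : 0 < ρ) {p : ℝ≥0∞}
    [Fact (1 ≤ p)] (hp2 : p < 2) {c : ℝ} {f : Lp ℂ p (weightedMeasure n ρ)}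
    (hf : IsPeriodicPoint (conjHeat ρ p c) f) : f = 0 := by
  obtain ⟨t, ht, hft⟩ := hf
  have ht' : (0 : ℝ) < t := ht
  set G : EuclideanSpace ℝ (Fin n) → ℂ := fun x => (phi ρ x : ℂ) * f x with hG
  have hGi : Integrable G := integrable_phi_mul hρ hp2 (Lp.memLp f)
  have hper : G =ᵐ[volume] fun x => (Real.exp ((c - ρ ^ 2) * t) : ℂ) *
      ∫ y, (heatKernel (t : ℝ) (x - y) : ℂ) * G y := by
    have h := phi_mul_conjHeat ρ p c ht f
    rw [hft] at h
    exact h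
  have hF : ∀ ξ, 𝓕 G ξ = (Real.exp ((c - ρ ^ 2) * t) * heatSymbol t ξ : ℝ) * 𝓕 G ξ := by
    intro ξ
    conv_lhs => rw [Real.fourier_congr_ae hper, Real.fourier_eq']
    have h := fourier_heatConvolution ht' hGi ξ
    rw [Real.fourier_eq'] at h
    rw [Complex.ofReal_mul, mul_assoc, ← h, ← integral_const_mul]
    refine integral_congr_ae (Eventually.of_forall fun x => ?_)
    simp only [smul_eq_mul]
    ring
  have h0 : 𝓕 G =ᵐ[volume] fun _ => 0 := by
    filter_upwards [ae_mul_heatSymbol_ne_one (n := n) ht' (Real.exp ((c - ρ ^ 2) * t))] with ξ hξ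
    by_contra hne
    refine hξ ?_
    have h1 := mul_right_cancel₀ hne ((one_mul _).trans (hF ξ))
    exact_mod_cast h1.symm
  have hc : Continuous (𝓕 G) := VectorFourier.fourierIntegral_continuous
    Real.continuous_fourierChar continuous_inner hGi
  have h1 := (hc.ae_eq_iff_eq volume continuous_const).1 h0
  exact eq_zero_of_phi_mul_ae_eq_zero ρ
    (ae_eq_zero_of_fourier_eq_zero hGi fun ξ => congrFun h1 ξ)

/-- The functional `f ↦ ∫ φ_{iρ} f dx` is an eigenvector of the adjoint operators with positive
eigenvalues. -/
theorem not_isHypercyclic_of_lt_two [NeZero n] {ρ : ℝ} (hρ : 0 < ρ) {p : ℝ≥0∞}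
    [hp : Fact (1 ≤ p)] (hp2 : p < 2) (c : ℝ) : ¬ IsHypercyclic (conjHeat (n := n) ρ p c) := by
  have hconj : ENNReal.HolderConjugate p (1 - p⁻¹)⁻¹ :=
    ENNReal.HolderConjugate.inv_one_sub_inv' hp.out
  have : ENNReal.HolderConjugate (1 - p⁻¹)⁻¹ p := hconj.symm
  have : Fact (1 ≤ (1 - p⁻¹)⁻¹) := ⟨ENNReal.HolderConjugate.one_le _ p⟩
  obtain ⟨l, hl⟩ := exists_pairing (p := p) (memLp_inv_phi (n := n) (q := (1 - p⁻¹)⁻¹) hρ hp2)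
  have hφ : ∀ x : EuclideanSpace ℝ (Fin n), (phi ρ x : ℂ) ≠ 0 := fun x =>
    Complex.ofReal_ne_zero.2 (phi_pos ρ x).ne'
  have hl' : ∀ f : Lp ℂ p (weightedMeasure n ρ), l f = ∫ x, (phi ρ x : ℂ) * f x := by
    intro f
    rw [hl, integral_weightedMeasure]
    refine integral_congr_ae (Eventually.of_forall fun x => ?_)
    have := hφ x
    simp only
    field_simp
  refine not_isHypercyclic_of_functional l (fun h0 => ?_) fun v hd => ?_
  -- on `φ⁻¹` times the indicator of the unit ball the functional is the volume of the ball
  · have hw : MemLp ((ball (0 : EuclideanSpace ℝ (Fin n)) 1).indicator fun x => (phi ρ x : ℂ)⁻¹) p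
        (weightedMeasure n ρ) := by
      obtain ⟨C, hC, hlow⟩ := exists_mul_exp_le_phi (n := n) hρ hρ
      refine (memLp_indicator_const p (measurableSet_ball (x := (0 : EuclideanSpace ℝ (Fin n)))
        (ε := 1)) (C⁻¹ : ℝ) (Or.inr (weightedMeasure_ball_lt_top hρ).ne)).of_le
        ((Complex.measurable_ofReal.comp (measurable_phi ρ)).inv.indicator
          measurableSet_ball).aestronglyMeasurable (Eventually.of_forall fun x => ?_)
      by_cases hx : x ∈ ball (0 : EuclideanSpace ℝ (Fin n)) 1
      · rw [indicator_of_mem hx, indicator_of_mem hx, norm_inv, norm_inv, Complex.norm_real,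
          Real.norm_of_nonneg (phi_pos ρ x).le, Real.norm_of_nonneg hC.le]
        exact inv_anti₀ hC ((le_mul_of_one_le_right hC.le
          (Real.one_le_exp (by positivity))).trans (hlow x))
      · simp [hx]
    have h1 := hl' (hw.toLp _)
    have h2 : ∫ x, (phi ρ x : ℂ) * hw.toLp _ x =
        ∫ x, (ball (0 : EuclideanSpace ℝ (Fin n)) 1).indicator (fun _ => (1 : ℂ)) x := by
      refine integral_congr_ae ?_
      filter_upwards [(ac_weighted ρ).ae_le hw.coeFn_toLp] with x hx
      rw [hx]
      by_cases hxb : x ∈ ball (0 : EuclideanSpace ℝ (Fin n)) 1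
      · rw [indicator_of_mem hxb, indicator_of_mem hxb, mul_inv_cancel₀ (hφ x)]
      · rw [indicator_of_notMem hxb, indicator_of_notMem hxb, mul_zero]
    rw [h0, zero_apply, h2, integral_indicator measurableSet_ball, setIntegral_const] at h1
    have h3 : volume.real (ball (0 : EuclideanSpace ℝ (Fin n)) 1) = 0 := by simpa using h1.symm
    exact (measure_ball_pos volume (0 : EuclideanSpace ℝ (Fin n)) one_pos).ne'
      ((measureReal_eq_zero_iff measure_ball_lt_top.ne).1 h3)
  -- the orbit is mapped into a ray
  · have hray : ∀ t : ℝ≥0, ∃ s : ℝ, 0 ≤ s ∧ l (conjHeat ρ p c t v) = s * l v := by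
      intro t
      rcases eq_or_ne t 0 with rfl | ht
      · refine ⟨1, zero_le_one, ?_⟩
        rw [hl', hl', Complex.ofReal_one, one_mul]
        refine integral_congr_ae ?_
        filter_upwards [(ac_weighted ρ).ae_le (conjHeat_coeFn ρ p c 0 v)] with x hx
        rw [hx, conjHeatFun_zero]
      · have ht' : 0 < t := pos_iff_ne_zero.2 ht
        refine ⟨Real.exp ((c - ρ ^ 2) * t), (Real.exp_pos _).le, ?_⟩
        -- the multiplier is `1` at frequency zero
        have h := fourier_heatConvolution (t := t) ht' (integrable_phi_mul hρ hp2 (Lp.memLp v)) 0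
        simp only [Real.fourier_eq', inner_zero_right, mul_zero, Complex.ofReal_zero, zero_mul,
          Complex.exp_zero, one_smul, heatSymbol, norm_zero, ne_eq, OfNat.ofNat_ne_zero,
          not_false_eq_true, zero_pow, neg_zero, Real.exp_zero, Complex.ofReal_one, one_mul] at h
        rw [hl', hl', ← h, ← integral_const_mul]
        exact integral_congr_ae (phi_mul_conjHeat ρ p c ht' v)
    -- a ray is not dense: it stays away from the opposite point
    rcases eq_or_ne (l v) 0 with h0 | h0
    · obtain ⟨_, ⟨t, rfl⟩, hz⟩ := hd.exists_dist_lt (1 : ℂ) one_pos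
      obtain ⟨s, hs, hst⟩ := hray t
      simp [hst, h0] at hz
    · obtain ⟨_, ⟨t, rfl⟩, hz⟩ := hd.exists_dist_lt (-l v) (norm_pos_iff.2 h0)
      obtain ⟨s, hs, hst⟩ := hray t
      simp only [hst] at hz
      have e : -l v - s * l v = ((-(1 + s) : ℝ) : ℂ) * l v := by push_cast; ring
      rw [dist_eq_norm, e, norm_mul, Complex.norm_real, norm_neg,
        Real.norm_of_nonneg (by linarith)] at hz
      nlinarith [norm_nonneg (l v)]

theorem memLp_heatConvolution_phi_mul [NeZero n] (ρ : ℝ) {t : ℝ≥0} (ht : 0 < t)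
    (f : Lp ℂ 2 (weightedMeasure n ρ)) :
    MemLp (fun x => ∫ y, (heatKernel (t : ℝ) (x - y) : ℂ) * ((phi ρ y : ℂ) * f y)) 2 := by
  -- for `c = ρ²` the heat convolution is `φ T̃_t^c f`
  refine (memLp_phi_mul ρ (Lp.memLp (conjHeat ρ 2 (ρ ^ 2) t f))).ae_eq ?_
  filter_upwards [phi_mul_conjHeat ρ 2 (ρ ^ 2) ht f] with x hx
  rw [hx]
  simp

/-- As for `p < 2`, with the Fourier transform of `φ_{iρ} f` in `L²`. -/
theorem eq_zero_of_isPeriodicPoint_two [NeZero n] (ρ : ℝ) {c : ℝ}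
    {f : Lp ℂ 2 (weightedMeasure n ρ)} (hf : IsPeriodicPoint (conjHeat ρ 2 c) f) : f = 0 := by
  obtain ⟨t, ht, hft⟩ := hf
  have ht' : (0 : ℝ) < t := ht
  have hG := memLp_phi_mul ρ (Lp.memLp f)
  have hH := memLp_heatConvolution_phi_mul ρ ht f
  have hper : hG.toLp _ = (Real.exp ((c - ρ ^ 2) * t) : ℂ) • hH.toLp _ := by
    rw [← MemLp.toLp_const_smul]
    refine MemLp.toLp_congr _ _ ?_
    have h := phi_mul_conjHeat ρ 2 c ht f
    rw [hft] at h
    exact h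
  have h1 := congrArg (fun g : Lp ℂ 2 (volume : Measure (EuclideanSpace ℝ (Fin n))) => 𝓕 g) hper
  simp only [FourierTransform.fourier_smul] at h1
  have h0 : (𝓕 (hG.toLp _) : Lp ℂ 2 (volume : Measure (EuclideanSpace ℝ (Fin n)))) = 0 := by
    refine (Lp.eq_zero_iff_ae_eq_zero).2 ?_
    filter_upwards [ae_mul_heatSymbol_ne_one (n := n) ht' (Real.exp ((c - ρ ^ 2) * t)),
      fourier_heatConvolution_toLp ht' hG hH, Lp.coeFn_smul (Real.exp ((c - ρ ^ 2) * t) : ℂ)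
        (𝓕 (hH.toLp _) : Lp ℂ 2 (volume : Measure (EuclideanSpace ℝ (Fin n))))] with ξ h2 h3 h4
    by_contra hne
    refine h2 ?_
    rw [← h1, Pi.smul_apply, h3, smul_eq_mul, ← mul_assoc] at h4
    have h5 := mul_right_cancel₀ hne ((one_mul _).trans h4)
    exact_mod_cast h5.symm
  have h2 : hG.toLp _ = 0 := norm_eq_zero.1 (by rw [← Lp.norm_fourier_eq, h0, norm_zero])
  refine eq_zero_of_phi_mul_ae_eq_zero ρ ?_
  filter_upwards [hG.coeFn_toLp, (Lp.eq_zero_iff_ae_eq_zero).1 h2] with x h3 h4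
  rw [← h3, h4]
  rfl

/-- On the Hilbert space `L² (φ_{iρ}² dx)` the operators are positive. -/
theorem re_inner_conjHeat_nonneg [NeZero n] (ρ c : ℝ) (t : ℝ≥0)
    (f : Lp ℂ 2 (weightedMeasure n ρ)) : 0 ≤ (inner ℂ f (conjHeat ρ 2 c t f)).re := by
  rcases eq_or_ne t 0 with rfl | ht0
  · have h : conjHeat ρ 2 c 0 f = f := by
      refine Lp.ext ((conjHeat_coeFn ρ 2 c 0 f).trans ?_)
      rw [conjHeatFun_zero]
    rw [h]
    exact inner_self_nonneg (𝕜 := ℂ)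
  have ht : 0 < t := pos_iff_ne_zero.2 ht0
  have ht' : (0 : ℝ) < t := ht
  have hG := memLp_phi_mul ρ (Lp.memLp f)
  have hH := memLp_heatConvolution_phi_mul ρ ht f
  have key : inner ℂ f (conjHeat ρ 2 c t f) = (Real.exp ((c - ρ ^ 2) * t) : ℂ) *
      inner ℂ (hG.toLp _) (hH.toLp _) := by
    rw [L2.inner_def, L2.inner_def, integral_weightedMeasure, ← integral_const_mul]
    refine integral_congr_ae ?_
    filter_upwards [phi_mul_conjHeat ρ 2 c ht f, hG.coeFn_toLp, hH.coeFn_toLp] with x h1 h2 h3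
    rw [h2, h3, RCLike.inner_apply, RCLike.inner_apply, map_mul, Complex.conj_ofReal]
    linear_combination (phi ρ x : ℂ) * (starRingEnd ℂ) (f x) * h1
  rw [key, Complex.re_ofReal_mul, ← Lp.inner_fourier_eq, L2.inner_def]
  refine mul_nonneg (Real.exp_pos _).le ?_
  have h2 : ∫ ξ, inner ℂ ((𝓕 (hG.toLp _) : Lp ℂ 2 (volume : Measure (EuclideanSpace ℝ (Fin n)))) ξ)
      ((𝓕 (hH.toLp _) : Lp ℂ 2 (volume : Measure (EuclideanSpace ℝ (Fin n)))) ξ) =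
      ∫ ξ, ((heatSymbol t ξ * ‖(𝓕 (hG.toLp _) :
        Lp ℂ 2 (volume : Measure (EuclideanSpace ℝ (Fin n)))) ξ‖ ^ 2 : ℝ) : ℂ) := by
    refine integral_congr_ae ?_
    filter_upwards [fourier_heatConvolution_toLp ht' hG hH] with ξ hξ
    rw [hξ, RCLike.inner_apply, mul_assoc, Complex.mul_conj, Complex.normSq_eq_norm_sq]
    push_cast
    rfl
  rw [h2, integral_complex_ofReal, Complex.ofReal_re]
  exact integral_nonneg fun ξ => mul_nonneg (heatSymbol_pos _ _).le (sq_nonneg _)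

/-- By positivity, `|T̃_t^c v + v| ≥ |v|` in norm, so that the orbit of `v ≠ 0` is not dense. -/
theorem not_isHypercyclic_two [NeZero n] {ρ : ℝ} (hρ : 0 < ρ) (c : ℝ) :
    ¬ IsHypercyclic (conjHeat (n := n) ρ 2 c) := by
  rintro ⟨v, hv⟩
  rcases eq_or_ne v 0 with rfl | h0
  -- the space is nontrivial
  · have hfin := weightedMeasure_ball_lt_top (n := n) hρ
    set u : Lp ℂ 2 (weightedMeasure n ρ) :=
      indicatorConstLp 2 measurableSet_ball hfin.ne (1 : ℂ) with hu
    have hune : u ≠ 0 := by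
      intro h
      have h1 := congrArg norm h
      rw [hu, norm_indicatorConstLp two_ne_zero ENNReal.ofNat_ne_top, norm_zero, norm_one, one_mul,
        Real.rpow_eq_zero measureReal_nonneg (by norm_num)] at h1
      exact (measure_ball_pos volume (0 : EuclideanSpace ℝ (Fin n)) one_pos).ne'
        (ac_weighted ρ ((measureReal_eq_zero_iff hfin.ne).1 h1))
    obtain ⟨_, ⟨t, rfl⟩, hz⟩ := hv.exists_dist_lt u (norm_pos_iff.2 hune)
    simp at hz
  · obtain ⟨_, ⟨t, rfl⟩, hz⟩ := hv.exists_dist_lt (-v) (norm_pos_iff.2 h0)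
    rw [dist_comm, dist_eq_norm, sub_neg_eq_add] at hz
    have h1 := re_inner_conjHeat_nonneg ρ c t v
    have h2 : ‖v‖ ^ 2 ≤ (inner ℂ v (conjHeat ρ 2 c t v + v)).re := by
      rw [inner_add_right, Complex.add_re]
      have : (inner ℂ v v).re = ‖v‖ ^ 2 := inner_self_eq_norm_sq (𝕜 := ℂ) v
      linarith
    have h3 := (Complex.re_le_norm _).trans (norm_inner_le_norm (𝕜 := ℂ) v (conjHeat ρ 2 c t v + v))
    have h4 : 0 < ‖v‖ := norm_pos_iff.2 h0
    nlinarith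

end SmallExponents

end HeatChaos

theorem theorem1p3 (n : ℕ) [NeZero n] (ρ : ℝ) (hρ : 0 < ρ) :
    (∀ (p : ℝ≥0∞) [Fact (1 ≤ p)], 2 < p → p < ∞ → ∀ c : ℝ,
      (HeatChaos.IsChaotic (HeatChaos.conjHeat (n := n) ρ p c) ↔
        HeatChaos.criticalConst ρ p < c)) ∧
    (∀ c : ℝ, ¬ HeatChaos.IsChaotic (HeatChaos.conjHeat (n := n) ρ ∞ c)) ∧
    (∀ (p : ℝ≥0∞) [Fact (1 ≤ p)], p ≤ 2 → ∀ c : ℝ,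
      ¬ HeatChaos.IsHypercyclic (HeatChaos.conjHeat (n := n) ρ p c) ∧
      ∀ f : Lp ℂ p (HeatChaos.weightedMeasure n ρ),
        HeatChaos.IsPeriodicPoint (HeatChaos.conjHeat ρ p c) f → f = 0) := by
  refine ⟨fun p _ hp2 hp c => ?_, fun c h => HeatChaos.not_dense_periodic_top hρ c h.2,
    fun p _ hp2 c => ?_⟩
  · have hcrit : HeatChaos.criticalConst ρ p = ρ ^ 2 * (1 - (1 - 2 / p.toReal) ^ 2) := by
      rw [HeatChaos.criticalConst, HeatChaos.gammaExp, sq_abs]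
      ring
    rw [hcrit]
    refine ⟨fun h => ?_, HeatChaos.isChaotic_conjHeat hρ hp2 hp.ne⟩
    by_contra! hc
    exact HeatChaos.not_isHypercyclic_of_le hρ hp2 hp.ne hc h.1
  · rcases hp2.lt_or_eq with hlt | rfl
    · exact ⟨HeatChaos.not_isHypercyclic_of_lt_two hρ hlt c,
        fun f => HeatChaos.eq_zero_of_isPeriodicPoint_of_lt_two hρ hlt⟩
    · exact ⟨HeatChaos.not_isHypercyclic_two hρ c,
        fun f => HeatChaos.eq_zero_of_isPeriodicPoint_two ρ⟩
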